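/- Let $m,n,N$ be positive integers, let $Q>1$ be a divisor of $N$ with $\gcd(Q,N/Q)=1$, and let $\varepsilon=\pm1$. Let $S_2(\Gamma_0(N))$ be the space of cusp forms of weight $2$ for $\Gamma_0(N)$. Write $f(z)=\sum_{k\ge1}a_k(f)e^{2\pi i kz}$ for the Fourier expansion of $f\in S_2(\Gamma_0(N))$, let $\langle f,g\rangle=\int_D\overline{f(x+iy)}\,g(x+iy)\,dx\,dy$ be the Petersson product, where $D$ is any fundamental domain for the action of $\Gamma_0(N)$ on the upper half-plane, and put $\|f\|^2=\langle f,f\rangle$. Let $w_Q$ be the Atkin–Lehner involution $$f_{|w_Q}(z)=\frac{Q}{(Nz+Qt)^2}\,f\!\left(\frac{Qz+y}{Nz+Qt}\right),$$ where $y,t$ are any integers such that $W_Q=\begin{pmatrix}Q&y\\N&Qt\end{pmatrix}$ has determinant $Q$. Let $\mathcal B$ be an eigenbasis of $S_2(\Gamma_0(N))$ in the following sense: a basis that is orthogonal for the Petersson product and whose elements are eigenvectors of $w_Q$. Then $$\frac{1}{2\pi\sqrt{mn}}\sum_{\substack{f\in\mathcal B\\ f_{|w_Q}=\varepsilon f}}\frac{\overline{a_m(f)}\,a_n(f)}{\|f\|^2}=\delta_{mn}-2\pi\sum_{\substack{c>0\\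 N\mid c}}\frac{S(m,n;c)}{c}J_1\!\left(\frac{4\pi\sqrt{mn}}{c}\right)-2\pi\varepsilon\sum_{\substack{c>0,\ (N/Q)\mid c\\ \gcd(c,Q)=1}}\frac{S(m,nQ^{-1};c)}{c\sqrt Q}J_1\!\left(\frac{4\pi\sqrt{mn}}{c\sqrt Q}\right),$$ where both series on the right converge absolutely. Here $Q^{-1}$ is the inverse of $Q$ modulo $c$, the Kloosterman sum is $S(a,b;c)=\sum_{k\in(\mathbb Z/c\mathbb Z)^*}e^{2\pi i(ak+bk^{-1})/c}$, and $J_1(z)=\sum_{k\ge0}\frac{(-1)^k}{k!\,(k+1)!}\left(\frac z2\right)^{2k+1}$ is the Bessel function of the first kind and order $1$. -/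

import Mathlib

open UpperHalfPlane CongruenceSubgroup MeasureTheory
open scoped MatrixGroups ModularForm ComplexConjugate Real

noncomputable section

/-- `S₂(Γ₀(N))`: the complex vector space of cusp forms of weight `2` for `Γ₀(N)`. -/
abbrev S2Gamma0 (N : ℕ) : Type :=
  CuspForm ((Gamma0 N).map (Matrix.SpecialLinearGroup.mapGL ℝ)) 2

/-- The `n`-th Fourier coefficient `a_n(f)`, where `f(z) = ∑ a_n(f) e^{2iπnz}`. -/
def fourierCoeff0 {N : ℕ} (n : ℕ) (f : S2Gamma0 N) : ℂ :=
  (qExpansion 1 f).coeff n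

/-- `D` is a (measurable, up to null sets) fundamental domain for the action of `Γ₀(N)` on `ℍ`.
As `-1 ∈ Γ₀(N)` acts trivially, the group to consider is the group of transformations of `ℍ`
induced by `Γ₀(N)`. The measure `volume` on `ℍ` is `dx dy / y ^ 2`, which has the same null sets
as `dx dy`. -/
def IsGamma0FundamentalDomain (N : ℕ) (D : Set ℍ) : Prop :=
  IsFundamentalDomain (MulAction.toPermHom (Gamma0 N) ℍ).range D (volume : Measure ℍ)

/-- The Petersson product `⟨f, g⟩ = ∫_D conj (f (x + iy)) g (x + iy) dx dy`.
Here `petersson 2 f g z = conj (f z) * g z * y ^ 2`, and `volume` on `ℍ` is `dx dy / y ^ 2`. -/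
def peterssonInner {N : ℕ} (D : Set ℍ) (f g : S2Gamma0 N) : ℂ :=
  ∫ z in D, petersson 2 f g z ∂(volume : Measure ℍ)

/-- `W` is an Atkin-Lehner matrix `W_Q = (Q, y; N, Q t)` with `y, t ∈ ℤ` and `det W_Q = Q`. -/
def IsAtkinLehnerMatrix (N Q : ℕ) (W : GL (Fin 2) ℝ) : Prop :=
  ∃ y t : ℤ, W.val = !![(Q : ℝ), (y : ℝ); (N : ℝ), (Q : ℝ) * (t : ℝ)] ∧ W.val.det = (Q : ℝ)

/-- The Kloosterman sum `S(a, b; c) = ∑_{k ∈ (ℤ/cℤ)ˣ} e^{2iπ(a k + b k⁻¹)/c}`, for residue classes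
`a, b` modulo `c`; the function `ZMod.stdAddChar` is `j mod c ↦ e^{2iπj/c}`. -/
def kloostermanSum (c : ℕ) [NeZero c] (a b : ZMod c) : ℂ :=
  ∑ k : (ZMod c)ˣ, ZMod.stdAddChar (a * (k : ZMod c) + b * ((k⁻¹ : (ZMod c)ˣ) : ZMod c))

/-- The Bessel function of the first kind and order `1`. -/
def besselJ1 (z : ℂ) : ℂ :=
  ∑' n : ℕ, (-1) ^ n / ((n.factorial : ℂ) * ((n + 1).factorial : ℂ)) * (z / 2) ^ (2 * n + 1)

/-- The term `S(m, n; c) / c * J₁(4π√(mn) / c)`. -/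
def kloostermanTerm (m n c : ℕ) [NeZero c] : ℂ :=
  kloostermanSum c (m : ZMod c) (n : ZMod c) / (c : ℂ) *
    besselJ1 (4 * π * (√((m : ℝ) * n) : ℝ) / (c : ℂ))

/-- The term `S(m, n Q⁻¹; c) / (c √Q) * J₁(4π√(mn) / (c √Q))`, where `Q⁻¹` is the inverse of `Q`
modulo `c` (used only for `c` prime to `Q`). -/
def kloostermanTermTwisted (Q m n c : ℕ) [NeZero c] : ℂ :=
  kloostermanSum c (m : ZMod c) ((n : ZMod c) * (Q : ZMod c)⁻¹) / ((c : ℂ) * (√(Q : ℝ) : ℝ)) *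
    besselJ1 (4 * π * (√((m : ℝ) * n) : ℝ) / ((c : ℂ) * (√(Q : ℝ) : ℝ)))

/-- `B` is an eigenbasis of `S₂(Γ₀(N))` for the Atkin-Lehner involution `w_Q`, given by the matrix
`W`: it is orthogonal for the Petersson product (computed on the fundamental domain `D`), and each
of its members is an eigenvector of `f ↦ f|W`. -/
structure IsAtkinLehnerEigenbasis {N : ℕ} (D : Set ℍ) (W : GL (Fin 2) ℝ) {ι : Type*}
    (B : Module.Basis ι ℂ (S2Gamma0 N)) : Prop where
  orthogonal : ∀ i j, i ≠ j → peterssonInner D (B i) (B j) = 0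
  eigenvector : ∀ i, ∃ a : ℂ, (⇑(B i) : ℍ → ℂ) ∣[(2 : ℤ)] W = a • (⇑(B i) : ℍ → ℂ)

end

/-! Let G be the weight 2 Poincaré series of index m. If G is a cusp form with ⟨G, f⟩ = a_m(f)/(4πm)
for every f, then orthogonality gives its coordinates in the eigenbasis: G = ∑ conj(a_m(f)) /
(4πm‖f‖²) · f. Since W² acts like an element of Γ₀(N), every eigenvalue a is ±1 and (1 + εa)/2
selects a = ε. So the spectral sum equals 2πm (a_n(G) + ε a_n(G|W)), which is
`finsum_eigenbasis_eq`. The two coefficients are the two Kloosterman series, the first with the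
identity term added.

In weight 2 the series defining G does not converge absolutely, so G is built from truncations: only
the terms with Im γz > 2⁻ᵏ are kept. The sum is then finite at each point and exactly modular, but
no longer holomorphic. The exponential is restricted to the strip 0 ≤ Re z < 1, so that the sum runs
over the whole group instead of cosets of translations; the factor 1/2 accounts for ±γ.

The Fourier coefficients of a truncation are sums of Kloosterman sums times cut-off Bessel integrals
(`hasSum_poincareCoeff`). The Bessel integral with C = Qc² is O(C^(-15/16) y^(-15/16)), uniformly in
the cutoff (`norm_besselIntegral_le`), and Kloosterman's elementary bound of order c^(3/4) d(c)
makes the sum over c converge (`norm_kloostermanSum_mul_rpow_le`). Hence the coefficients are at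
most 1 + K y^(-15/16) for every cutoff (`exists_norm_poincareCoeff_le`) and converge as the cutoff
is removed (`tendsto_poincareCoeff`).

Unfolding turns the squared Petersson norm of a difference of truncations into an integral of such a
coefficient over 0 < y ≤ 2⁻ʲ, which is O(2^(-j/16)) because -15/16 > -1 (`exists_normSqOn_sub_le`).
The limiting coefficients define a holomorphic function `limitForm`. Parseval and Fatou identify it
with the almost everywhere limit of the truncations (`ae_tendsto_limitForm`), so it is modular; it
is square integrable, so by the mean value inequality it vanishes at the cusps
(`isZeroAtImInfty_slash`). Unfolding against f and passing to the limit gives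
`peterssonInner_poincareForm`.

For the involution, write W = V diag(Q, 1) with V in SL(2, ℤ). Then Γ₀(N)V is the set of matrices
with lower row (c, d), N/Q ∣ c and Q ∣ d, and the same computation applies to the truncations of
G|W. Their L² convergence on a rectangle shows that the limiting coefficients are those of G|W
(`fourierCoeff0_of_eq_slash`). -/

noncomputable section

/-! ### Kloosterman's bound for Kloosterman sums -/

section Kloosterman

/-- By Bézout, ax = 0 forces gcd(a, c)x = 0, and a cyclic group has at most g elements killed by g.
-/
theorem ZMod.card_filter_mul_eq_zero_le (c : ℕ) [NeZero c] (a : ZMod c) :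
    (Finset.univ.filter fun x : ZMod c => a * x = 0).card ≤ Nat.gcd a.val c := by
  have hc : 0 < c := Nat.pos_of_ne_zero (NeZero.ne c)
  have hg : 0 < Nat.gcd a.val c := Nat.gcd_pos_of_pos_right _ hc
  refine le_trans (Finset.card_le_card ?_) (IsAddCyclic.card_nsmul_eq_zero_le (α := ZMod c) hg)
  intro x hx
  simp only [Finset.mem_filter, Finset.mem_univ, true_and] at hx ⊢
  have h := Nat.gcd_eq_gcd_ab a.val c
  have h2 : ((Nat.gcd a.val c : ℕ) : ZMod c) = a * ((Nat.gcdA a.val c : ℤ) : ZMod c) := by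
    have := congrArg (Int.cast : ℤ → ZMod c) h
    push_cast at this
    simpa using this
  rw [nsmul_eq_mul, h2, mul_right_comm, hx, zero_mul]

theorem ZMod.card_filter_mul_eq_le (c : ℕ) [NeZero c] (a e : ZMod c) :
    (Finset.univ.filter fun x : ZMod c => a * x = e).card ≤ Nat.gcd a.val c := by
  classical
  by_cases h : ∃ x0, a * x0 = e
  · obtain ⟨x0, hx0⟩ := h
    refine le_trans ?_ (ZMod.card_filter_mul_eq_zero_le c a)
    refine Finset.card_le_card_of_injOn (fun x => x - x0) ?_ (fun x _ y _ h => by simpa using h)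
    intro x hx
    simp only [Finset.coe_filter, Finset.mem_univ, true_and, Set.mem_ofPred_eq] at hx ⊢
    rw [mul_sub, hx, hx0, sub_self]
  · rw [Finset.filter_false_of_mem (fun x _ hx => h ⟨x, hx⟩)]
    simp

theorem ZMod.gcd_val_natCast_le (c m : ℕ) [NeZero c] (hm : 0 < m) :
    Nat.gcd (m : ZMod c).val c ≤ m := by
  refine Nat.le_of_dvd hm ?_
  have h1 : Nat.gcd (m : ZMod c).val c = Nat.gcd m c := by
    rw [ZMod.val_natCast, Nat.gcd_comm, Nat.gcd_comm m, Nat.gcd_comm c, ← Nat.gcd_rec, Nat.gcd_comm]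
  rw [h1]
  exact Nat.gcd_dvd_left _ _

theorem ZMod.gcd_val_mul_le (c : ℕ) [NeZero c] (u v : ZMod c) :
    Nat.gcd (u * v).val c ≤ Nat.gcd u.val c * Nat.gcd v.val c := by
  have hc : 0 < c := Nat.pos_of_ne_zero (NeZero.ne c)
  have h1 : Nat.gcd (u * v).val c = Nat.gcd c (u.val * v.val) := by
    rw [ZMod.val_mul, ← Nat.gcd_rec, Nat.gcd_comm]
  rw [h1, Nat.gcd_comm u.val, Nat.gcd_comm v.val]
  exact Nat.le_of_dvd (Nat.mul_pos (Nat.gcd_pos_of_pos_left _ hc) (Nat.gcd_pos_of_pos_left _ hc))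
    (Nat.gcd_mul_right_dvd_mul_gcd _ _ _)

/-- Bound gcd(u, c) by the sum of the divisors g of c that divide u. Each g divides at most c/g
residues and so contributes at most c. -/
theorem ZMod.sum_gcd_val_le (c : ℕ) [NeZero c] :
    ∑ u : ZMod c, Nat.gcd u.val c ≤ c * c.divisors.card := by
  have hc : c ≠ 0 := NeZero.ne c
  calc ∑ u : ZMod c, Nat.gcd u.val c
      ≤ ∑ u : ZMod c, ∑ g ∈ c.divisors, if g ∣ u.val then g else 0 := by
        refine Finset.sum_le_sum fun u _ => ?_
        have hmem : Nat.gcd u.val c ∈ c.divisors := Nat.mem_divisors.2 ⟨Nat.gcd_dvd_right _ _, hc⟩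
        refine le_trans ?_ (Finset.single_le_sum (fun _ _ => Nat.zero_le _) hmem)
        rw [if_pos (Nat.gcd_dvd_left _ _)]
    _ = ∑ g ∈ c.divisors, (Finset.univ.filter fun u : ZMod c => g ∣ u.val).card * g := by
        rw [Finset.sum_comm]
        refine Finset.sum_congr rfl fun g _ => ?_
        rw [← Finset.sum_filter, Finset.sum_const, smul_eq_mul]
    _ ≤ ∑ g ∈ c.divisors, c := by
        refine Finset.sum_le_sum fun g hg => ?_
        have hgc := Nat.dvd_of_mem_divisors hg
        have hg0 : 0 < g := Nat.pos_of_mem_divisors hg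
        have hq : 0 < c / g := Nat.div_pos (Nat.le_of_dvd (Nat.pos_of_ne_zero hc) hgc) hg0
        have h1 : (Finset.univ.filter fun u : ZMod c => g ∣ u.val).card ≤ c / g := by
          refine le_trans (Finset.card_le_card ?_)
            (IsAddCyclic.card_nsmul_eq_zero_le (α := ZMod c) hq)
          intro x hx
          simp only [Finset.mem_filter, Finset.mem_univ, true_and] at hx ⊢
          obtain ⟨k, hk⟩ := hx
          rw [← ZMod.natCast_zmod_val x, nsmul_eq_mul, ← Nat.cast_mul, hk, ← mul_assoc,
            Nat.div_mul_cancel hgc, Nat.cast_mul, ZMod.natCast_self, zero_mul]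
        exact (Nat.mul_le_mul_right g h1).trans_eq (Nat.div_mul_cancel hgc)
    _ = c * c.divisors.card := by rw [Finset.sum_const, smul_eq_mul, mul_comm]

theorem ZMod.card_mul_mul_eq_zero_le (c : ℕ) [NeZero c] :
    (Finset.univ.filter fun p : ZMod c × ZMod c × ZMod c => p.1 * p.2.1 * p.2.2 = 0).card ≤
      (c * c.divisors.card) ^ 2 := by
  classical
  calc (Finset.univ.filter fun p : ZMod c × ZMod c × ZMod c => p.1 * p.2.1 * p.2.2 = 0).card
      = ∑ u : ZMod c, ∑ v : ZMod c, (Finset.univ.filter fun w : ZMod c => u * v * w = 0).card := by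
        simp only [Finset.card_filter]
        rw [Fintype.sum_prod_type]
        refine Finset.sum_congr rfl fun u _ => ?_
        rw [Fintype.sum_prod_type]
    _ ≤ ∑ u : ZMod c, ∑ v : ZMod c, Nat.gcd u.val c * Nat.gcd v.val c :=
        Finset.sum_le_sum fun u _ => Finset.sum_le_sum fun v _ =>
          (ZMod.card_filter_mul_eq_zero_le c (u * v)).trans (ZMod.gcd_val_mul_le c u v)
    _ = (∑ u : ZMod c, Nat.gcd u.val c) ^ 2 := by
        rw [sq, Finset.sum_mul_sum]
    _ ≤ (c * c.divisors.card) ^ 2 := Nat.pow_le_pow_left (ZMod.sum_gcd_val_le c) 2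

/-- The pairs of units with prescribed sum and prescribed sum of inverses. -/
theorem ZMod.card_units_sum_eq_le (c : ℕ) [NeZero c] :
    (Finset.univ.filter fun p : ((ZMod c)ˣ × (ZMod c)ˣ) × ((ZMod c)ˣ × (ZMod c)ˣ) =>
      (p.1.1 : ZMod c) + p.1.2 = p.2.1 + p.2.2 ∧
      ((p.1.1⁻¹ : (ZMod c)ˣ) : ZMod c) + (p.1.2⁻¹ : (ZMod c)ˣ) =
        (p.2.1⁻¹ : (ZMod c)ˣ) + (p.2.2⁻¹ : (ZMod c)ˣ)).card ≤ 2 * (c * c.divisors.card) ^ 2 := by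
  classical
  -- If x + y = z + w and the sums of inverses agree, then (x + y)(zw - xy) = 0, and zw - xy = -(z -
  -- x)(z - y). So (x + y, z - x, z - y) has product 0. The triple determines 2x, and x determines
  -- the rest, so the fibres have at most 2 elements.
  refine le_trans (Finset.card_le_mul_card_image_of_maps_to
    (f := fun p => ((p.1.1 : ZMod c) + p.1.2, (p.2.1 : ZMod c) - p.1.1, (p.2.1 : ZMod c) - p.1.2))
    (t := Finset.univ.filter fun p : ZMod c × ZMod c × ZMod c => p.1 * p.2.1 * p.2.2 = 0)
    ?_ 2 ?_) (Nat.mul_le_mul_left 2 (ZMod.card_mul_mul_eq_zero_le c))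
  · rintro ⟨⟨x, y⟩, ⟨z, w⟩⟩ h
    simp only [Finset.mem_filter, Finset.mem_univ, true_and] at h ⊢
    obtain ⟨h1, h2⟩ := h
    have hx := x.mul_inv
    have hy := y.mul_inv
    have hz := z.mul_inv
    have hw := w.mul_inv
    have hsum : ((x : ZMod c) + y) * (z * w - x * y) = 0 := by
      have e1 : ((x : ZMod c) * y * z * w) * (((x⁻¹ : (ZMod c)ˣ) : ZMod c) + (y⁻¹ : (ZMod c)ˣ)) =
          (x + y) * (z * w) := by
        linear_combination (y * z * w : ZMod c) * hx + (x * z * w : ZMod c) * hy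
      have e2 : ((x : ZMod c) * y * z * w) * (((z⁻¹ : (ZMod c)ˣ) : ZMod c) + (w⁻¹ : (ZMod c)ˣ)) =
          (z + w) * (x * y) := by
        linear_combination (y * x * w : ZMod c) * hz + (x * z * y : ZMod c) * hw
      rw [h2, e2, ← h1] at e1
      linear_combination -e1
    have hw' : (w : ZMod c) = x + y - z := by linear_combination -h1
    rw [hw'] at hsum
    linear_combination -hsum
  · rintro ⟨u, v, w⟩ _
    have h2 : Nat.gcd (2 : ZMod c).val c ≤ 2 := by
      simpa using ZMod.gcd_val_natCast_le c 2 (by norm_num)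
    refine le_trans ?_ ((ZMod.card_filter_mul_eq_le c 2 (u - v + w)).trans h2)
    refine Finset.card_le_card_of_injOn (fun p => (p.1.1 : ZMod c)) ?_ ?_
    · rintro ⟨⟨x, y⟩, ⟨z, t⟩⟩ h
      simp only [Finset.coe_filter, Finset.mem_filter, Finset.mem_univ, true_and,
        Set.mem_ofPred_eq, Prod.mk.injEq] at h ⊢
      obtain ⟨-, h1, h2, h3⟩ := h
      linear_combination h1 - h2 + h3
    · rintro ⟨⟨x, y⟩, ⟨z, t⟩⟩ h ⟨⟨x', y'⟩, ⟨z', t'⟩⟩ h' hxx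
      simp only [Finset.coe_filter, Finset.mem_filter, Finset.mem_univ, true_and,
        Set.mem_ofPred_eq, Prod.mk.injEq] at h h' hxx ⊢
      obtain ⟨⟨g1, -⟩, h1, h2, h3⟩ := h
      obtain ⟨⟨g1', -⟩, h1', h2', h3'⟩ := h'
      have ey : (y : ZMod c) = y' := by linear_combination h1 - h1' - hxx
      have ez : (z : ZMod c) = z' := by linear_combination h2 - h2' + hxx
      have et : (t : ZMod c) = t' := by linear_combination -g1 + g1' + hxx + ey - ez
      exact ⟨⟨Units.ext hxx, Units.ext ey⟩, Units.ext ez, Units.ext et⟩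

theorem ZMod.sum_sum_stdAddChar (c : ℕ) [NeZero c] (s t : ZMod c) :
    ∑ a : ZMod c, ∑ b : ZMod c, (ZMod.stdAddChar (a * s + b * t) : ℂ) =
      if s = 0 ∧ t = 0 then (c : ℂ) ^ 2 else 0 := by
  have h (s : ZMod c) : ∑ a : ZMod c, (ZMod.stdAddChar (a * s) : ℂ) = if s = 0 then (c : ℂ) else 0 := by
    rw [AddChar.sum_mulShift s (ZMod.isPrimitive_stdAddChar c), ZMod.card]
    push_cast
    rfl
  simp_rw [AddChar.map_add_eq_mul, ← Finset.mul_sum, ← Finset.sum_mul, h]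
  by_cases hs : s = 0 <;> by_cases ht : t = 0 <;> simp [hs, ht, sq]

/-- Expanding |S|⁴ gives a character sum over quadruples of units. Summing over a and b keeps, by
orthogonality, exactly the quadruples counted in `ZMod.card_units_sum_eq_le`, each with weight c².
-/
theorem sum_norm_kloostermanSum_pow_four (c : ℕ) [NeZero c] :
    ∑ a : ZMod c, ∑ b : ZMod c, ‖kloostermanSum c a b‖ ^ 4 ≤
      2 * (c : ℝ) ^ 4 * (c.divisors.card : ℝ) ^ 2 := by
  classical
  have key (a b : ZMod c) : ((‖kloostermanSum c a b‖ ^ 4 : ℝ) : ℂ) =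
      ∑ p : (ZMod c)ˣ × (ZMod c)ˣ, ∑ q : (ZMod c)ˣ × (ZMod c)ˣ,
        ZMod.stdAddChar (N := c) (a * (((p.1 : ZMod c) + p.2) - ((q.1 : ZMod c) + q.2)) +
          b * ((((p.1⁻¹ : (ZMod c)ˣ) : ZMod c) + ((p.2⁻¹ : (ZMod c)ˣ) : ZMod c)) -
            (((q.1⁻¹ : (ZMod c)ˣ) : ZMod c) + ((q.2⁻¹ : (ZMod c)ˣ) : ZMod c)))) := by
    have h1 : ((‖kloostermanSum c a b‖ ^ 4 : ℝ) : ℂ) =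
        (kloostermanSum c a b * kloostermanSum c a b) *
          conj (kloostermanSum c a b * kloostermanSum c a b) := by
      rw [Complex.mul_conj, Complex.normSq_eq_norm_sq, norm_mul]
      push_cast
      ring
    have h2 : kloostermanSum c a b * kloostermanSum c a b =
        ∑ p : (ZMod c)ˣ × (ZMod c)ˣ, ZMod.stdAddChar (N := c) (a * ((p.1 : ZMod c) + p.2) +
          b * (((p.1⁻¹ : (ZMod c)ˣ) : ZMod c) + ((p.2⁻¹ : (ZMod c)ˣ) : ZMod c))) := by
      rw [kloostermanSum, Finset.sum_mul_sum, Fintype.sum_prod_type]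
      refine Finset.sum_congr rfl fun x _ => Finset.sum_congr rfl fun y _ => ?_
      rw [← AddChar.map_add_eq_mul]
      congr 1
      ring
    rw [h1, h2, map_sum, Finset.sum_mul_sum]
    refine Finset.sum_congr rfl fun p _ => Finset.sum_congr rfl fun q _ => ?_
    rw [← AddChar.map_neg_eq_conj, ← AddChar.map_add_eq_mul]
    congr 1
    ring
  have hsum : ((∑ a : ZMod c, ∑ b : ZMod c, ‖kloostermanSum c a b‖ ^ 4 : ℝ) : ℂ) =
      (((c : ℝ) ^ 2 * (Finset.univ.filter fun p : ((ZMod c)ˣ × (ZMod c)ˣ) × ((ZMod c)ˣ × (ZMod c)ˣ) =>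
      (p.1.1 : ZMod c) + p.1.2 = p.2.1 + p.2.2 ∧
      ((p.1.1⁻¹ : (ZMod c)ˣ) : ZMod c) + (p.1.2⁻¹ : (ZMod c)ˣ) =
        (p.2.1⁻¹ : (ZMod c)ˣ) + (p.2.2⁻¹ : (ZMod c)ˣ)).card : ℝ) : ℂ) := by
    rw [Complex.ofReal_sum]
    simp_rw [Complex.ofReal_sum, key]
    have swap (F : ZMod c → ZMod c → (ZMod c)ˣ × (ZMod c)ˣ → (ZMod c)ˣ × (ZMod c)ˣ → ℂ) :
        ∑ a, ∑ b, ∑ p, ∑ q, F a b p q = ∑ x : ((ZMod c)ˣ × (ZMod c)ˣ) × ((ZMod c)ˣ × (ZMod c)ˣ),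
          ∑ a, ∑ b, F a b x.1 x.2 := by
      rw [Fintype.sum_prod_type]
      simp only [Finset.sum_comm (s := Finset.univ (α := ZMod c))
        (t := Finset.univ (α := (ZMod c)ˣ × (ZMod c)ˣ))]
    rw [swap]
    simp_rw [ZMod.sum_sum_stdAddChar]
    simp only [sub_eq_zero, Finset.card_filter]
    push_cast
    rw [Finset.mul_sum]
    refine Finset.sum_congr rfl fun x _ => ?_
    split_ifs <;> simp
  rw [Complex.ofReal_inj] at hsum
  rw [hsum]
  have := ZMod.card_units_sum_eq_le c
  have h3 := (Nat.cast_le (α := ℝ)).2 this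
  calc _ ≤ (c : ℝ) ^ 2 * ((2 * (c * c.divisors.card) ^ 2 : ℕ) : ℝ) := by gcongr
    _ = _ := by push_cast; ring

/-- Substituting uk for k; this lets a single value occur φ(c) times in the full fourth moment. -/
theorem kloostermanSum_mul_unit (c : ℕ) [NeZero c] (a b : ZMod c) (u : (ZMod c)ˣ) :
    kloostermanSum c (a * u) (b * (u⁻¹ : (ZMod c)ˣ)) = kloostermanSum c a b := by
  unfold kloostermanSum
  refine Fintype.sum_equiv (Equiv.mulLeft u) _ _ fun k => ?_
  simp only [Equiv.coe_mulLeft, mul_inv, Units.val_mul, mul_assoc]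

/-- Kloosterman's bound, by the fourth moment method. -/
theorem norm_kloostermanSum_pow_four_le (c m : ℕ) [NeZero c] (hm : 0 < m) (b : ZMod c) :
    ‖kloostermanSum c m b‖ ^ 4 ≤ 2 * m * (c : ℝ) ^ 3 * (c.divisors.card : ℝ) ^ 3 := by
  classical
  have hc : 0 < c := Nat.pos_of_ne_zero (NeZero.ne c)
  -- S(m, b) = S(mu, b/u) for all φ(c) units u, and a given class is of the form mu for at most
  -- gcd(m, c) ≤ m of them.
  have h1 : (c.totient : ℝ) * ‖kloostermanSum c m b‖ ^ 4 ≤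
      m * ∑ a : ZMod c, ∑ b : ZMod c, ‖kloostermanSum c a b‖ ^ 4 := by
    calc (c.totient : ℝ) * ‖kloostermanSum c m b‖ ^ 4
        = ∑ u : (ZMod c)ˣ, ‖kloostermanSum c (m * (u : ZMod c)) (b * (u⁻¹ : (ZMod c)ˣ))‖ ^ 4 := by
          simp_rw [kloostermanSum_mul_unit]
          rw [Finset.sum_const, Finset.card_univ, ZMod.card_units_eq_totient, nsmul_eq_mul]
      _ ≤ ∑ u : (ZMod c)ˣ, ∑ b : ZMod c, ‖kloostermanSum c (m * (u : ZMod c)) b‖ ^ 4 := by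
          refine Finset.sum_le_sum fun u _ => ?_
          exact Finset.single_le_sum (f := fun b => ‖kloostermanSum c (m * (u : ZMod c)) b‖ ^ 4)
            (fun _ _ => by positivity) (Finset.mem_univ _)
      _ = ∑ a : ZMod c, ∑ u ∈ Finset.univ.filter (fun u : (ZMod c)ˣ => (m : ZMod c) * u = a),
            ∑ b : ZMod c, ‖kloostermanSum c (m * (u : ZMod c)) b‖ ^ 4 :=
          (Finset.sum_fiberwise _ _ _).symm
      _ ≤ ∑ a : ZMod c, m * ∑ b : ZMod c, ‖kloostermanSum c a b‖ ^ 4 := by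
          refine Finset.sum_le_sum fun a _ => ?_
          calc _ = ∑ u ∈ Finset.univ.filter (fun u : (ZMod c)ˣ => (m : ZMod c) * u = a),
                ∑ b : ZMod c, ‖kloostermanSum c a b‖ ^ 4 := by
                refine Finset.sum_congr rfl fun u hu => ?_
                rw [(Finset.mem_filter.1 hu).2]
            _ ≤ _ := by
                rw [Finset.sum_const, nsmul_eq_mul]
                refine mul_le_mul_of_nonneg_right ?_ (by positivity)
                refine Nat.cast_le.2 (le_trans ?_ ((ZMod.card_filter_mul_eq_le c m a).trans
                  (ZMod.gcd_val_natCast_le c m hm)))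
                refine Finset.card_le_card_of_injOn (fun u => (u : ZMod c)) ?_
                  (fun x _ y _ h => Units.ext h)
                intro u hu
                simpa using hu
      _ = _ := by rw [← Finset.mul_sum]
  -- From c = ∑ φ(d) over d ∣ c and φ(d) ≤ φ(c).
  have h2 : (c : ℝ) ≤ c.divisors.card * c.totient := by
    have h : c ≤ c.divisors.card * c.totient := by
      conv_lhs => rw [← Nat.sum_totient c]
      refine (Finset.sum_le_card_nsmul _ _ c.totient fun d hd => ?_).trans_eq (by simp)
      exact Nat.le_of_dvd (Nat.totient_pos.2 hc)
        (Nat.totient_dvd_of_dvd (Nat.dvd_of_mem_divisors hd))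
    exact_mod_cast h
  have hc' : (0 : ℝ) < c := Nat.cast_pos.2 hc
  have h3 := sum_norm_kloostermanSum_pow_four c
  refine le_of_mul_le_mul_left ?_ hc'
  calc (c : ℝ) * ‖kloostermanSum c m b‖ ^ 4
      ≤ (c.divisors.card * c.totient) * ‖kloostermanSum c m b‖ ^ 4 := by gcongr
    _ = c.divisors.card * (c.totient * ‖kloostermanSum c m b‖ ^ 4) := by ring
    _ ≤ c.divisors.card * (m * (2 * (c : ℝ) ^ 4 * (c.divisors.card : ℝ) ^ 2)) := by
        exact mul_le_mul_of_nonneg_left (h1.trans (mul_le_mul_of_nonneg_left h3 (by positivity)))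
          (by positivity)
    _ = c * (2 * m * (c : ℝ) ^ 3 * (c.divisors.card : ℝ) ^ 3) := by ring

/-- This is the Dirichlet series of ζ² at -s > 1. -/
theorem summable_card_divisors_mul_rpow {s : ℝ} (hs : s < -1) :
    Summable fun c : ℕ => (c.divisors.card : ℝ) * (c : ℝ) ^ s := by
  have h0 : LSeriesSummable (fun n => (ArithmeticFunction.zeta : ArithmeticFunction ℂ) n)
      ((-s : ℝ) : ℂ) := by
    have := ArithmeticFunction.LSeriesSummable_zeta_iff (s := ((-s : ℝ) : ℂ))
    simp only [ArithmeticFunction.natCoe_apply]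
    rw [this]
    simp
    linarith
  have h := (ArithmeticFunction.LSeriesSummable_mul h0 h0).norm
  refine h.congr fun c => ?_
  rcases Nat.eq_zero_or_pos c with rfl | hc
  · simp
  rw [LSeries.term_of_ne_zero hc.ne', norm_div]
  have h1 : ((ArithmeticFunction.zeta : ArithmeticFunction ℂ) * ArithmeticFunction.zeta) c =
      (c.divisors.card : ℂ) := by
    rw [← ArithmeticFunction.natCoe_mul, ArithmeticFunction.natCoe_apply,
      ArithmeticFunction.zeta_mul_apply]
    rw [Finset.sum_congr rfl fun d hd => by
      rw [ArithmeticFunction.zeta_apply_ne (Nat.pos_of_mem_divisors hd).ne']]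
    simp
  rw [h1, Complex.norm_natCast, Complex.norm_natCast_cpow_of_pos hc, Complex.ofReal_re,
    Real.rpow_neg (Nat.cast_nonneg c), div_inv_eq_mul]

/-- The Kloosterman sums are small enough for `∑ |S(m, b; c)| c ^ (-15/8)` to converge. -/
theorem norm_kloostermanSum_mul_rpow_le (c m : ℕ) [NeZero c] (hm : 0 < m) (b : ZMod c) :
    ‖kloostermanSum c m b‖ * (c : ℝ) ^ (-15 / 8 : ℝ) ≤
      2 * m * ((c.divisors.card : ℝ) * (c : ℝ) ^ (-9 / 8 : ℝ)) := by
  have hc : (0 : ℝ) < c := Nat.cast_pos.2 (Nat.pos_of_ne_zero (NeZero.ne c))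
  have hd : (1 : ℝ) ≤ c.divisors.card := by
    have : 0 < c.divisors.card := Finset.card_pos.2 (Nat.nonempty_divisors.2 (NeZero.ne c))
    exact_mod_cast this
  have hm' : (1 : ℝ) ≤ m := by exact_mod_cast hm
  -- Fourth root of Kloosterman's bound, after rounding 2m and d(c)³ up to fourth powers. Then 3/4 -
  -- 15/8 = -9/8 < -1.
  have h1 : ‖kloostermanSum c m b‖ ≤ 2 * m * c.divisors.card * (c : ℝ) ^ (3 / 4 : ℝ) := by
    refine le_of_pow_le_pow_left₀ (n := 4) (by norm_num) (by positivity) ?_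
    refine (norm_kloostermanSum_pow_four_le c m hm b).trans ?_
    have e : ((c : ℝ) ^ (3 / 4 : ℝ)) ^ 4 = (c : ℝ) ^ 3 := by
      rw [← Real.rpow_natCast, ← Real.rpow_mul hc.le, ← Real.rpow_natCast]
      norm_num
    have e2 : (2 * m * (c.divisors.card : ℝ) * (c : ℝ) ^ (3 / 4 : ℝ)) ^ 4 =
        (2 * m) ^ 4 * (c : ℝ) ^ 3 * (c.divisors.card : ℝ) ^ 4 := by
      rw [mul_pow, e]; ring
    rw [e2]
    have a1 : (2 * m : ℝ) ≤ (2 * m) ^ 4 := le_self_pow₀ (by linarith) (by norm_num)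
    have a2 : (c.divisors.card : ℝ) ^ 3 ≤ (c.divisors.card : ℝ) ^ 4 :=
      pow_le_pow_right₀ hd (by norm_num)
    gcongr
  calc ‖kloostermanSum c m b‖ * (c : ℝ) ^ (-15 / 8 : ℝ)
      ≤ 2 * m * c.divisors.card * (c : ℝ) ^ (3 / 4 : ℝ) * (c : ℝ) ^ (-15 / 8 : ℝ) := by gcongr
    _ = _ := by
      rw [mul_assoc, ← Real.rpow_add hc]
      norm_num
      ring

end Kloosterman

/-! ### The exponential e^{2iπz} -/

section ExpTwoPi

/-- The function `z ↦ e^{2iπz}`. -/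
def expTwoPiI (z : ℂ) : ℂ := Complex.exp (2 * π * Complex.I * z)

theorem expTwoPiI_add (z w : ℂ) : expTwoPiI (z + w) = expTwoPiI z * expTwoPiI w := by
  simp only [expTwoPiI, mul_add, Complex.exp_add]

@[simp] theorem expTwoPiI_intCast (n : ℤ) : expTwoPiI n = 1 := by
  rw [expTwoPiI, mul_comm, Complex.exp_int_mul_two_pi_mul_I]

theorem expTwoPiI_add_intCast (z : ℂ) (n : ℤ) : expTwoPiI (z + n) = expTwoPiI z := by
  rw [expTwoPiI_add, expTwoPiI_intCast, mul_one]

theorem norm_expTwoPiI (z : ℂ) : ‖expTwoPiI z‖ = Real.exp (-(2 * π * z.im)) := by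
  rw [expTwoPiI, Complex.norm_exp]
  congr 1
  simp [mul_assoc]

@[simp] theorem norm_expTwoPiI_ofReal (x : ℝ) : ‖expTwoPiI (x : ℂ)‖ = 1 := by
  simp [norm_expTwoPiI]

theorem conj_expTwoPiI (z : ℂ) : conj (expTwoPiI z) = expTwoPiI (-conj z) := by
  rw [expTwoPiI, ← Complex.exp_conj, expTwoPiI]
  congr 1
  simp [Complex.conj_ofNat]

@[fun_prop] theorem continuous_expTwoPiI : Continuous expTwoPiI := by
  unfold expTwoPiI
  fun_prop

@[fun_prop] theorem measurable_expTwoPiI : Measurable expTwoPiI := continuous_expTwoPiI.measurable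

end ExpTwoPi

/-! ### Fourier transforms of negative powers of x + iy -/

section FourierPower

theorem add_mul_I_ne_zero {y : ℝ} (hy : 0 < y) (x : ℝ) : (x : ℂ) + y * Complex.I ≠ 0 := by
  intro h
  have := congrArg Complex.im h
  simp at this
  exact hy.ne' this

theorem continuous_inv_add_mul_I_pow {y : ℝ} (hy : 0 < y) (k : ℕ) :
    Continuous fun x : ℝ => (((x : ℂ) + y * Complex.I) ^ k)⁻¹ :=
  Continuous.inv₀ (by fun_prop) fun x => pow_ne_zero _ (add_mul_I_ne_zero hy x)

theorem integrable_inv_sq_add_sq {y : ℝ} (hy : 0 < y) :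
    Integrable fun x : ℝ => (x ^ 2 + y ^ 2)⁻¹ := by
  have h := (integrable_inv_one_add_sq.comp_mul_left' (R := y⁻¹) (by positivity)).const_mul
    (y ^ 2)⁻¹
  refine h.congr (Filter.Eventually.of_forall fun x => ?_)
  simp only
  rw [← mul_inv]
  congr 1
  field_simp
  ring

theorem norm_inv_add_mul_I_pow_le {y : ℝ} (hy : 0 < y) (k : ℕ) (x : ℝ) :
    ‖(((x : ℂ) + y * Complex.I) ^ (k + 2))⁻¹‖ ≤ (y ^ k)⁻¹ * (x ^ 2 + y ^ 2)⁻¹ := by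
  have h1 : ‖(x : ℂ) + y * Complex.I‖ ^ 2 = x ^ 2 + y ^ 2 := by
    rw [← Complex.normSq_eq_norm_sq, Complex.normSq_add_mul_I]
  have h2 : y ≤ ‖(x : ℂ) + y * Complex.I‖ := by
    have := Complex.abs_im_le_norm ((x : ℂ) + y * Complex.I)
    simp at this
    exact (le_abs_self y).trans this
  rw [norm_inv, norm_pow, pow_add, mul_inv, h1]
  gcongr

theorem integrable_inv_add_mul_I_pow {y : ℝ} (hy : 0 < y) (k : ℕ) :
    Integrable fun x : ℝ => (((x : ℂ) + y * Complex.I) ^ (k + 2))⁻¹ :=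
  ((integrable_inv_sq_add_sq hy).const_mul (y ^ k)⁻¹).mono'
    (continuous_inv_add_mul_I_pow hy _).aestronglyMeasurable
    (Filter.Eventually.of_forall (norm_inv_add_mul_I_pow_le hy k))

/-- Induction on n: the derivative of t^(n+1) e^(-at) integrates to 0. -/
theorem integral_pow_mul_exp_neg_mul_Ioi (n : ℕ) {a : ℂ} (ha : 0 < a.re) :
    IntegrableOn (fun t : ℝ => (t : ℂ) ^ n * Complex.exp (-(a * t))) (Set.Ioi 0) ∧
    ∫ t : ℝ in Set.Ioi 0, (t : ℂ) ^ n * Complex.exp (-(a * t)) = n.factorial / a ^ (n + 1) := by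
  have ha0 : a ≠ 0 := fun h => by simp [h] at ha
  have hint (n : ℕ) : IntegrableOn (fun t : ℝ => (t : ℂ) ^ n * Complex.exp (-(a * t)))
      (Set.Ioi 0) := by
    have h := integrableOn_rpow_mul_exp_neg_mul_rpow (p := 1) (s := (n : ℕ)) (b := a.re)
      (by linarith [Nat.cast_nonneg (α := ℝ) n]) one_pos ha
    refine h.mono' (by fun_prop) ((ae_restrict_iff' measurableSet_Ioi).2
      (Filter.Eventually.of_forall fun t ht => ?_))
    rw [norm_mul, norm_pow, Complex.norm_exp, Complex.norm_real, Real.norm_of_nonneg (le_of_lt ht),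
      Real.rpow_natCast, Real.rpow_one]
    simp
  refine ⟨hint n, ?_⟩
  induction n with
  | zero =>
    have := integral_exp_mul_complex_Ioi (a := -a) (by simpa using ha) 0
    simp at this ⊢
    simpa using this
  | succ n ih =>
    have hd (t : ℝ) : HasDerivAt (fun t : ℝ => (t : ℂ) ^ (n + 1) * Complex.exp (-(a * t)))
        ((n + 1) * ((t : ℂ) ^ n * Complex.exp (-(a * t))) -
          a * ((t : ℂ) ^ (n + 1) * Complex.exp (-(a * t)))) t := by
      have h1 : HasDerivAt (fun t : ℝ => (t : ℂ)) 1 t := Complex.ofRealCLM.hasDerivAt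
      have h2 := (h1.pow (n + 1)).mul ((h1.const_mul a).neg.cexp)
      refine h2.congr_deriv ?_
      push_cast
      simp only [mul_one, Pi.pow_apply, Pi.neg_apply]
      ring
    have hi := (((hint n).const_mul ((n : ℂ) + 1)).sub ((hint (n + 1)).const_mul a))
    have hlim := tendsto_zero_of_hasDerivAt_of_integrableOn_Ioi (a := 0) (fun t _ => hd t) hi
      (hint (n + 1))
    have := integral_Ioi_of_hasDerivAt_of_tendsto (a := 0) (hd 0).continuousAt.continuousWithinAt
      (fun t _ => hd t) hi hlim
    rw [integral_sub ((hint n).const_mul _) ((hint (n + 1)).const_mul a), integral_const_mul,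
      integral_const_mul, ih] at this
    simp only [Complex.ofReal_zero, ne_eq, Nat.succ_ne_zero, not_false_eq_true, zero_pow, zero_mul,
      sub_zero] at this
    rw [← mul_right_inj' ha0, ← sub_eq_zero.1 this, Nat.factorial_succ]
    push_cast
    field_simp
    ring

open scoped FourierTransform in
/-- The Fourier transform of `x ↦ (x + i y) ^ (-k-2)`. -/
theorem integral_inv_add_mul_I_pow_mul_exp {y : ℝ} (hy : 0 < y) (k : ℕ) (t : ℝ) :
    ∫ x : ℝ, (((x : ℂ) + y * Complex.I) ^ (k + 2))⁻¹ * expTwoPiI (-(t * x)) =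
      if 0 < t then (-2 * π * Complex.I) ^ (k + 2) / (k + 1).factorial * (t : ℂ) ^ (k + 1) *
        Real.exp (-(2 * π * t * y)) else 0 := by
  -- The result follows by Fourier inversion from the transform of f, a gamma integral. Writing f
  -- with `max` makes its continuity at 0 visible, which uses k + 1 ≥ 1.
  set f : ℝ → ℂ := fun t => (max t 0 : ℝ) ^ (k + 1) * Real.exp (-(2 * π * y * t)) with hf
  have hfc : Continuous f := by
    rw [hf]; fun_prop
  have hf0 : ∀ t, f t = (Set.Ioi (0 : ℝ)).indicator
      (fun t => ((t ^ (k + 1) * Real.exp (-(2 * π * y * t)) : ℝ) : ℂ)) t := by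
    intro t
    by_cases ht : 0 < t
    · rw [Set.indicator_of_mem (show t ∈ Set.Ioi (0 : ℝ) from ht)]
      simp [hf, max_eq_left ht.le]
    · rw [Set.indicator_of_notMem (show t ∉ Set.Ioi (0 : ℝ) from ht)]
      simp [hf, max_eq_right (not_lt.1 ht)]
  have hfi : Integrable f := by
    rw [funext hf0, integrable_indicator_iff measurableSet_Ioi]
    refine Integrable.ofReal ?_
    have h := integrableOn_rpow_mul_exp_neg_mul_rpow (p := 1) (s := (k + 1 : ℕ)) (b := 2 * π * y)
      (by push_cast; linarith [Nat.cast_nonneg (α := ℝ) k]) one_pos (by positivity)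
    refine h.congr_fun (fun t _ => ?_) measurableSet_Ioi
    simp only [Real.rpow_natCast, Real.rpow_one, neg_mul]
    rfl
  have hF : ∀ x : ℝ, 𝓕 f (-x) = (k + 1).factorial / (-2 * π * Complex.I) ^ (k + 2) *
      (((x : ℂ) + y * Complex.I) ^ (k + 2))⁻¹ := by
    intro x
    rw [Real.fourier_real_eq_integral_exp_smul]
    have e1 : ∀ v : ℝ, Complex.exp (((-2 * π * v * (-x) : ℝ) : ℂ) * Complex.I) • f v =
        (Set.Ioi (0 : ℝ)).indicator (fun v : ℝ => (v : ℂ) ^ (k + 1) *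
          Complex.exp (-((2 * π * (y - x * Complex.I)) * v))) v := by
      intro v
      rw [hf0]
      by_cases hv : 0 < v
      · rw [Set.indicator_of_mem (show v ∈ Set.Ioi (0 : ℝ) from hv),
          Set.indicator_of_mem (show v ∈ Set.Ioi (0 : ℝ) from hv)]
        push_cast
        rw [smul_eq_mul, mul_left_comm, ← Complex.exp_add]
        congr 2
        ring
      · rw [Set.indicator_of_notMem (show v ∉ Set.Ioi (0 : ℝ) from hv),
          Set.indicator_of_notMem (show v ∉ Set.Ioi (0 : ℝ) from hv), smul_zero]
    simp_rw [e1]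
    rw [integral_indicator measurableSet_Ioi, (integral_pow_mul_exp_neg_mul_Ioi (k + 1) _).2,
      div_eq_mul_inv, div_eq_mul_inv, mul_assoc ((k + 1).factorial : ℂ), ← mul_inv, ← mul_pow]
    · congr 3
      linear_combination (2 * π * y : ℂ) * Complex.I_sq
    · simp; positivity
  have hc : ((k + 1).factorial : ℂ) / (-2 * π * Complex.I) ^ (k + 2) ≠ 0 := by
    refine div_ne_zero (Nat.cast_ne_zero.2 (Nat.factorial_ne_zero _)) (pow_ne_zero _ ?_)
    simp [Real.pi_ne_zero]
  have hFi : Integrable (𝓕 f) := by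
    have h1 : Integrable fun x => 𝓕 f (-x) := by
      simp_rw [hF]
      exact (integrable_inv_add_mul_I_pow hy k).const_mul _
    simpa using h1.comp_neg
  have hinv := congrFun (hfc.fourierInv_fourier_eq hfi hFi) t
  rw [Real.fourierInv_eq'] at hinv
  have h2 : ∫ x : ℝ, Complex.exp (((2 * π * inner ℝ x t : ℝ) : ℂ) * Complex.I) • 𝓕 f x =
      (k + 1).factorial / (-2 * π * Complex.I) ^ (k + 2) *
      ∫ x : ℝ, (((x : ℂ) + y * Complex.I) ^ (k + 2))⁻¹ * expTwoPiI (-(t * x)) := by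
    rw [← integral_neg_eq_self, ← integral_const_mul]
    refine integral_congr_ae (Filter.Eventually.of_forall fun x => ?_)
    simp only [hF, smul_eq_mul, expTwoPiI]
    rw [mul_comm, mul_assoc]
    congr 3
    simp
    ring
  rw [h2] at hinv
  have h3 : ∀ I : ℂ, (k + 1).factorial / (-2 * π * Complex.I) ^ (k + 2) * I = f t →
      I = f t * ((-2 * π * Complex.I) ^ (k + 2) / (k + 1).factorial) := by
    intro I hI
    rw [← hI, ← inv_div, mul_right_comm, inv_mul_cancel₀ (by simpa using inv_ne_zero hc), one_mul]
  rw [h3 _ hinv]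
  split_ifs with ht
  · simp only [hf, max_eq_left ht.le]
    push_cast
    rw [mul_comm, ← mul_assoc]
    congr 2
    ring
  · simp [hf, max_eq_right (not_lt.1 ht)]

end FourierPower

/-! ### The Bessel integral and its bounds -/

section BesselIntegral

/-- The function `z ↦ e^{-2iπm/(Cz)} / (C z²)`. -/
def besselKernel (m : ℕ) (C : ℝ) (z : ℂ) : ℂ := expTwoPiI (-(m / (C * z))) / (C * z ^ 2)

/-- The integral over a horizontal line of the Bessel kernel, cut off by the function `φ`. -/
def besselIntegral (m : ℕ) (n : ℤ) (φ : ℝ → ℝ) (C y : ℝ) : ℂ :=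
  ∫ x : ℝ, φ (y / (C * (x ^ 2 + y ^ 2))) * besselKernel m C (x + y * Complex.I) *
    expTwoPiI (-(n * x))

theorem norm_add_mul_I_sq (x y : ℝ) : ‖(x : ℂ) + y * Complex.I‖ ^ 2 = x ^ 2 + y ^ 2 := by
  rw [← Complex.normSq_eq_norm_sq, Complex.normSq_add_mul_I]

theorem norm_besselKernel (m : ℕ) {C : ℝ} (hC : 0 < C) (x y : ℝ) :
    ‖besselKernel m C (x + y * Complex.I)‖ =
      Real.exp (-(2 * π * m * (y / (C * (x ^ 2 + y ^ 2))))) * (C * (x ^ 2 + y ^ 2))⁻¹ := by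
  rw [besselKernel, norm_div, norm_mul, norm_pow, norm_add_mul_I_sq, Complex.norm_real,
    Real.norm_of_nonneg hC.le, div_eq_mul_inv, norm_expTwoPiI]
  congr 3
  have h : (-((m : ℂ) / (C * (x + y * Complex.I)))).im = m * (y / (C * (x ^ 2 + y ^ 2))) := by
    rw [← div_div, Complex.neg_im, Complex.div_im, Complex.normSq_add_mul_I]
    have h1 : ((m : ℂ) / C).im = 0 := by
      rw [show (m : ℂ) / C = ((m / C : ℝ) : ℂ) by push_cast; rfl, Complex.ofReal_im]
    have h2 : ((m : ℂ) / C).re = m / C := by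
      rw [show (m : ℂ) / C = ((m / C : ℝ) : ℂ) by push_cast; rfl, Complex.ofReal_re]
    rw [h1, h2]
    simp only [Complex.add_re, Complex.ofReal_re, Complex.mul_re, Complex.I_re, mul_zero,
      Complex.ofReal_im, Complex.I_im, mul_one, sub_self, add_zero, Complex.add_im, Complex.mul_im,
      zero_add, zero_mul, zero_div, zero_sub, neg_neg]
    field_simp
  rw [h]
  ring

theorem norm_besselKernel_le (m : ℕ) {C y : ℝ} (hC : 0 < C) (hy : 0 < y) (x : ℝ) :
    ‖besselKernel m C (x + y * Complex.I)‖ ≤ (C * (x ^ 2 + y ^ 2))⁻¹ := by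
  rw [norm_besselKernel m hC]
  refine mul_le_of_le_one_left (by positivity) (Real.exp_le_one_iff.2 ?_)
  have : 0 ≤ 2 * π * m * (y / (C * (x ^ 2 + y ^ 2))) := by positivity
  linarith

/-- The trivial bound 1/(C|z|²) integrates over the line to a multiple of 1/(Cy), which is not
integrable at y = 0. With s = y/(C|z|²), the inequality e^(-2πms) ≤ s^(-1/16) gives up a little
decay in C to gain integrability in y. -/
theorem norm_besselKernel_le_rpow {m : ℕ} (hm : 0 < m) {C y : ℝ} (hC : 0 < C) (hy : 0 < y)
    (x : ℝ) : ‖besselKernel m C (x + y * Complex.I)‖ ≤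
      (C * (x ^ 2 + y ^ 2)) ^ (-15 / 16 : ℝ) * y ^ (-1 / 16 : ℝ) := by
  rw [norm_besselKernel m hC]
  set r := C * (x ^ 2 + y ^ 2) with hr
  have hr0 : 0 < r := by positivity
  have hs : 0 < y / r := by positivity
  have h1 : Real.exp (-(2 * π * m * (y / r))) ≤ (y / r) ^ (-1 / 16 : ℝ) := by
    rw [Real.exp_neg, show (-1 / 16 : ℝ) = -(1 / 16) by norm_num, Real.rpow_neg hs.le]
    refine inv_anti₀ (by positivity) ?_
    have hm' : (1 : ℝ) ≤ m := by exact_mod_cast hm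
    have h2 : y / r ≤ 2 * π * m * (y / r) := by
      refine le_mul_of_one_le_left hs.le ?_
      nlinarith [Real.pi_gt_three]
    refine le_trans ?_ (Real.exp_le_exp.2 h2)
    rcases le_total (y / r) 1 with h | h
    · exact (Real.rpow_le_one hs.le h (by norm_num)).trans (Real.one_le_exp hs.le)
    · refine (Real.rpow_le_rpow_of_exponent_le h (by norm_num : (1 / 16 : ℝ) ≤ 1)).trans ?_
      rw [Real.rpow_one]
      linarith [Real.add_one_le_exp (y / r)]
  calc Real.exp (-(2 * π * m * (y / r))) * r⁻¹ ≤ (y / r) ^ (-1 / 16 : ℝ) * r⁻¹ := by gcongr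
    _ = r ^ (-15 / 16 : ℝ) * y ^ (-1 / 16 : ℝ) := by
      rw [Real.div_rpow hy.le hr0.le, ← Real.rpow_neg_one r, div_eq_mul_inv, ← Real.rpow_neg hr0.le,
        mul_assoc, ← Real.rpow_add hr0, mul_comm]
      norm_num

theorem continuous_besselKernel_line (m : ℕ) {C y : ℝ} (hC : 0 < C) (hy : 0 < y) :
    Continuous fun x : ℝ => besselKernel m C (x + y * Complex.I) := by
  have hC' : (C : ℂ) ≠ 0 := Complex.ofReal_ne_zero.2 hC.ne'
  unfold besselKernel
  refine Continuous.div (continuous_expTwoPiI.comp (Continuous.neg (Continuous.div (by fun_prop)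
    (by fun_prop) fun x => ?_))) (by fun_prop) fun x => ?_
  · exact mul_ne_zero hC' (add_mul_I_ne_zero hy x)
  · exact mul_ne_zero hC' (pow_ne_zero _ (add_mul_I_ne_zero hy x))

theorem integrable_inv_mul_sq_add_sq (C : ℝ) {y : ℝ} (hy : 0 < y) :
    Integrable fun x : ℝ => (C * (x ^ 2 + y ^ 2))⁻¹ := by
  simp_rw [mul_inv]
  exact (integrable_inv_sq_add_sq hy).const_mul _

theorem measurable_cutoff_line {φ : ℝ → ℝ} (hφ : Measurable φ) (C y : ℝ) :
    Measurable fun x : ℝ => φ (y / (C * (x ^ 2 + y ^ 2))) :=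
  hφ.comp (by fun_prop)

theorem norm_cutoff_besselKernel_le (m : ℕ) {φ : ℝ → ℝ} (hφ1 : ∀ t, |φ t| ≤ 1) {C y : ℝ}
    (hC : 0 < C) (hy : 0 < y) (x : ℝ) :
    ‖(φ (y / (C * (x ^ 2 + y ^ 2))) : ℂ) * besselKernel m C (x + y * Complex.I)‖ ≤
      (C * (x ^ 2 + y ^ 2))⁻¹ := by
  rw [norm_mul, Complex.norm_real, Real.norm_eq_abs]
  exact (mul_le_of_le_one_left (norm_nonneg _) (hφ1 _)).trans (norm_besselKernel_le m hC hy x)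

theorem aestronglyMeasurable_cutoff_besselKernel (m : ℕ) {φ : ℝ → ℝ} (hφ : Measurable φ) {C y : ℝ}
    (hC : 0 < C) (hy : 0 < y) : AEStronglyMeasurable fun x : ℝ =>
      (φ (y / (C * (x ^ 2 + y ^ 2))) : ℂ) * besselKernel m C (x + y * Complex.I) :=
  ((Complex.measurable_ofReal.comp (measurable_cutoff_line hφ C y)).mul
    (continuous_besselKernel_line m hC hy).measurable).aestronglyMeasurable

theorem integrable_cutoff_besselKernel (m : ℕ) {φ : ℝ → ℝ} (hφ : Measurable φ)
    (hφ1 : ∀ t, |φ t| ≤ 1) {C y : ℝ} (hC : 0 < C) (hy : 0 < y) : Integrable fun x : ℝ =>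
      (φ (y / (C * (x ^ 2 + y ^ 2))) : ℂ) * besselKernel m C (x + y * Complex.I) :=
  (integrable_inv_mul_sq_add_sq C hy).mono' (aestronglyMeasurable_cutoff_besselKernel m hφ hC hy)
    (Filter.Eventually.of_forall (norm_cutoff_besselKernel_le m hφ1 hC hy))

theorem norm_expTwoPiI_neg_intCast_mul (n : ℤ) (x : ℝ) : ‖expTwoPiI (-(n * x))‖ = 1 := by
  have := norm_expTwoPiI_ofReal (-(n * x))
  push_cast at this
  exact this

theorem tendsto_besselIntegral (m : ℕ) (n : ℤ) {φ : ℕ → ℝ → ℝ} (hφ : ∀ k, Measurable (φ k))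
    (hφ1 : ∀ k t, |φ k t| ≤ 1)
    (hlim : ∀ t, 0 < t → Filter.Tendsto (fun k => φ k t) Filter.atTop (nhds 1))
    {C y : ℝ} (hC : 0 < C) (hy : 0 < y) :
    Filter.Tendsto (fun k => besselIntegral m n (φ k) C y) Filter.atTop
      (nhds (besselIntegral m n (fun _ => 1) C y)) := by
  refine tendsto_integral_of_dominated_convergence (fun x => (C * (x ^ 2 + y ^ 2))⁻¹) (fun k => ?_)
    (integrable_inv_mul_sq_add_sq C hy) (fun k => Filter.Eventually.of_forall fun x => ?_)
    (Filter.Eventually.of_forall fun x => ?_)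
  · exact (aestronglyMeasurable_cutoff_besselKernel m (hφ k) hC hy).mul
      (by fun_prop : Continuous fun x : ℝ => expTwoPiI (-(n * x))).aestronglyMeasurable
  · rw [norm_mul, norm_expTwoPiI_neg_intCast_mul, mul_one]
    exact norm_cutoff_besselKernel_le m (hφ1 k) hC hy x
  · refine Filter.Tendsto.mul_const _ (Filter.Tendsto.mul_const _ ?_)
    exact (Complex.continuous_ofReal.tendsto _).comp (hlim _ (by positivity))

/-- The constant `∫ (1 + x ^ 2) ^ (-15/16) dx`. -/
def besselBound : ℝ := ∫ x : ℝ, (1 + x ^ 2) ^ (-15 / 16 : ℝ)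

theorem integrable_one_add_sq_rpow : Integrable fun x : ℝ => (1 + x ^ 2) ^ (-15 / 16 : ℝ) := by
  have := integrable_rpow_neg_one_add_norm_sq (E := ℝ) (μ := volume) (r := 15 / 8)
    (by simp; norm_num)
  simp only [Real.norm_eq_abs, sq_abs] at this
  convert this using 3
  norm_num

theorem besselBound_nonneg : 0 ≤ besselBound := integral_nonneg fun x => by positivity

/-- Rescaling x by y reduces `norm_besselKernel_le_rpow` to one convergent integral. The bound does
not depend on n or on the cutoff, and its exponent of y exceeds -1. -/
theorem norm_besselIntegral_le {m : ℕ} (hm : 0 < m) (n : ℤ) {φ : ℝ → ℝ} (hφ1 : ∀ t, |φ t| ≤ 1)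
    {C y : ℝ} (hC : 0 < C) (hy : 0 < y) :
    ‖besselIntegral m n φ C y‖ ≤ besselBound * C ^ (-15 / 16 : ℝ) * y ^ (-15 / 16 : ℝ) := by
  have e : ∀ x : ℝ, (C * (x ^ 2 + y ^ 2)) ^ (-15 / 16 : ℝ) * y ^ (-1 / 16 : ℝ) =
      (C ^ (-15 / 16 : ℝ) * y ^ (-31 / 16 : ℝ)) * (1 + (y⁻¹ * x) ^ 2) ^ (-15 / 16 : ℝ) := by
    intro x
    have : C * (x ^ 2 + y ^ 2) = C * (y ^ 2 * (1 + (y⁻¹ * x) ^ 2)) := by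
      field_simp
      ring
    rw [this, Real.mul_rpow hC.le (by positivity), Real.mul_rpow (by positivity) (by positivity),
      ← Real.rpow_natCast y, ← Real.rpow_mul hy.le]
    have h2 : y ^ (-31 / 16 : ℝ) = y ^ (((2 : ℕ) : ℝ) * (-15 / 16)) * y ^ (-1 / 16 : ℝ) := by
      rw [← Real.rpow_add hy]
      norm_num
    rw [h2]
    ring
  have hint : Integrable fun x : ℝ => (C * (x ^ 2 + y ^ 2)) ^ (-15 / 16 : ℝ) * y ^ (-1 / 16 : ℝ) := by
    simp_rw [e]
    exact (integrable_one_add_sq_rpow.comp_mul_left' (by positivity)).const_mul _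
  refine (norm_integral_le_of_norm_le hint (Filter.Eventually.of_forall fun x => ?_)).trans_eq ?_
  · rw [norm_mul, norm_expTwoPiI_neg_intCast_mul, mul_one, norm_mul, Complex.norm_real,
      Real.norm_eq_abs]
    exact (mul_le_of_le_one_left (norm_nonneg _) (hφ1 _)).trans (norm_besselKernel_le_rpow hm hC hy x)
  · simp_rw [e]
    rw [integral_const_mul, Measure.integral_comp_mul_left (fun x => (1 + x ^ 2) ^ (-15 / 16 : ℝ)) y⁻¹,
      inv_inv, abs_of_pos hy, smul_eq_mul, besselBound]
    have h2 : y ^ (-15 / 16 : ℝ) = y ^ (-31 / 16 : ℝ) * y := by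
      nth_rewrite 3 [← Real.rpow_one y]
      rw [← Real.rpow_add hy]
      norm_num
    rw [h2]
    ring

theorem hasSum_besselKernel (m : ℕ) (C : ℝ) (z : ℂ) :
    HasSum (fun k : ℕ => (-(2 * π * Complex.I * m / C)) ^ k / k.factorial / C * (z ^ (k + 2))⁻¹)
      (besselKernel m C z) := by
  have h := (NormedSpace.expSeries_div_hasSum_exp (2 * π * Complex.I * (-(m / (C * z))))).mul_right
    (C * z ^ 2 : ℂ)⁻¹
  rw [← Complex.exp_eq_exp_ℂ] at h
  have e (k : ℕ) : (-(2 * π * Complex.I * m / C)) ^ k / k.factorial / C * (z ^ (k + 2))⁻¹ =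
      (2 * π * Complex.I * (-(m / (C * z)))) ^ k / k.factorial * (C * z ^ 2 : ℂ)⁻¹ := by
    rw [show 2 * π * Complex.I * (-(m / (C * z)) : ℂ) =
      (-(2 * π * Complex.I * m / C)) * z⁻¹ by rw [div_eq_mul_inv, mul_inv]; ring, mul_pow]
    ring
  rw [funext e, show besselKernel m C z = _ from div_eq_mul_inv _ _]
  exact h

/-- Expand the kernel in powers of 1/z, integrate term by term with
`integral_inv_add_mul_I_pow_mul_exp`, and recognise the series of J₁. The exchange is licensed by
|z|^(-k-2) ≤ y^(-k)/(x² + y²), whose coefficients sum to an exponential. -/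
theorem besselIntegral_one (m : ℕ) (hm : 0 < m) (n : ℤ) {C y : ℝ} (hC : 0 < C) (hy : 0 < y) :
    besselIntegral m n (fun _ => 1) C y =
      if 0 < n then -(2 * π * (√((m : ℝ) * n) / m : ℝ) / (√C : ℝ)) *
        besselJ1 (4 * π * (√((m : ℝ) * n) : ℝ) / (√C : ℝ)) * Real.exp (-(2 * π * n * y)) else 0 := by
  have h1 : HasSum (fun k : ℕ => ∫ x : ℝ, (-(2 * π * Complex.I * m / C)) ^ k / k.factorial / C *
      ((((x : ℂ) + y * Complex.I) ^ (k + 2))⁻¹ * expTwoPiI (-((n : ℝ) * x))))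
      (besselIntegral m n (fun _ => 1) C y) := by
    have e : besselIntegral m n (fun _ => 1) C y = ∫ x : ℝ, ∑' k : ℕ,
        (-(2 * π * Complex.I * m / C)) ^ k / k.factorial / C *
        ((((x : ℂ) + y * Complex.I) ^ (k + 2))⁻¹ * expTwoPiI (-((n : ℝ) * x))) := by
      refine integral_congr_ae (Filter.Eventually.of_forall fun x => ?_)
      simp only
      simp_rw [← mul_assoc]
      rw [tsum_mul_right, (hasSum_besselKernel m C _).tsum_eq]
      simp
    rw [e]
    have hb : ∀ k (x : ℝ), ‖(-(2 * π * Complex.I * m / C)) ^ k / k.factorial / C *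
        ((((x : ℂ) + y * Complex.I) ^ (k + 2))⁻¹ * expTwoPiI (-((n : ℝ) * x)))‖ ≤
        ((2 * π * m / C * y⁻¹) ^ k / k.factorial) * (C * (x ^ 2 + y ^ 2))⁻¹ := by
      intro k x
      have := norm_inv_add_mul_I_pow_le hy k x
      have hn := norm_expTwoPiI_neg_intCast_mul n x
      rw [norm_mul, norm_mul, Complex.ofReal_intCast, hn, mul_one, norm_div, norm_div, norm_pow, norm_neg]
      simp only [norm_div, norm_mul, Complex.norm_real, Complex.norm_I, Complex.norm_natCast,
        Complex.norm_ofNat, mul_one, Real.norm_of_nonneg hC.le, Real.norm_of_nonneg Real.pi_pos.le]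
      calc _ ≤ (2 * π * m / C) ^ k / k.factorial / C * ((y ^ k)⁻¹ * (x ^ 2 + y ^ 2)⁻¹) := by gcongr
        _ = _ := by rw [mul_pow, inv_pow, mul_inv]; ring
    have hint := integrable_inv_mul_sq_add_sq C hy
    have hi : ∀ k : ℕ, Integrable fun x : ℝ => (-(2 * π * Complex.I * m / C)) ^ k / k.factorial / C *
        ((((x : ℂ) + y * Complex.I) ^ (k + 2))⁻¹ * expTwoPiI (-((n : ℝ) * x))) := fun k =>
      (hint.const_mul _).mono' (Continuous.aestronglyMeasurable
        (continuous_const.mul ((continuous_inv_add_mul_I_pow hy _).mul (by fun_prop))))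
        (Filter.Eventually.of_forall (hb k))
    refine hasSum_integral_of_summable_integral_norm hi ?_
    refine Summable.of_nonneg_of_le (fun k => integral_nonneg fun x => norm_nonneg _)
      (fun k => integral_mono (hi k).norm (hint.const_mul _) (hb k)) ?_
    simp_rw [integral_const_mul]
    exact (Real.summable_pow_div_factorial _).mul_right _
  rw [← h1.tsum_eq]
  simp_rw [integral_const_mul, integral_inv_add_mul_I_pow_mul_exp hy]
  simp only [Int.cast_pos]
  split_ifs with hn
  · rw [besselJ1, ← tsum_mul_left, ← tsum_mul_right]
    refine tsum_congr fun k => ?_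
    have hmn : (0 : ℝ) ≤ (m : ℝ) * n := by positivity
    have hs : ((√((m : ℝ) * n) : ℝ) : ℂ) ^ 2 = m * n := by
      rw [← Complex.ofReal_pow, Real.sq_sqrt hmn]; push_cast; rfl
    have hsC : ((√C : ℝ) : ℂ) ^ 2 = C := by
      rw [← Complex.ofReal_pow, Real.sq_sqrt hC.le]
    have hC0 : ((√C : ℝ) : ℂ) ≠ 0 := Complex.ofReal_ne_zero.2 (Real.sqrt_pos.2 hC).ne'
    have hm0 : (m : ℂ) ≠ 0 := Nat.cast_ne_zero.2 hm.ne'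
    have hCC : (C : ℂ) ≠ 0 := Complex.ofReal_ne_zero.2 hC.ne'
    set s : ℂ := ((√((m : ℝ) * n) : ℝ) : ℂ) with hs_def
    set r : ℂ := ((√C : ℝ) : ℂ) with hr_def
    have e1 : (4 * π * s / r / 2) ^ (2 * k + 1) =
        (4 * π ^ 2 * (m * n) / C) ^ k * (2 * π * s / r) := by
      rw [pow_succ, pow_mul, ← hs, ← hsC]
      congr 1
      · congr 1
        ring
      · ring
    have e2 : (-(2 * π * Complex.I * m / C)) ^ k * (-2 * π * Complex.I) ^ (k + 2) * (n : ℂ) ^ (k + 1) =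
        ((-1) ^ k * (4 * π ^ 2 * (m * n) / C) ^ k) * (-(4 * π ^ 2 * n)) := by
      rw [pow_add, pow_succ (n : ℂ) k, ← mul_pow]
      have : (-(2 * π * Complex.I * m / C)) ^ k * ((-2 * π * Complex.I) ^ k) * (n : ℂ) ^ k =
          (-1 * (4 * π ^ 2 * (m * n) / C)) ^ k := by
        rw [← mul_pow, ← mul_pow]
        congr 1
        linear_combination (4 * π ^ 2 * (m * n) / C : ℂ) * Complex.I_sq
      rw [← this]
      linear_combination (4 * π ^ 2 * (-(2 * π * Complex.I * m / C)) ^ k *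
        (-2 * π * Complex.I) ^ k * n ^ k * n : ℂ) * Complex.I_sq
    have e3 : s * s = m * n := by rw [← hs, sq]
    have e4 : r * r = C := by rw [← hsC, sq]
    rw [e1]
    push_cast
    rw [← hs_def]
    have e5 : (2 * π * (s / m) / r) * (2 * π * s / r) = 4 * π ^ 2 * n / C := by
      rw [← e4]
      field_simp
      linear_combination 4 * e3
    calc _ = ((-(2 * π * Complex.I * m / C)) ^ k * (-2 * π * Complex.I) ^ (k + 2) *
          (n : ℂ) ^ (k + 1)) / (k.factorial * (k + 1).factorial) / C *
          Complex.exp (-(2 * π * n * y)) := by ring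
      _ = ((-1) ^ k * (4 * π ^ 2 * (m * n) / C) ^ k) / (k.factorial * (k + 1).factorial) *
          (-(4 * π ^ 2 * n / C)) * Complex.exp (-(2 * π * n * y)) := by rw [e2]; ring
      _ = _ := by rw [← e5]; ring
  · simp

end BesselIntegral

/-! ### Finiteness properties of the action of SL(2, ℤ) -/

section Finiteness

theorem isCompact_rectangle (X : ℝ) {Y₁ : ℝ} (Y₂ : ℝ) (hY : 0 < Y₁) :
    IsCompact {z : ℍ | |z.re| ≤ X ∧ Y₁ ≤ z.im ∧ z.im ≤ Y₂} := by
  have h : IsCompact (Set.Icc (-X) X ×ℂ Set.Icc Y₁ Y₂) := isCompact_Icc.reProdIm isCompact_Icc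
  have h2 := (UpperHalfPlane.isOpenEmbedding_coe.isInducing.isCompact_preimage_iff
    (K := Set.Icc (-X) X ×ℂ Set.Icc Y₁ Y₂) ?_).2 h
  · convert h2 using 1
    ext z
    simp [Complex.mem_reProdIm, abs_le, and_assoc]
  · intro z hz
    exact ⟨⟨z, hY.trans_le (Complex.mem_reProdIm.1 hz).2.1⟩, rfl⟩

theorem finite_setOf_image_inter_nonempty {K L : Set ℍ} (hK : IsCompact K) (hL : IsCompact L) :
    {σ : SL(2, ℤ) | ∃ z ∈ K, σ • z ∈ L}.Finite := by
  have h := ProperlyDiscontinuousSMul.finite_disjoint_inter_image (Γ := 𝒮ℒ) (T := ℍ) hK hL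
  let f : SL(2, ℤ) → 𝒮ℒ := fun σ => ⟨Matrix.SpecialLinearGroup.mapGL ℝ σ, ⟨σ, rfl⟩⟩
  have hf : Function.Injective f := fun a b hab =>
    Matrix.SpecialLinearGroup.mapGL_injective (Subtype.ext_iff.1 hab)
  refine (h.preimage hf.injOn).subset ?_
  rintro σ ⟨z, hz, hz'⟩
  exact ⟨σ • z, ⟨z, hz, rfl⟩, hz'⟩

/-- The orbits of `SL(2, ℤ)` meet a compact set boundedly often. -/
theorem exists_encard_smul_mem_le {K : Set ℍ} (hK : IsCompact K) :
    ∃ C : ℕ, ∀ w : ℍ, {σ : SL(2, ℤ) | σ • w ∈ K}.encard ≤ C := by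
  have h := finite_setOf_image_inter_nonempty hK hK
  refine ⟨h.toFinset.card, fun w => ?_⟩
  by_cases hne : ∃ σ₀ : SL(2, ℤ), σ₀ • w ∈ K
  · obtain ⟨σ₀, h₀⟩ := hne
    rw [← Set.encard_coe_eq_coe_finsetCard, h.coe_toFinset]
    -- σσ₀⁻¹ moves the point σ₀w of K into K; the count of such matrices does not involve w.
    refine Set.encard_le_encard_of_injOn (f := fun σ => σ * σ₀⁻¹) ?_
      (fun a _ b _ hab => mul_right_cancel hab)
    intro σ hσ
    refine ⟨σ₀ • w, h₀, ?_⟩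
    rwa [← mul_smul, inv_mul_cancel_right]
  · have : {σ : SL(2, ℤ) | σ • w ∈ K} = ∅ :=
      Set.eq_empty_of_forall_notMem fun σ hσ => hne ⟨σ, hσ⟩
    rw [this]
    simp

/-- For c ≠ 0 one has |cw + d|² ≥ c²(Im w)² ≥ (Im w)². -/
theorem im_SL_smul_le_of_ne_zero (σ : SL(2, ℤ)) (w : ℍ) (hg : σ 1 0 ≠ 0) :
    (σ • w).im ≤ 1 / w.im := by
  rw [ModularGroup.im_smul_eq_div_normSq, ModularGroup.denom_apply]
  have h1 : (1 : ℝ) ≤ σ 1 0 ^ 2 := mod_cast (one_le_sq_iff_one_le_abs _).mpr (Int.one_le_abs hg)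
  rw [show Complex.normSq ((σ 1 0) * w + (σ 1 1)) =
    ((σ 1 0) * w.re + (σ 1 1)) ^ 2 + (σ 1 0) ^ 2 * w.im ^ 2 by simp [Complex.normSq_apply]; ring]
  have hw := w.im_pos
  have h2 : w.im ^ 2 ≤ (σ 1 0) ^ 2 * w.im ^ 2 := le_mul_of_one_le_left (by positivity) h1
  have h3 : 0 ≤ ((σ 1 0) * w.re + (σ 1 1)) ^ 2 := sq_nonneg _
  rw [div_le_div_iff₀ (by nlinarith [sq_pos_of_pos hw]) hw]
  nlinarith

theorem im_SL_smul_le (σ : SL(2, ℤ)) (w : ℍ) : (σ • w).im ≤ max w.im (1 / w.im) := by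
  by_cases hg : σ 1 0 = 0
  · rw [ModularGroup.im_smul_eq_div_normSq, ModularGroup.denom_apply]
    have : σ 1 1 ≠ 0 := fun hg' => zero_ne_one <| by
      simpa only [Matrix.det_fin_two, hg, hg', mul_zero, mul_zero, sub_zero] using σ.det_coe
    have : (1 : ℝ) ≤ σ 1 1 ^ 2 := mod_cast (one_le_sq_iff_one_le_abs _).mpr (Int.one_le_abs this)
    refine le_trans ?_ <| le_max_left _ _
    rw [show Complex.normSq ((σ 1 0) * w + (σ 1 1)) = (σ 1 1) ^ 2 by simp [hg, sq]]
    exact div_le_self w.im_pos.le this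
  · exact (im_SL_smul_le_of_ne_zero σ w hg).trans (le_max_right _ _)

end Finiteness

/-! ### The truncated exponential on a vertical strip -/

section Strip

/-- The function `z ↦ φ(Im z) e^{2iπmz}` on the strip `0 ≤ Re z < 1`, and `0` elsewhere. -/
def stripFun (m : ℕ) (φ : ℝ → ℝ) (z : ℍ) : ℂ :=
  if 0 ≤ z.re ∧ z.re < 1 then φ z.im * expTwoPiI (m * z) else 0

/-- The orbit of w has bounded height and the cutoff excludes small heights, so only the orbit
points in a compact rectangle count. -/
theorem finite_support_stripFun (m : ℕ) {φ : ℝ → ℝ} {δ : ℝ} (hδ : 0 < δ)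
    (hφ : ∀ t ≤ δ, φ t = 0) (w : ℍ) : {σ : SL(2, ℤ) | stripFun m φ (σ • w) ≠ 0}.Finite := by
  refine (finite_setOf_image_inter_nonempty (isCompact_singleton (x := w))
    (isCompact_rectangle 1 (max w.im (1 / w.im)) hδ)).subset ?_
  intro σ hσ
  have hσ' : stripFun m φ (σ • w) ≠ 0 := hσ
  unfold stripFun at hσ'
  split_ifs at hσ' with h
  · refine ⟨w, rfl, abs_le.2 ⟨by linarith [h.1], h.2.le⟩, ?_, im_SL_smul_le σ w⟩
    by_contra hlt
    exact hσ' (by rw [hφ _ (not_le.1 hlt).le]; simp)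
  · exact absurd rfl hσ'

theorem stripFun_slash_apply (m : ℕ) (φ : ℝ → ℝ) (σ : SL(2, ℤ)) (w : ℍ) :
    (stripFun m φ ∣[(2 : ℤ)] σ) w = stripFun m φ (σ • w) * (((σ 1 0 : ℂ) * w + (σ 1 1 : ℂ)) ^ 2)⁻¹ := by
  rw [ModularForm.SL_slash_apply, ModularGroup.denom_apply]
  rfl

theorem finite_support_stripFun_slash (m : ℕ) {φ : ℝ → ℝ} {δ : ℝ} (hδ : 0 < δ)
    (hφ : ∀ t ≤ δ, φ t = 0) (w : ℍ) :
    (Function.support fun σ : SL(2, ℤ) => (stripFun m φ ∣[(2 : ℤ)] σ) w).Finite := by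
  refine (finite_support_stripFun m hδ hφ w).subset fun σ hσ h => hσ ?_
  simp only [stripFun_slash_apply, h, zero_mul]

theorem stripFun_neg_slash (m : ℕ) (φ : ℝ → ℝ) (σ : SL(2, ℤ)) (w : ℍ) :
    (stripFun m φ ∣[(2 : ℤ)] (-σ)) w = (stripFun m φ ∣[(2 : ℤ)] σ) w := by
  rw [stripFun_slash_apply, stripFun_slash_apply, ModularGroup.SL_neg_smul]
  congr 2
  simp only [Matrix.SpecialLinearGroup.coe_neg, Matrix.neg_apply]
  push_cast
  ring

/-- Exactly one integer translate falls into the unit interval. -/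
theorem hasSum_translate_unit_interval {E : Type*} [AddCommMonoid E] [TopologicalSpace E]
    (t : ℝ) (v : E) : HasSum (fun j : ℤ => if 0 ≤ t + j ∧ t + j < 1 then v else 0) v := by
  have h : (fun j : ℤ => if 0 ≤ t + j ∧ t + j < 1 then v else 0) =
      fun j => if j = -⌊t⌋ then v else 0 := by
    ext j
    congr 1
    rw [eq_iff_iff, eq_neg_iff_add_eq_zero, add_comm j, ← Int.floor_add_intCast,
      Int.floor_eq_zero_iff]
    rfl
  rw [h]
  exact hasSum_ite_eq _ _

end Strip

/-! ### Parametrisation of the matrices by modulus, residue and translations -/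

section Coset

/-- The matrices in `SL(2, ℤ)` whose lower row is `(c, d)` with `M ∣ c` and `Q ∣ d`. -/
def cosetSet (M Q : ℕ) : Set SL(2, ℤ) := {σ | (M : ℤ) ∣ σ 1 0 ∧ (Q : ℤ) ∣ σ 1 1}

/-- The moduli: positive multiples of `M` prime to `Q`. -/
abbrev Modulus (M Q : ℕ) : Type := {c : ℕ+ // M ∣ (c : ℕ) ∧ Nat.Coprime (c : ℕ) Q}

/-- The point `Q z`. -/
def scalePoint (Q : ℕ) [NeZero Q] (z : ℍ) : ℍ :=
  ⟨Q * z, by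
    have : (0 : ℝ) < Q := Nat.cast_pos.2 (NeZero.pos Q)
    simpa using mul_pos this z.im_pos⟩

@[simp] theorem coe_scalePoint (Q : ℕ) [NeZero Q] (z : ℍ) :
    (scalePoint Q z : ℂ) = Q * z := rfl

@[simp] theorem scalePoint_im (Q : ℕ) [NeZero Q] (z : ℍ) : (scalePoint Q z).im = Q * z.im := by
  rw [← coe_im, coe_scalePoint]; simp

/-- The inverse of `Q` as a unit modulo a number prime to `Q`. -/
def Modulus.unit {M Q : ℕ} (c : Modulus M Q) : (ZMod (c.1 : ℕ))ˣ :=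
  ZMod.unitOfCoprime Q c.2.2.symm

variable {M Q : ℕ}

/-- The upper left entry of the matrix attached to `c`, `r` modulo `c` and `j`. -/
def cellTop (c : Modulus M Q) (r : (ZMod (c.1 : ℕ))ˣ) : ℤ :=
  ((((c.unit * r)⁻¹ : (ZMod (c.1 : ℕ))ˣ) : ZMod (c.1 : ℕ)).val : ℤ)

/-- The upper left entry inverts Qr modulo c, so ad ≡ 1 for d = Q(r + cl); this makes the upper
right entry (ad - 1)/c an integer. -/
theorem dvd_cellTop_mul (c : Modulus M Q) (r : (ZMod (c.1 : ℕ))ˣ) (l j : ℤ) :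
    ((c.1 : ℕ) : ℤ) ∣ (cellTop c r + (c.1 : ℕ) * j) *
      (Q * (((r : ZMod (c.1 : ℕ)).val : ℤ) + (c.1 : ℕ) * l)) - 1 := by
  rw [← ZMod.intCast_zmod_eq_zero_iff_dvd]
  unfold cellTop
  push_cast
  simp only [ZMod.natCast_val, ZMod.cast_id', id, CharP.cast_eq_zero, zero_mul, add_zero]
  have h : (Q : ZMod (c.1 : ℕ)) = (c.unit : ZMod (c.1 : ℕ)) :=
    (ZMod.coe_unitOfCoprime Q c.2.2.symm).symm
  rw [h, ← Units.val_mul, ← Units.val_mul, inv_mul_cancel]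
  simp

/-- The matrix with lower row `(c, Q (r + c l))` and upper left entry determined by `j`. -/
def cellMatrix (p : (Σ c : Modulus M Q, (ZMod (c.1 : ℕ))ˣ × ℤ) × ℤ) : SL(2, ℤ) :=
  ⟨!![cellTop p.1.1 p.1.2.1 + (p.1.1.1 : ℕ) * p.2,
      ((cellTop p.1.1 p.1.2.1 + (p.1.1.1 : ℕ) * p.2) *
      (Q * (((p.1.2.1 : ZMod (p.1.1.1 : ℕ)).val : ℤ) + (p.1.1.1 : ℕ) * p.1.2.2)) - 1) /
        (p.1.1.1 : ℕ);
      (p.1.1.1 : ℕ), Q * (((p.1.2.1 : ZMod (p.1.1.1 : ℕ)).val : ℤ) + (p.1.1.1 : ℕ) * p.1.2.2)], by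
    rw [Matrix.det_fin_two_of, Int.ediv_mul_cancel (dvd_cellTop_mul _ _ _ _)]
    ring⟩

theorem cellMatrix_injective [NeZero Q] :
    Function.Injective (cellMatrix : (Σ c : Modulus M Q, (ZMod (c.1 : ℕ))ˣ × ℤ) × ℤ → SL(2, ℤ)) := by
  rintro ⟨⟨c, r, l⟩, j⟩ ⟨⟨c', r', l'⟩, j'⟩ h
  have e10 : ((c.1 : ℕ) : ℤ) = (c'.1 : ℕ) := congrArg (fun σ : SL(2, ℤ) => σ 1 0) h
  obtain rfl : c = c' := by
    apply Subtype.ext; apply PNat.coe_injective; exact_mod_cast e10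
  have hc : ((c.1 : ℕ) : ℤ) ≠ 0 := by exact_mod_cast c.1.ne_zero
  have e11 : (Q : ℤ) * (((r : ZMod (c.1 : ℕ)).val : ℤ) + (c.1 : ℕ) * l) =
    Q * (((r' : ZMod (c.1 : ℕ)).val : ℤ) + (c.1 : ℕ) * l') :=
      congrArg (fun σ : SL(2, ℤ) => σ 1 1) h
  have e11' := mul_left_cancel₀ (by exact_mod_cast NeZero.ne Q) e11
  have hr : r = r' := by
    apply Units.ext
    have := congrArg (Int.cast : ℤ → ZMod (c.1 : ℕ)) e11'
    simpa using this
  subst hr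
  have hl : l = l' := mul_left_cancel₀ hc (add_left_cancel e11')
  subst hl
  have e00 : cellTop c r + (c.1 : ℕ) * j = cellTop c r + (c.1 : ℕ) * j' :=
    congrArg (fun σ : SL(2, ℤ) => σ 0 0) h
  have hj : j = j' := mul_left_cancel₀ hc (add_left_cancel e00)
  rw [hj]

/-- For a matrix with c > 0 and d = Qd', determinant 1 forces c to be prime to Q and d' to be prime
to c, and makes a the inverse of Qd' modulo c. Hence r and l are the residue and quotient of d',
while j is the quotient of a; the entry b is then determined. -/
theorem range_cellMatrix [NeZero Q] :
    Set.range (cellMatrix : (Σ c : Modulus M Q, (ZMod (c.1 : ℕ))ˣ × ℤ) × ℤ → SL(2, ℤ)) =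
      {σ ∈ cosetSet M Q | 0 < σ 1 0} := by
  ext σ
  constructor
  · rintro ⟨⟨⟨c, r, l⟩, j⟩, rfl⟩
    refine ⟨⟨?_, ?_⟩, ?_⟩
    · exact Int.natCast_dvd_natCast.2 c.2.1
    · exact dvd_mul_right _ _
    · change (0 : ℤ) < (c.1 : ℕ)
      exact_mod_cast c.1.pos
  · rintro ⟨⟨hM, d, hd⟩, h0⟩
    have hdet := σ.det_coe
    rw [Matrix.det_fin_two] at hdet
    obtain ⟨k, hk⟩ : ∃ k : ℕ, σ 1 0 = k := ⟨(σ 1 0).toNat, (Int.toNat_of_nonneg h0.le).symm⟩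
    have hk0 : 0 < k := by rw [hk] at h0; exact_mod_cast h0
    have hkQ : Nat.Coprime k Q := by
      rw [← Nat.isCoprime_iff_coprime]
      refine ⟨-σ 0 1, σ 0 0 * d, ?_⟩
      rw [hd, hk] at hdet
      linarith
    rw [hk] at hM
    obtain ⟨c, hc⟩ : ∃ c : Modulus M Q, (c.1 : ℕ) = k :=
      ⟨⟨⟨k, hk0⟩, Int.natCast_dvd_natCast.1 hM, hkQ⟩, rfl⟩
    subst hc
    rw [hk] at hdet
    have hkd : IsCoprime d ((c.1 : ℕ) : ℤ) := ⟨σ 0 0 * Q, -σ 0 1, by rw [hd] at hdet; linarith⟩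
    let r : (ZMod (c.1 : ℕ))ˣ := ZMod.unitOfIsCoprime d hkd
    have hr : ((r : ZMod (c.1 : ℕ)).val : ℤ) + (c.1 : ℕ) * (d / (c.1 : ℕ)) = d := by
      rw [ZMod.coe_unitOfIsCoprime, ZMod.val_intCast, Int.emod_add_mul_ediv]
    have ha : cellTop c r + (c.1 : ℕ) * (σ 0 0 / (c.1 : ℕ)) = σ 0 0 := by
      have h1 : (((c.unit * r)⁻¹ : (ZMod (c.1 : ℕ))ˣ) : ZMod (c.1 : ℕ)) = ((σ 0 0 : ℤ) : ZMod (c.1 : ℕ)) := by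
        rw [Units.inv_eq_of_mul_eq_one_right]
        rw [Units.val_mul, ZMod.coe_unitOfIsCoprime]
        have h2 := congrArg (Int.cast : ℤ → ZMod (c.1 : ℕ)) hdet
        rw [hd] at h2
        push_cast at h2
        rw [ZMod.natCast_self, mul_zero, sub_zero] at h2
        rw [← h2, mul_comm]
        rfl
      have h2 : cellTop c r = ((((σ 0 0 : ℤ) : ZMod (c.1 : ℕ))).val : ℤ) := by rw [← h1]; rfl
      rw [h2, ZMod.val_intCast, Int.emod_add_mul_ediv]
    refine ⟨⟨⟨c, r, d / (c.1 : ℕ)⟩, σ 0 0 / (c.1 : ℕ)⟩, ?_⟩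
    apply Matrix.SpecialLinearGroup.ext
    have hkz : ((c.1 : ℕ) : ℤ) ≠ 0 := by exact_mod_cast hk0.ne'
    have e00 : cellMatrix ⟨⟨c, r, d / (c.1 : ℕ)⟩, σ 0 0 / (c.1 : ℕ)⟩ 0 0 = σ 0 0 := ha
    have e10 : cellMatrix ⟨⟨c, r, d / (c.1 : ℕ)⟩, σ 0 0 / (c.1 : ℕ)⟩ 1 0 = σ 1 0 := hk.symm
    have e11 : cellMatrix ⟨⟨c, r, d / (c.1 : ℕ)⟩, σ 0 0 / (c.1 : ℕ)⟩ 1 1 = σ 1 1 := by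
      rw [hd]; exact congrArg ((Q : ℤ) * ·) hr
    have e01 : cellMatrix ⟨⟨c, r, d / (c.1 : ℕ)⟩, σ 0 0 / (c.1 : ℕ)⟩ 0 1 = σ 0 1 := by
      have h := (cellMatrix ⟨⟨c, r, d / (c.1 : ℕ)⟩, σ 0 0 / (c.1 : ℕ)⟩).det_coe
      rw [Matrix.det_fin_two, e00, e10, e11, hk] at h
      exact mul_right_cancel₀ hkz (by linarith)
    intro i j
    fin_cases i <;> fin_cases j
    exacts [e00, e01, e10, e11]

end Coset

/-! ### The term attached to one matrix -/

section CellTerms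

variable {M Q : ℕ}

/-- The Bessel kernel on the horizontal line at height `y`, cut off by the function `φ`. -/
def cutoffKernel (m : ℕ) (φ : ℝ → ℝ) (C y x : ℝ) : ℂ :=
  φ (y / (C * (x ^ 2 + y ^ 2))) * besselKernel m C (x + y * Complex.I)

/-- The character value at the inverse of `Q r`. -/
def cellChar (m : ℕ) (c : Modulus M Q) (r : (ZMod (c.1 : ℕ))ˣ) : ℂ :=
  ZMod.stdAddChar ((m : ZMod (c.1 : ℕ)) * (((c.unit * r)⁻¹ : (ZMod (c.1 : ℕ))ˣ) : ZMod (c.1 : ℕ)))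

/-- The real translation `r / c + l`. -/
def cellShift (p : Σ c : Modulus M Q, (ZMod (c.1 : ℕ))ˣ × ℤ) : ℝ :=
  ((p.2.1 : ZMod (p.1.1 : ℕ)).val : ℝ) / (p.1.1 : ℕ) + p.2.2

theorem expTwoPiI_cellTop (m : ℕ) (c : Modulus M Q) (r : (ZMod (c.1 : ℕ))ˣ) :
    expTwoPiI (m * ((cellTop c r : ℂ) / (c.1 : ℕ))) = cellChar m c r := by
  have h : (m : ZMod (c.1 : ℕ)) * (((c.unit * r)⁻¹ : (ZMod (c.1 : ℕ))ˣ) : ZMod (c.1 : ℕ)) =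
      ((m * cellTop c r : ℤ) : ZMod (c.1 : ℕ)) := by
    simp [cellTop]
  rw [cellChar, h, ZMod.stdAddChar_coe, expTwoPiI]
  congr 1
  push_cast
  ring

theorem coe_SL_smul_eq (σ : SL(2, ℤ)) (w : ℍ) (h : σ 1 0 ≠ 0) :
    ((σ • w : ℍ) : ℂ) = (σ 0 0 : ℂ) / (σ 1 0 : ℂ) -
      1 / ((σ 1 0 : ℂ) * ((σ 1 0 : ℂ) * w + (σ 1 1 : ℂ))) := by
  rw [coe_specialLinearGroup_apply]
  have h0 : (σ 1 0 : ℂ) ≠ 0 := by exact_mod_cast h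
  have hd : (σ 1 0 : ℂ) * w + (σ 1 1 : ℂ) ≠ 0 := by
    have := denom_ne_zero (σ : GL (Fin 2) ℝ) w
    rwa [ModularGroup.denom_apply] at this
  have hdet := σ.det_coe
  rw [Matrix.det_fin_two] at hdet
  have hdet' := congrArg (Int.cast : ℤ → ℂ) hdet
  push_cast at hdet'
  have e (k : ℤ) : ((algebraMap ℤ ℝ k : ℝ) : ℂ) = k := by simp
  simp only [e]
  rw [div_sub_div _ _ h0 (mul_ne_zero h0 hd), div_eq_div_iff hd (mul_ne_zero h0 (mul_ne_zero h0 hd))]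
  linear_combination (-(σ 1 0 : ℂ) * ((σ 1 0 : ℂ) * w + (σ 1 1 : ℂ))) * hdet'

/-- At the point Qz the denominator is Qc(z + r/c + l), so everything depends on C = Qc² and on the
real shift r/c + l. -/
theorem coe_cellMatrix_smul [NeZero Q] (p : Σ c : Modulus M Q, (ZMod (c.1 : ℕ))ˣ × ℤ) (j : ℤ)
    (z : ℍ) : ((cellMatrix (p, j) • scalePoint Q z : ℍ) : ℂ) =
      (cellTop p.1 p.2.1 : ℂ) / (p.1.1 : ℕ) + j -
        1 / (((Q * (p.1.1 : ℕ) ^ 2 : ℝ) : ℂ) *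
          (((z.re + cellShift p : ℝ) : ℂ) + z.im * Complex.I)) ∧
      (((cellMatrix (p, j) 1 0 : ℤ) : ℂ) * scalePoint Q z + (cellMatrix (p, j) 1 1 : ℤ)) ^ 2 =
        Q * (((Q * (p.1.1 : ℕ) ^ 2 : ℝ) : ℂ) *
          (((z.re + cellShift p : ℝ) : ℂ) + z.im * Complex.I) ^ 2) := by
  obtain ⟨c, r, l⟩ := p
  have hc : ((c.1 : ℕ) : ℂ) ≠ 0 := by exact_mod_cast c.1.ne_zero
  have hQ : (Q : ℂ) ≠ 0 := by exact_mod_cast NeZero.ne Q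
  set ζ : ℂ := (((z.re + cellShift ⟨c, r, l⟩ : ℝ) : ℂ) + z.im * Complex.I) with hζ
  have hζ0 : ζ ≠ 0 := add_mul_I_ne_zero z.im_pos _
  have hden : ((cellMatrix (⟨c, r, l⟩, j) 1 0 : ℤ) : ℂ) * scalePoint Q z +
      (cellMatrix (⟨c, r, l⟩, j) 1 1 : ℤ) = Q * (c.1 : ℕ) * ζ := by
    have e10 : cellMatrix (⟨c, r, l⟩, j) 1 0 = (c.1 : ℕ) := rfl
    have e11 : cellMatrix (⟨c, r, l⟩, j) 1 1 =
      Q * (((r : ZMod (c.1 : ℕ)).val : ℤ) + (c.1 : ℕ) * l) := rfl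
    have ez : (z : ℂ) = z.re + z.im * Complex.I := (Complex.re_add_im _).symm
    rw [e10, e11, hζ, coe_scalePoint, ez, cellShift]
    push_cast
    field_simp
    ring
  refine ⟨?_, ?_⟩
  · rw [coe_SL_smul_eq _ _ (by change ((c.1 : ℕ) : ℤ) ≠ 0; exact_mod_cast c.1.ne_zero), hden]
    have e00 : cellMatrix (⟨c, r, l⟩, j) 0 0 = cellTop c r + (c.1 : ℕ) * j := rfl
    have e10 : cellMatrix (⟨c, r, l⟩, j) 1 0 = (c.1 : ℕ) := rfl
    rw [e00, e10]
    push_cast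
    field_simp
  · rw [hden]
    push_cast
    ring

/-- Changing j translates the image by an integer, which only affects whether it lies in the strip;
exactly one j will survive. The factor Q cancels the Q in the square of the denominator. -/
theorem slash_cellMatrix [NeZero Q] (m : ℕ) (φ : ℝ → ℝ)
    (p : Σ c : Modulus M Q, (ZMod (c.1 : ℕ))ˣ × ℤ) (z : ℍ) : ∃ t : ℝ, ∀ j : ℤ,
    Q * (stripFun m φ ∣[(2 : ℤ)] cellMatrix (p, j)) (scalePoint Q z) =
      if 0 ≤ t + j ∧ t + j < 1 then
        cellChar m p.1 p.2.1 * cutoffKernel m φ (Q * (p.1.1 : ℕ) ^ 2) z.im (z.re + cellShift p)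
      else 0 := by
  have hQ : (Q : ℂ) ≠ 0 := by exact_mod_cast NeZero.ne Q
  set C : ℝ := Q * (p.1.1 : ℕ) ^ 2 with hC
  set x' : ℝ := z.re + cellShift p with hx'
  set ζ : ℂ := (x' : ℂ) + z.im * Complex.I with hζ
  have hC0 : 0 < C := mul_pos (Nat.cast_pos.2 (NeZero.pos Q)) (by have := p.1.1.pos; positivity)
  have hn : Complex.normSq ζ = x' ^ 2 + z.im ^ 2 := Complex.normSq_add_mul_I _ _
  refine ⟨(cellTop p.1 p.2.1 : ℝ) / (p.1.1 : ℕ) - (1 / ((C : ℂ) * ζ)).re, fun j => ?_⟩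
  obtain ⟨h1, h2⟩ := coe_cellMatrix_smul p j z
  rw [← hC, ← hx', ← hζ] at h1 h2
  set s := cellMatrix (p, j) • scalePoint Q z with hs
  have hre : s.re = (cellTop p.1 p.2.1 : ℝ) / (p.1.1 : ℕ) - (1 / ((C : ℂ) * ζ)).re + j := by
    rw [← coe_re, h1]
    have : ((cellTop p.1 p.2.1 : ℂ) / (p.1.1 : ℕ)) =
      (((cellTop p.1 p.2.1 : ℝ) / (p.1.1 : ℕ) : ℝ) : ℂ) := by push_cast; rfl
    rw [this, Complex.sub_re, Complex.add_re, Complex.ofReal_re, Complex.intCast_re]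
    ring
  have him : s.im = z.im / (C * (x' ^ 2 + z.im ^ 2)) := by
    rw [← coe_im, h1]
    have : ((cellTop p.1 p.2.1 : ℂ) / (p.1.1 : ℕ)) =
      (((cellTop p.1 p.2.1 : ℝ) / (p.1.1 : ℕ) : ℝ) : ℂ) := by push_cast; rfl
    rw [this, Complex.sub_im, Complex.add_im, Complex.ofReal_im, Complex.intCast_im, one_div,
      mul_inv, ← Complex.ofReal_inv, Complex.im_ofReal_mul, Complex.inv_im, hn]
    have : ζ.im = z.im := by simp [hζ]
    rw [this]
    field_simp
    ring
  rw [stripFun_slash_apply, h2, ← hs, stripFun, hre, him]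
  split_ifs
  · have he : expTwoPiI (m * s) = cellChar m p.1 p.2.1 * expTwoPiI (-(m / (C * ζ))) := by
      rw [h1, ← expTwoPiI_cellTop, ← expTwoPiI_add]
      refine Eq.trans ?_ (expTwoPiI_add_intCast _ (m * j))
      congr 1
      push_cast
      ring
    rw [he, cutoffKernel, besselKernel, ← hζ, div_eq_mul_inv, mul_inv (Q : ℂ)]
    field_simp
  · simp

end CellTerms

/-! ### Truncated Poincaré series as sums over cells -/

section PoincareSum

variable {M Q : ℕ}

/-- Half the sum of `stripFun m φ ∣[2] σ diag(Q, 1)` over the matrices `σ` in `cosetSet M Q`. -/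
def poincareSum (m : ℕ) (φ : ℝ → ℝ) (M Q : ℕ) [NeZero Q] (z : ℍ) : ℂ :=
  2⁻¹ * ∑' σ : cosetSet M Q, Q * (stripFun m φ ∣[(2 : ℤ)] (σ : SL(2, ℤ))) (scalePoint Q z)

theorem hasSum_cell [NeZero Q] (m : ℕ) {φ : ℝ → ℝ} {δ : ℝ} (hδ : 0 < δ)
    (hφ : ∀ t ≤ δ, φ t = 0) (z : ℍ) :
    HasSum (fun p : Σ c : Modulus M Q, (ZMod (c.1 : ℕ))ˣ × ℤ =>
      cellChar m p.1 p.2.1 * cutoffKernel m φ (Q * (p.1.1 : ℕ) ^ 2) z.im (z.re + cellShift p))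
      (∑' σ : SL(2, ℤ), Set.indicator {σ ∈ cosetSet M Q | 0 < σ 1 0}
        (fun σ => Q * (stripFun m φ ∣[(2 : ℤ)] σ) (scalePoint Q z)) σ) := by
  set F : SL(2, ℤ) → ℂ := fun σ => Q * (stripFun m φ ∣[(2 : ℤ)] σ) (scalePoint Q z) with hF
  have hfin : (Function.support F).Finite := by
    refine (finite_support_stripFun_slash m hδ hφ (scalePoint Q z)).subset fun σ hσ h => hσ ?_
    simp only [hF, h, mul_zero]
  set S : Set SL(2, ℤ) := {σ ∈ cosetSet M Q | 0 < σ 1 0} with hS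
  have h1 : HasSum (S.indicator F) (∑' σ, S.indicator F σ) :=
    (summable_of_hasFiniteSupport (hfin.subset (by
      rw [Set.support_indicator]; exact Set.inter_subset_right))).hasSum
  rw [← (cellMatrix_injective (M := M) (Q := Q)).hasSum_iff] at h1
  · have h2 (p : Σ c : Modulus M Q, (ZMod (c.1 : ℕ))ˣ × ℤ) :
        HasSum (fun j : ℤ => (S.indicator F ∘ cellMatrix) (p, j))
          (cellChar m p.1 p.2.1 *
            cutoffKernel m φ (Q * (p.1.1 : ℕ) ^ 2) z.im (z.re + cellShift p)) := by
      obtain ⟨t, ht⟩ := slash_cellMatrix m φ p z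
      have e : (fun j : ℤ => (S.indicator F ∘ cellMatrix) (p, j)) = fun j : ℤ =>
          if 0 ≤ t + j ∧ t + j < 1 then cellChar m p.1 p.2.1 *
            cutoffKernel m φ (Q * (p.1.1 : ℕ) ^ 2) z.im (z.re + cellShift p) else 0 := by
        ext j
        have hmem : cellMatrix (p, j) ∈ S := by
          rw [hS, ← range_cellMatrix]; exact ⟨_, rfl⟩
        rw [Function.comp_apply, Set.indicator_of_mem hmem, hF]
        exact ht j
      rw [e]
      exact hasSum_translate_unit_interval t _
    exact h1.prod_fiberwise h2
  · intro σ hσ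
    rw [range_cellMatrix] at hσ
    exact Set.indicator_of_notMem hσ _

/-- Summing over translations undoes the restriction to the strip. -/
theorem hasSum_translations (m : ℕ) (φ : ℝ → ℝ) (w : ℍ) :
    HasSum (fun j : ℤ => (stripFun m φ ∣[(2 : ℤ)] (ModularGroup.T ^ j : SL(2, ℤ))) w)
      (φ w.im * expTwoPiI (m * w)) := by
  have e : (fun j : ℤ => (stripFun m φ ∣[(2 : ℤ)] (ModularGroup.T ^ j : SL(2, ℤ))) w) =
      fun j : ℤ => if 0 ≤ w.re + j ∧ w.re + j < 1 then φ w.im * expTwoPiI (m * w) else 0 := by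
    ext j
    rw [stripFun_slash_apply]
    have h10 : (ModularGroup.T ^ j : SL(2, ℤ)) 1 0 = 0 := by
      rw [ModularGroup.coe_T_zpow]; rfl
    have h11 : (ModularGroup.T ^ j : SL(2, ℤ)) 1 1 = 1 := by
      rw [ModularGroup.coe_T_zpow]; rfl
    have hT : (ModularGroup.T ^ j : SL(2, ℤ)) • w = (j : ℝ) +ᵥ w := modular_T_zpow_smul w j
    rw [h10, h11, hT, stripFun, vadd_re, vadd_im, add_comm w.re, coe_vadd]
    have he : expTwoPiI (m * (((j : ℝ) : ℂ) + w)) = expTwoPiI (m * w) := by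
      refine Eq.trans ?_ (expTwoPiI_add_intCast _ (m * j))
      congr 1
      push_cast
      ring
    rw [he]
    simp
  rw [e]
  exact hasSum_translate_unit_interval _ _

theorem tsum_neg_eq {S : Set SL(2, ℤ)} {F : SL(2, ℤ) → ℂ} (hF : ∀ σ, F (-σ) = F σ) :
    ∑' σ, S.indicator F σ = ∑' σ, {σ | -σ ∈ S}.indicator F σ := by
  rw [← (Equiv.neg SL(2, ℤ)).tsum_eq]
  congr 1
  ext σ
  by_cases h : -σ ∈ S
  · simp [Set.indicator, h, hF]
  · simp [Set.indicator, h]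

/-- The matrices σ and -σ have equal terms, which absorbs the factor 1/2 and leaves c > 0, that is,
the cells, together with c = 0 and d = 1. The latter satisfies Q ∣ d only for Q = 1, and then gives
the identity term. -/
theorem hasSum_poincareSum [NeZero Q] (m : ℕ) {φ : ℝ → ℝ} {δ : ℝ} (hδ : 0 < δ)
    (hφ : ∀ t ≤ δ, φ t = 0) (z : ℍ) :
    HasSum (fun p : Σ c : Modulus M Q, (ZMod (c.1 : ℕ))ˣ × ℤ =>
      cellChar m p.1 p.2.1 * cutoffKernel m φ (Q * (p.1.1 : ℕ) ^ 2) z.im (z.re + cellShift p))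
      (poincareSum m φ M Q z - if Q = 1 then φ z.im * expTwoPiI (m * z) else 0) := by
  convert hasSum_cell (M := M) (Q := Q) m hδ hφ z using 1
  rw [sub_eq_iff_eq_add, poincareSum, tsum_subtype (cosetSet M Q)
    (fun σ : SL(2, ℤ) => Q * (stripFun m φ ∣[(2 : ℤ)] σ) (scalePoint Q z))]
  set F : SL(2, ℤ) → ℂ := fun σ => Q * (stripFun m φ ∣[(2 : ℤ)] σ) (scalePoint Q z) with hF
  have hfin : (Function.support F).Finite := by
    refine (finite_support_stripFun_slash m hδ hφ (scalePoint Q z)).subset fun σ hσ h => hσ ?_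
    simp only [hF, h, mul_zero]
  have hsum (S : Set SL(2, ℤ)) : Summable (S.indicator F) :=
    summable_of_hasFiniteSupport (hfin.subset (by
      rw [Set.support_indicator]; exact Set.inter_subset_right))
  have hneg (σ) : F (-σ) = F σ := by simp only [hF, stripFun_neg_slash]
  set S := cosetSet M Q with hS
  set P : Set SL(2, ℤ) := {σ ∈ S | 0 < σ 1 0} with hP
  set Z : Set SL(2, ℤ) := {σ ∈ S | σ 1 0 = 0 ∧ σ 1 1 = 1} with hZ
  have hdec : S.indicator F = fun σ => P.indicator F σ + {σ | -σ ∈ P}.indicator F σ +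
      (Z.indicator F σ + {σ | -σ ∈ Z}.indicator F σ) := by
    ext σ
    have hnegS : -σ ∈ S ↔ σ ∈ S := by
      simp [hS, cosetSet]
    have hn0 : (-σ) 1 0 = -σ 1 0 := rfl
    have hn1 : (-σ) 1 1 = -σ 1 1 := rfl
    have mP : σ ∈ P ↔ σ ∈ S ∧ 0 < σ 1 0 := Iff.rfl
    have mP' : σ ∈ {σ | -σ ∈ P} ↔ σ ∈ S ∧ σ 1 0 < 0 := by
      rw [← hnegS, ← neg_pos, ← hn0]; rfl
    have mZ : σ ∈ Z ↔ σ ∈ S ∧ σ 1 0 = 0 ∧ σ 1 1 = 1 := Iff.rfl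
    have mZ' : σ ∈ {σ | -σ ∈ Z} ↔ σ ∈ S ∧ σ 1 0 = 0 ∧ σ 1 1 = -1 := by
      rw [← hnegS, ← neg_eq_zero, ← hn0, ← neg_eq_iff_eq_neg, ← hn1]; rfl
    have hdet := σ.det_coe
    rw [Matrix.det_fin_two] at hdet
    classical
    rw [Set.indicator_apply, Set.indicator_apply, Set.indicator_apply, Set.indicator_apply,
      Set.indicator_apply]
    simp only [mP, mP', mZ, mZ']
    by_cases hσ : σ ∈ S
    · rcases lt_trichotomy (σ 1 0) 0 with h | h | h
      · simp [hσ, h, h.not_gt, h.ne]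
      · rw [h, mul_zero, sub_zero, mul_comm] at hdet
        rcases Int.isUnit_iff.1 (IsUnit.of_mul_eq_one _ hdet) with h1 | h1
        · simp [hσ, h, h1]
        · simp [hσ, h, h1]
      · simp [hσ, h, h.not_gt, h.ne']
    · simp [hσ]
  have hZsum : ∑' σ, Z.indicator F σ = if Q = 1 then φ z.im * expTwoPiI (m * z) else 0 := by
    split_ifs with hQ
    · subst hQ
      have hinj : Function.Injective fun j : ℤ => (ModularGroup.T ^ j : SL(2, ℤ)) := by
        intro j k hjk
        have := congrArg (fun σ : SL(2, ℤ) => σ 0 1) hjk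
        simp only [ModularGroup.coe_T_zpow] at this
        exact this
      have hrange : Set.range (fun j : ℤ => (ModularGroup.T ^ j : SL(2, ℤ))) = Z := by
        ext σ
        constructor
        · rintro ⟨j, rfl⟩
          have h10 : (ModularGroup.T ^ j : SL(2, ℤ)) 1 0 = 0 := by
            rw [ModularGroup.coe_T_zpow]; rfl
          have h11 : (ModularGroup.T ^ j : SL(2, ℤ)) 1 1 = 1 := by
            rw [ModularGroup.coe_T_zpow]; rfl
          refine ⟨⟨?_, ?_⟩, h10, h11⟩
          · simp only [h10, dvd_zero]
          · simp only [h11, Nat.cast_one, dvd_refl]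
        · rintro ⟨-, h0, h1⟩
          have hdet := σ.det_coe
          rw [Matrix.det_fin_two, h0, h1, mul_zero, sub_zero, mul_one] at hdet
          refine ⟨σ 0 1, Matrix.SpecialLinearGroup.ext _ _ fun i j => ?_⟩
          rw [ModularGroup.coe_T_zpow]
          fin_cases i <;> fin_cases j
          exacts [hdet.symm, rfl, h0.symm, h1.symm]
      have hz : scalePoint 1 z = z := UpperHalfPlane.ext (by simp)
      have h := hasSum_translations m φ z
      have e : (fun j : ℤ => (stripFun m φ ∣[(2 : ℤ)] (ModularGroup.T ^ j : SL(2, ℤ))) z) =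
          Z.indicator F ∘ fun j : ℤ => (ModularGroup.T ^ j : SL(2, ℤ)) := by
        ext j
        have hmem : (ModularGroup.T ^ j : SL(2, ℤ)) ∈ Z := by rw [← hrange]; exact ⟨j, rfl⟩
        rw [Function.comp_apply, Set.indicator_of_mem hmem]
        simp only [hF, hz, Nat.cast_one, one_mul]
      rw [e, hinj.hasSum_iff] at h
      · exact h.tsum_eq
      · intro σ hσ
        rw [hrange] at hσ
        exact Set.indicator_of_notMem hσ _
    · have : Z = ∅ := by
        refine Set.eq_empty_of_forall_notMem fun σ hσ => hQ ?_
        have h1 : (Q : ℤ) ∣ σ 1 1 := hσ.1.2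
        rw [hσ.2.2] at h1
        exact Nat.dvd_one.1 (by exact_mod_cast h1)
      simp [this]
  rw [hdec, ((hsum _).add (hsum _)).tsum_add ((hsum _).add (hsum _)), (hsum _).tsum_add (hsum _),
    (hsum _).tsum_add (hsum _), ← tsum_neg_eq hneg, ← tsum_neg_eq hneg, hZsum]
  ring

end PoincareSum

/-! ### Fourier coefficients of the truncated series -/

section Coefficients

variable {M Q : ℕ}

/-- The point `x + i y` of the upper half plane (for `y > 0`). -/
def linePoint (x y : ℝ) : ℍ := ofComplex (x + y * Complex.I)

theorem coe_linePoint {x y : ℝ} (hy : 0 < y) : (linePoint x y : ℂ) = x + y * Complex.I := by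
  rw [linePoint, ofComplex_apply_of_im_pos (by simpa using hy)]

theorem linePoint_re {x y : ℝ} (hy : 0 < y) : (linePoint x y).re = x := by
  rw [← coe_re, coe_linePoint hy]; simp

theorem linePoint_im {x y : ℝ} (hy : 0 < y) : (linePoint x y).im = y := by
  rw [← coe_im, coe_linePoint hy]; simp

theorem linePoint_re_im (z : ℍ) : linePoint z.re z.im = z :=
  UpperHalfPlane.ext (by rw [coe_linePoint z.im_pos]; exact Complex.re_add_im z)

theorem integrable_cutoffKernel (m : ℕ) {φ : ℝ → ℝ} (hφ : Measurable φ)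
    (hφ1 : ∀ t, |φ t| ≤ 1) {C y : ℝ} (hC : 0 < C) (hy : 0 < y) :
    Integrable (cutoffKernel m φ C y) :=
  integrable_cutoff_besselKernel m hφ hφ1 hC hy

theorem expTwoPiI_neg_mul_add_int (n : ℤ) (x : ℝ) (l : ℤ) :
    expTwoPiI (-(n * ((x + l : ℝ) : ℂ))) = expTwoPiI (-(n * x)) := by
  refine Eq.trans ?_ (expTwoPiI_add_intCast _ (-(n * l)))
  congr 1
  push_cast
  ring

theorem integral_cutoffKernel_shift (m : ℕ) (n : ℤ) (φ : ℝ → ℝ) (C y s : ℝ) :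
    ∫ x : ℝ, cutoffKernel m φ C y (x + s) * expTwoPiI (-(n * x)) =
      expTwoPiI (n * s) * besselIntegral m n φ C y := by
  rw [besselIntegral, ← integral_const_mul, ← integral_add_right_eq_self
    (fun x : ℝ => expTwoPiI (n * s) * (φ (y / (C * (x ^ 2 + y ^ 2))) *
      besselKernel m C (x + y * Complex.I) * expTwoPiI (-(n * x)))) s]
  congr 1
  ext x
  have : expTwoPiI (-(n * x)) = expTwoPiI (n * s) * expTwoPiI (-(n * ((x + s : ℝ) : ℂ))) := by
    rw [← expTwoPiI_add]
    congr 1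
    push_cast
    ring
  rw [this, cutoffKernel]
  ring

/-- Reparametrise by k = (Qr)⁻¹, so that r = k⁻¹Q⁻¹. -/
theorem sum_cellChar (m : ℕ) (n : ℤ) (c : Modulus M Q) :
    ∑ r : (ZMod (c.1 : ℕ))ˣ, cellChar m c r *
      expTwoPiI (n * ((((r : ZMod (c.1 : ℕ)).val : ℝ) / (c.1 : ℕ) : ℝ) : ℂ)) =
    kloostermanSum (c.1 : ℕ) m (n * (Q : ZMod (c.1 : ℕ))⁻¹) := by
  rw [kloostermanSum, ← (Equiv.inv _).trans (Equiv.mulRight c.unit⁻¹) |>.sum_comp]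
  refine Finset.sum_congr rfl fun r _ => ?_
  have h1 (r : (ZMod (c.1 : ℕ))ˣ) :
      expTwoPiI (n * ((((r : ZMod (c.1 : ℕ)).val : ℝ) / (c.1 : ℕ) : ℝ) : ℂ)) =
      ZMod.stdAddChar ((n : ZMod (c.1 : ℕ)) * (r : ZMod (c.1 : ℕ))) := by
    have h : (n : ZMod (c.1 : ℕ)) * (r : ZMod (c.1 : ℕ)) =
        ((n * ((r : ZMod (c.1 : ℕ)).val : ℤ) : ℤ) : ZMod (c.1 : ℕ)) := by simp
    rw [h, ZMod.stdAddChar_coe, expTwoPiI]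
    congr 1
    push_cast
    ring
  have hQ : (Q : ZMod (c.1 : ℕ))⁻¹ = ((c.unit⁻¹ : (ZMod (c.1 : ℕ))ˣ) : ZMod (c.1 : ℕ)) := by
    rw [← ZMod.inv_coe_unit]; rfl
  have h2 : (c.unit * (r⁻¹ * c.unit⁻¹))⁻¹ = r := by
    rw [mul_comm r⁻¹, mul_inv_cancel_left, inv_inv]
  have h3 : ((Equiv.inv _).trans (Equiv.mulRight c.unit⁻¹)) r = r⁻¹ * c.unit⁻¹ := rfl
  rw [h3, h1, cellChar, ← AddChar.map_add_eq_mul, hQ, h2]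
  congr 2
  rw [Units.val_mul]
  ring

/-- The image point has height y/(C|z|²) ≤ 1/(Cy). For large C this lies below the cutoff, so only
finitely many moduli occur at a given height y. -/
theorem cutoffKernel_eq_zero (m : ℕ) {φ : ℝ → ℝ} {δ : ℝ} (hδ : 0 < δ) (hφ : ∀ t ≤ δ, φ t = 0)
    {C y : ℝ} (hC : 0 < C) (hy : 0 < y) (h : 1 / (δ * y) ≤ C) (x : ℝ) :
    cutoffKernel m φ C y x = 0 := by
  rw [cutoffKernel, hφ]
  · simp
  · rw [div_le_iff₀ (by positivity)]
    rw [div_le_iff₀ (by positivity)] at h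
    have h2 : 0 ≤ δ * C * x ^ 2 := by positivity
    nlinarith

theorem finite_setOf_modulus_le (K : ℝ) : {c : Modulus M Q | ((c.1 : ℕ) : ℝ) ≤ K}.Finite := by
  have hinj : Function.Injective fun c : Modulus M Q => (c.1 : ℕ) :=
    PNat.coe_injective.comp Subtype.val_injective
  refine ((Set.finite_Iic ⌊K⌋₊).preimage hinj.injOn).subset fun c hc => ?_
  exact Nat.le_floor hc

/-- The sum over l unfolds the integral over [0, 1] to the real line and the sum over r produces the
Kloosterman sum. Since only finitely many c contribute, sum and integral may be exchanged. -/
theorem hasSum_coeff_poincareSum [NeZero Q] (m : ℕ) (n : ℤ) {φ : ℝ → ℝ} (hφm : Measurable φ)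
    (hφ1 : ∀ t, |φ t| ≤ 1) {δ : ℝ} (hδ : 0 < δ) (hφ : ∀ t ≤ δ, φ t = 0) {y : ℝ} (hy : 0 < y) :
    HasSum (fun c : Modulus M Q => kloostermanSum (c.1 : ℕ) m (n * (Q : ZMod (c.1 : ℕ))⁻¹) *
      besselIntegral m n φ (Q * (c.1 : ℕ) ^ 2) y)
      (∫ x in (0 : ℝ)..1, (poincareSum m φ M Q (linePoint x y) -
        if Q = 1 then φ y * expTwoPiI (m * (x + y * Complex.I)) else 0) *
          expTwoPiI (-(n * x))) := by
  have hC (c : Modulus M Q) : (0 : ℝ) < Q * (c.1 : ℕ) ^ 2 :=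
    mul_pos (Nat.cast_pos.2 (NeZero.pos Q)) (by have := c.1.pos; positivity)
  let f (c : Modulus M Q) (r : (ZMod (c.1 : ℕ))ˣ) (x : ℝ) : ℂ := cellChar m c r *
    cutoffKernel m φ (Q * (c.1 : ℕ) ^ 2) y
      (x + ((r : ZMod (c.1 : ℕ)).val : ℝ) / (c.1 : ℕ)) * expTwoPiI (-(n * x))
  have hfi (c r) : Integrable (f c r) := by
    refine Integrable.mul_bdd (c := 1) (((integrable_cutoffKernel m hφm hφ1 (hC c) hy).comp_add_right
      _).const_mul _) (by fun_prop) (Filter.Eventually.of_forall fun x => ?_)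
    rw [norm_expTwoPiI_neg_intCast_mul]
  let F (p : Σ c : Modulus M Q, (ZMod (c.1 : ℕ))ˣ × ℤ) (x : ℝ) : ℂ := f p.1 p.2.1 (x + p.2.2)
  have hFi (p) : Integrable (F p) := (hfi p.1 p.2.1).comp_add_right _
  have hnorm : Summable fun p => ∫ x in (0 : ℝ)..1, ‖F p x‖ := by
    have hnn (p) : 0 ≤ ∫ x in (0 : ℝ)..1, ‖F p x‖ :=
      intervalIntegral.integral_nonneg zero_le_one fun x _ => norm_nonneg _
    rw [summable_sigma_of_nonneg hnn]
    have hl (c r) : HasSum (fun l : ℤ => ∫ x in (0 : ℝ)..1, ‖F ⟨c, r, l⟩ x‖) (∫ x, ‖f c r x‖) :=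
      (hfi c r).norm.hasSum_intervalIntegral_comp_add_int
    refine ⟨fun c => ?_, ?_⟩
    · rw [summable_prod_of_nonneg fun p => hnn ⟨c, p⟩]
      exact ⟨fun r => (hl c r).summable, (hasSum_fintype _).summable⟩
    · refine summable_of_hasFiniteSupport ((finite_setOf_modulus_le (1 / (δ * y))).subset
        fun c hc => ?_)
      by_contra hlt
      refine hc ?_
      have hle : 1 / (δ * y) ≤ Q * (c.1 : ℕ) ^ 2 := by
        have h1 : (1 : ℝ) ≤ (c.1 : ℕ) := by exact_mod_cast c.1.pos
        have h2 : (1 : ℝ) ≤ Q := by exact_mod_cast NeZero.one_le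
        have h3 : 1 / (δ * y) < (c.1 : ℕ) := not_le.1 hlt
        nlinarith
      have : ∀ p x, F ⟨c, p⟩ x = 0 := fun p x => by
        simp only [F, f, cutoffKernel_eq_zero m hδ hφ (hC c) hy hle, mul_zero, zero_mul]
      simp [this]
  have hpt (x : ℝ) : HasSum (fun p => F p x) ((poincareSum m φ M Q (linePoint x y) -
        if Q = 1 then φ y * expTwoPiI (m * (x + y * Complex.I)) else 0) *
          expTwoPiI (-(n * x))) := by
    have h := (hasSum_poincareSum (M := M) (Q := Q) m hδ hφ (linePoint x y)).mul_right
      (expTwoPiI (-(n * x)))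
    rw [linePoint_im hy, linePoint_re hy, coe_linePoint hy] at h
    have e : (fun p => F p x) = fun p : Σ c : Modulus M Q, (ZMod (c.1 : ℕ))ˣ × ℤ =>
        cellChar m p.1 p.2.1 * cutoffKernel m φ (Q * (p.1.1 : ℕ) ^ 2) y (x + cellShift p) *
          expTwoPiI (-(n * x)) := by
      ext p
      simp only [F, f]
      rw [expTwoPiI_neg_mul_add_int, cellShift, add_right_comm, add_assoc x]
    rw [e]
    exact h
  have h1 := hasSum_integral_of_summable_integral_norm (μ := volume.restrict (Set.Ioc (0 : ℝ) 1))
    (F := F) (fun p => (hFi p).restrict)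
    (by simpa only [intervalIntegral.integral_of_le zero_le_one] using hnorm)
  rw [intervalIntegral.integral_of_le zero_le_one]
  have h2 := h1.sigma (g := fun c : Modulus M Q =>
    kloostermanSum (c.1 : ℕ) m (n * (Q : ZMod (c.1 : ℕ))⁻¹) *
      besselIntegral m n φ (Q * (c.1 : ℕ) ^ 2) y) fun c => ?_
  · simpa only [(hpt _).tsum_eq] using h2
  · have hs : Summable fun p : (ZMod (c.1 : ℕ))ˣ × ℤ =>
        ∫ x in Set.Ioc (0 : ℝ) 1, F ⟨c, p⟩ x := h1.summable.comp_injective sigma_mk_injective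
    have h3 := hs.hasSum.prod_fiberwise (g := fun r => ∫ x, f c r x) fun r => by
      simpa only [intervalIntegral.integral_of_le zero_le_one] using
        (hfi c r).hasSum_intervalIntegral_comp_add_int
    rw [← sum_cellChar, Finset.sum_mul]
    have h4 : ∑' p, ∫ x in Set.Ioc (0 : ℝ) 1, F ⟨c, p⟩ x = ∑ r, ∫ x, f c r x :=
      h3.unique (hasSum_fintype _)
    have h5 : ∑ r, ∫ x, f c r x = ∑ r : (ZMod (c.1 : ℕ))ˣ, cellChar m c r *
        expTwoPiI (n * ((((r : ZMod (c.1 : ℕ)).val : ℝ) / (c.1 : ℕ) : ℝ) : ℂ)) *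
        besselIntegral m n φ (Q * (c.1 : ℕ) ^ 2) y := by
      refine Finset.sum_congr rfl fun r _ => ?_
      simp only [f, mul_assoc (cellChar m c r)]
      rw [integral_const_mul, integral_cutoffKernel_shift]
    rw [← h5, ← h4]
    exact hs.hasSum

end Coefficients

/-! ### Modularity, measurability and boundedness of the truncated series -/

section SlashSums

instance countable_SL : Countable SL(2, ℤ) :=
  have : Countable (Matrix (Fin 2) (Fin 2) ℤ) := inferInstanceAs (Countable (Fin 2 → Fin 2 → ℤ))
  inferInstanceAs (Countable {A : Matrix (Fin 2) (Fin 2) ℤ // A.det = 1})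

theorem continuous_SL_smul (σ : SL(2, ℤ)) : Continuous fun z : ℍ => σ • z :=
  continuous_const_smul (Matrix.SpecialLinearGroup.mapGL ℝ σ)

theorem measurable_tsum_of_summable {α ι : Type*} [MeasurableSpace α] [Countable ι]
    {f : ι → α → ℂ} (hf : ∀ i, Measurable (f i)) (hs : ∀ a, Summable fun i => f i a) :
    Measurable fun a => ∑' i, f i a := by
  refine measurable_of_tendsto_metrizable' (f := fun (s : Finset ι) a => ∑ i ∈ s, f i a)
    Filter.atTop (fun s => Finset.measurable_fun_sum s fun i _ => hf i) ?_
  exact tendsto_pi_nhds.2 fun a => (hs a).hasSum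

theorem measurable_stripFun (m : ℕ) {φ : ℝ → ℝ} (hφ : Measurable φ) :
    Measurable (stripFun m φ) := by
  unfold stripFun
  have hre : Measurable fun z : ℍ => z.re := continuous_re.measurable
  have him : Measurable fun z : ℍ => z.im := continuous_im.measurable
  refine Measurable.ite ((measurableSet_le measurable_const hre).inter
    (measurableSet_lt hre measurable_const)) ?_ measurable_const
  refine (Complex.measurable_ofReal.comp (hφ.comp him)).mul (measurable_expTwoPiI.comp ?_)
  exact measurable_const.mul measurable_coe

theorem measurable_stripFun_slash (m : ℕ) {φ : ℝ → ℝ} (hφ : Measurable φ) (σ : SL(2, ℤ)) :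
    Measurable (stripFun m φ ∣[(2 : ℤ)] σ) := by
  have e : (stripFun m φ ∣[(2 : ℤ)] σ) = fun w : ℍ => stripFun m φ (σ • w) *
      (((σ 1 0 : ℂ) * w + (σ 1 1 : ℂ)) ^ 2)⁻¹ := funext (stripFun_slash_apply m φ σ)
  rw [e]
  exact ((measurable_stripFun m hφ).comp (continuous_SL_smul σ).measurable).mul
    (((measurable_coe.const_mul _).add_const _).pow_const 2).inv

/-- Half the sum of `stripFun m φ ∣[2] σ` over `σ ∈ S`. -/
def slashSum (m : ℕ) (φ : ℝ → ℝ) (S : Set SL(2, ℤ)) (w : ℍ) : ℂ :=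
  2⁻¹ * ∑' σ : S, (stripFun m φ ∣[(2 : ℤ)] (σ : SL(2, ℤ))) w

theorem poincareSum_eq (m : ℕ) (φ : ℝ → ℝ) (M Q : ℕ) [NeZero Q] (z : ℍ) :
    poincareSum m φ M Q z = Q * slashSum m φ (cosetSet M Q) (scalePoint Q z) := by
  rw [poincareSum, slashSum, tsum_mul_left]
  ring

theorem summable_slash (m : ℕ) {φ : ℝ → ℝ} {δ : ℝ} (hδ : 0 < δ) (hφ : ∀ t ≤ δ, φ t = 0)
    (S : Set SL(2, ℤ)) (w : ℍ) :
    Summable fun σ : S => (stripFun m φ ∣[(2 : ℤ)] (σ : SL(2, ℤ))) w :=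
  summable_of_hasFiniteSupport
    ((finite_support_stripFun_slash m hδ hφ w).preimage Subtype.val_injective.injOn)

theorem measurable_slashSum (m : ℕ) {φ : ℝ → ℝ} (hφm : Measurable φ) {δ : ℝ} (hδ : 0 < δ)
    (hφ : ∀ t ≤ δ, φ t = 0) (S : Set SL(2, ℤ)) : Measurable (slashSum m φ S) :=
  (measurable_tsum_of_summable (fun σ : S => measurable_stripFun_slash m hφm (σ : SL(2, ℤ)))
    (summable_slash m hδ hφ S)).const_mul _

/-- Right multiplication by g reindexes the sum. With S = S' = Γ₀(N) this is modularity; with g = V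
it describes the Atkin–Lehner image. -/
theorem slashSum_slash (m : ℕ) (φ : ℝ → ℝ) {S S' : Set SL(2, ℤ)} (g : SL(2, ℤ))
    (h : ∀ σ, σ * g ∈ S' ↔ σ ∈ S) :
    slashSum m φ S ∣[(2 : ℤ)] g = slashSum m φ S' := by
  ext w
  rw [ModularForm.SL_slash_apply, slashSum, slashSum, mul_assoc, ← tsum_mul_right]
  congr 1
  let e : S ≃ S' := (Equiv.mulRight g).subtypeEquiv fun σ => (h σ).symm
  rw [← e.tsum_eq]
  refine tsum_congr fun σ => ?_
  change _ = (stripFun m φ ∣[(2 : ℤ)] ((σ : SL(2, ℤ)) * g)) w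
  rw [SlashAction.slash_mul, ModularForm.SL_slash_apply (stripFun m φ ∣[(2 : ℤ)] (σ : SL(2, ℤ)))]

theorem mem_Gamma0_iff {N : ℕ} {σ : SL(2, ℤ)} : σ ∈ Gamma0 N ↔ (N : ℤ) ∣ σ 1 0 := by
  rw [Gamma0_mem]
  exact ZMod.intCast_zmod_eq_zero_iff_dvd _ _

theorem cosetSet_one (N : ℕ) : cosetSet N 1 = (Gamma0 N : Set SL(2, ℤ)) := by
  ext σ
  rw [SetLike.mem_coe, mem_Gamma0_iff]
  simp [cosetSet]

theorem slashSum_Gamma0_slash (m : ℕ) (φ : ℝ → ℝ) {N : ℕ} {γ : SL(2, ℤ)} (hγ : γ ∈ Gamma0 N) :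
    slashSum m φ (Gamma0 N : Set SL(2, ℤ)) ∣[(2 : ℤ)] γ = slashSum m φ (Gamma0 N) :=
  slashSum_slash m φ γ fun _ => (Gamma0 N).mul_mem_cancel_right hγ

theorem norm_stripFun_mul_im_le {m : ℕ} (hm : 0 < m) {φ : ℝ → ℝ} (hφ1 : ∀ t, |φ t| ≤ 1) (z : ℍ) :
    ‖stripFun m φ z‖ * z.im ≤ 1 := by
  unfold stripFun
  split_ifs
  · rw [norm_mul, norm_expTwoPiI, Complex.norm_real, Real.norm_eq_abs]
    have h1 : ((m : ℂ) * z).im = m * z.im := by simp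
    rw [h1]
    have hm' : (1 : ℝ) ≤ m := by exact_mod_cast hm
    have hz := z.im_pos
    have h2 : z.im ≤ Real.exp (2 * π * (m * z.im)) := by
      refine le_trans ?_ (Real.add_one_le_exp _)
      have : 1 ≤ 2 * π * m := by nlinarith [Real.two_le_pi]
      nlinarith
    rw [Real.exp_neg]
    calc |φ z.im| * (Real.exp (2 * π * (m * z.im)))⁻¹ * z.im
        ≤ 1 * (Real.exp (2 * π * (m * z.im)))⁻¹ * Real.exp (2 * π * (m * z.im)) := by
          gcongr
          exact hφ1 _
      _ = 1 := by
          rw [one_mul, inv_mul_cancel₀ (Real.exp_ne_zero _)]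
  · simp

/-- In weight 2 the quantity |f| · Im transforms without a factor. -/
theorem norm_stripFun_slash_mul_im_le {m : ℕ} (hm : 0 < m) {φ : ℝ → ℝ} (hφ1 : ∀ t, |φ t| ≤ 1)
    (σ : SL(2, ℤ)) (w : ℍ) : ‖(stripFun m φ ∣[(2 : ℤ)] σ) w‖ * w.im ≤ 1 := by
  refine le_trans (le_of_eq ?_) (norm_stripFun_mul_im_le hm hφ1 (σ • w))
  rw [ModularGroup.im_smul_eq_div_normSq, ModularGroup.denom_apply, stripFun_slash_apply, norm_mul,
    norm_inv, norm_pow, ← Complex.normSq_eq_norm_sq]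
  ring

/-- The number of `σ ∈ SL(2, ℤ)` moving a point into a vertical half strip is bounded. -/
theorem exists_encard_smul_mem_strip_le {δ : ℝ} (hδ : 0 < δ) :
    ∃ C : ℕ, ∀ w : ℍ,
      {σ : SL(2, ℤ) | 0 ≤ (σ • w).re ∧ (σ • w).re < 1 ∧ δ ≤ (σ • w).im}.encard ≤ C := by
  obtain ⟨C, hC⟩ := exists_encard_smul_mem_le (isCompact_rectangle 1 (1 / δ) hδ)
  refine ⟨max C 2, fun w => ?_⟩
  -- If all images have height at most 1/δ, they lie in a compact rectangle. If σ₀w is higher, any τ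
  -- keeping it in the strip above height δ has lower left entry 0, since otherwise the height drops
  -- below δ; the half-open unit width then leaves only τ = ±1.
  by_cases hne : ∃ σ₀ : SL(2, ℤ), 0 ≤ (σ₀ • w).re ∧ (σ₀ • w).re < 1 ∧ 1 / δ < (σ₀ • w).im
  · obtain ⟨σ₀, h₀, h₀', h₁⟩ := hne
    have key (σ : SL(2, ℤ)) (hσ : 0 ≤ (σ • w).re ∧ (σ • w).re < 1 ∧ δ ≤ (σ • w).im) :
        σ = σ₀ ∨ σ = -σ₀ := by
      set w₀ := σ₀ • w with hw₀
      set τ := σ * σ₀⁻¹ with hτ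
      have hτw : τ • w₀ = σ • w := by rw [hτ, hw₀, ← mul_smul, inv_mul_cancel_right]
      rw [← hτw] at hσ
      have hστ : σ = τ * σ₀ := by rw [hτ, inv_mul_cancel_right]
      have h10 : τ 1 0 = 0 := by
        by_contra h
        have h2 := im_SL_smul_le_of_ne_zero τ w₀ h
        have h3 : 1 / w₀.im < δ := by
          rw [div_lt_comm₀ w₀.im_pos hδ]; exact h₁
        linarith [hσ.2.2]
      have hdet := τ.det_coe
      rw [Matrix.det_fin_two, h10, mul_zero, sub_zero] at hdet
      have hcoe := coe_specialLinearGroup_apply τ w₀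
      have e (k : ℤ) : ((algebraMap ℤ ℝ k : ℝ) : ℂ) = k := by simp
      simp only [e, h10] at hcoe
      have h01 (b : ℤ) (hb : ((τ • w₀ : ℍ) : ℂ) = w₀ + b) : b = 0 := by
        have h4 := congrArg Complex.re hb
        simp only [coe_re, Complex.add_re, Complex.intCast_re] at h4
        have h5 : (b : ℝ) < 1 := by linarith [hσ.2.1]
        have h6 : (-1 : ℝ) < b := by linarith [hσ.1]
        have h7 : b < 1 := by exact_mod_cast h5
        have h8 : -1 < b := by exact_mod_cast h6
        omega
      rcases Int.mul_eq_one_iff_eq_one_or_neg_one.1 hdet with ⟨ha, hd⟩ | ⟨ha, hd⟩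
      · left
        have hb := h01 (τ 0 1) (by rw [hcoe, ha, hd]; push_cast; ring)
        have : τ = 1 := Matrix.SpecialLinearGroup.ext _ _ fun i j => by
          fin_cases i <;> fin_cases j
          exacts [ha, hb, h10, hd]
        rw [hστ, this, one_mul]
      · right
        have hb := h01 (-τ 0 1) (by rw [hcoe, ha, hd]; push_cast; ring)
        have : τ = -1 := Matrix.SpecialLinearGroup.ext _ _ fun i j => by
          fin_cases i <;> fin_cases j
          exacts [ha, neg_eq_zero.1 hb, h10, hd]
        rw [hστ, this, neg_mul, one_mul]
    refine (Set.encard_le_encard (t := {σ₀, -σ₀}) fun σ hσ => key σ hσ).trans ?_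
    refine (Set.encard_insert_le _ _).trans ?_
    rw [Set.encard_singleton, one_add_one_eq_two]
    exact_mod_cast le_max_right C 2
  · push Not at hne
    refine (Set.encard_le_encard fun σ hσ => ?_).trans ((hC w).trans (by simp))
    exact ⟨abs_le.2 ⟨by linarith [hσ.1], hσ.2.1.le⟩, hσ.2.2, hne σ hσ.1 hσ.2.1⟩

/-- Boundedly many terms are nonzero at each point, and each satisfies |·| Im ≤ 1. The constant may
depend on the cutoff: it only serves to make each truncation integrable. -/
theorem exists_norm_slashSum_mul_im_le {m : ℕ} (hm : 0 < m) {φ : ℝ → ℝ} (hφ1 : ∀ t, |φ t| ≤ 1)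
    {δ : ℝ} (hδ : 0 < δ) (hφ : ∀ t ≤ δ, φ t = 0) :
    ∃ C : ℝ, ∀ S w, ‖slashSum m φ S w‖ * w.im ≤ C := by
  obtain ⟨C, hC⟩ := exists_encard_smul_mem_strip_le hδ
  refine ⟨C, fun S w => ?_⟩
  have hfin := finite_support_stripFun_slash m hδ hφ w
  have hcard : hfin.toFinset.card ≤ C := by
    have h := hC w
    rw [← Nat.cast_le (α := ℕ∞), ← Set.encard_coe_eq_coe_finsetCard, hfin.coe_toFinset]
    refine (Set.encard_le_encard fun σ hσ => ?_).trans h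
    have h2 : stripFun m φ (σ • w) ≠ 0 := fun h0 => hσ (by
      simp only [stripFun_slash_apply, h0, zero_mul])
    unfold stripFun at h2
    split_ifs at h2 with h3
    · refine ⟨h3.1, h3.2, ?_⟩
      by_contra hlt
      exact h2 (by rw [hφ _ (not_le.1 hlt).le]; simp)
    · exact absurd rfl h2
  rw [slashSum, tsum_subtype S (fun σ => (stripFun m φ ∣[(2 : ℤ)] σ) w),
    tsum_eq_sum (s := hfin.toFinset) fun σ hσ => by
      have : (stripFun m φ ∣[(2 : ℤ)] σ) w = 0 := by simpa using hσ
      simp [Set.indicator, this]]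
  rw [norm_mul, mul_assoc]
  have h4 : ‖∑ σ ∈ hfin.toFinset, S.indicator (fun σ => (stripFun m φ ∣[(2 : ℤ)] σ) w) σ‖ * w.im ≤
      C := by
    calc _ ≤ (∑ σ ∈ hfin.toFinset, ‖S.indicator (fun σ => (stripFun m φ ∣[(2 : ℤ)] σ) w) σ‖) *
          w.im := by exact mul_le_mul_of_nonneg_right (norm_sum_le _ _) w.im_pos.le
      _ ≤ ∑ σ ∈ hfin.toFinset, (1 : ℝ) := by
          rw [Finset.sum_mul]
          refine Finset.sum_le_sum fun σ _ => ?_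
          refine le_trans ?_ (norm_stripFun_slash_mul_im_le hm hφ1 σ w)
          have := w.im_pos
          gcongr
          exact norm_indicator_le_norm_self _ _
      _ ≤ C := by simpa using hcard
  have h5 : ‖(2⁻¹ : ℂ)‖ ≤ 1 := by norm_num
  calc _ ≤ 1 * _ := mul_le_mul_of_nonneg_right h5 (mul_nonneg (norm_nonneg _) w.im_pos.le)
    _ ≤ _ := by rw [one_mul]; exact h4

end SlashSums

/-! ### Atkin–Lehner matrices -/

section AtkinLehner

/-- The matrix `V` with `V diag(Q, 1) = W_Q`. -/
theorem IsAtkinLehnerMatrix.exists_SL {N Q : ℕ} (hQN : Q ∣ N) (hQ : 0 < Q)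
    {W : GL (Fin 2) ℝ} (hW : IsAtkinLehnerMatrix N Q W) : ∃ (V : SL(2, ℤ)) (t : ℤ),
      V 0 0 = 1 ∧ V 1 0 = (N / Q : ℕ) ∧ V 1 1 = Q * t ∧
      W.val = !![(Q : ℝ), (V 0 1 : ℝ); ((Q * (N / Q : ℕ) : ℕ) : ℝ), (V 1 1 : ℝ)] := by
  obtain ⟨y, t, h1, h2⟩ := hW
  have hN : Q * (N / Q) = N := Nat.mul_div_cancel' hQN
  rw [h1, Matrix.det_fin_two_of] at h2
  have h5 : (1 : ℤ) * (Q * t) - y * (N / Q : ℕ) = 1 := by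
    generalize N / Q = M at hN
    have h3 : (Q : ℝ) * (Q * t - y * M) = Q * 1 := by
      rw [← hN] at h2
      push_cast at h2
      linarith
    have h4 := mul_left_cancel₀ (by positivity) h3
    rw [one_mul]
    exact_mod_cast h4
  refine ⟨⟨!![1, y; (N / Q : ℕ), Q * t], by rw [Matrix.det_fin_two_of]; exact h5⟩, t,
    rfl, rfl, rfl, ?_⟩
  rw [h1, hN]
  simp

variable {N Q : ℕ} {W : GL (Fin 2) ℝ} {V : SL(2, ℤ)}

/-- The decomposition `W = V diag(Q, 1)` of a real matrix, with `V ∈ SL(2, ℤ)`. -/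
def IsScaleProduct (Q : ℕ) (W : GL (Fin 2) ℝ) (V : SL(2, ℤ)) : Prop :=
  W.val = !![(Q : ℝ) * (V 0 0 : ℝ), (V 0 1 : ℝ); (Q : ℝ) * (V 1 0 : ℝ), (V 1 1 : ℝ)]

theorem IsScaleProduct.det (h : IsScaleProduct Q W V) : W.det.val = Q := by
  rw [Matrix.GeneralLinearGroup.val_det_apply, h, Matrix.det_fin_two_of]
  have := V.det_coe
  rw [Matrix.det_fin_two] at this
  have h2 : (V 0 0 : ℝ) * V 1 1 - V 0 1 * V 1 0 = 1 := by exact_mod_cast this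
  linear_combination (Q : ℝ) * h2

variable [NeZero Q]

theorem IsScaleProduct.det_pos (h : IsScaleProduct Q W V) : 0 < W.det.val := by
  rw [h.det]; exact Nat.cast_pos.2 (NeZero.pos Q)

theorem IsScaleProduct.smul (h : IsScaleProduct Q W V) (z : ℍ) :
    W • z = V • scalePoint Q z := by
  apply UpperHalfPlane.ext
  rw [coe_smul_of_det_pos h.det_pos, coe_specialLinearGroup_apply, num, denom, h]
  simp
  ring_nf

theorem IsScaleProduct.slash_apply (h : IsScaleProduct Q W V) (f : ℍ → ℂ) (z : ℍ) :
    (f ∣[(2 : ℤ)] W) z = Q * (f ∣[(2 : ℤ)] V) (scalePoint Q z) := by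
  rw [ModularForm.slash_apply, ModularForm.SL_slash_apply, h.smul, h.det, σ, if_pos h.det_pos]
  have : denom W z = denom V (scalePoint Q z) := by
    rw [ModularGroup.denom_apply, denom, h]
    simp
    ring
  rw [this]
  simp
  ring

/-- With V = (1, y; N/Q, Qt), the lower row of σV is (c + dN/Q, cy + dQt). If N ∣ c the two
divisibilities are clear; conversely, multiplying by V⁻¹ expresses c as a combination of the new
entries that is divisible by N. -/
theorem IsAtkinLehnerMatrix.exists_isScaleProduct (hQN : Q ∣ N)
    (hW : IsAtkinLehnerMatrix N Q W) : ∃ V : SL(2, ℤ), IsScaleProduct Q W V ∧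
      ∀ σ : SL(2, ℤ), σ * V ∈ cosetSet (N / Q) Q ↔ σ ∈ Gamma0 N := by
  obtain ⟨V, t, h00, h10, h11, hv⟩ := hW.exists_SL hQN (NeZero.pos Q)
  have hN : ((Q * (N / Q : ℕ) : ℕ) : ℤ) = N := by rw [Nat.mul_div_cancel' hQN]
  refine ⟨V, ?_, fun σ => ?_⟩
  · rw [IsScaleProduct, hv, h00, h10, Int.cast_natCast, Int.cast_one, mul_one, Nat.cast_mul]
  · have hdet := V.det_coe
    rw [Matrix.det_fin_two, h00, h10, h11, one_mul] at hdet
    have e0 : (σ * V) 1 0 = σ 1 0 + σ 1 1 * (N / Q : ℕ) := by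
      rw [Matrix.SpecialLinearGroup.coe_mul, Matrix.mul_apply, Fin.sum_univ_two, h00, h10, mul_one]
    have e1 : (σ * V) 1 1 = σ 1 0 * V 0 1 + σ 1 1 * (Q * t) := by
      rw [Matrix.SpecialLinearGroup.coe_mul, Matrix.mul_apply, Fin.sum_univ_two, h11]
    have e3 : σ 1 0 = (σ * V) 1 0 * (Q * t) - (σ * V) 1 1 * (N / Q : ℕ) := by
      rw [e0, e1]
      linear_combination (-σ 1 0) * hdet
    rw [mem_Gamma0_iff, ← hN]
    constructor
    · rintro ⟨⟨a, ha⟩, ⟨b, hb⟩⟩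
      rw [e3, ha, hb]
      refine ⟨a * t - b, ?_⟩
      push_cast
      ring
    · rintro ⟨a, ha⟩
      refine ⟨?_, ?_⟩
      · rw [e0, ha]
        refine ⟨Q * a + σ 1 1, ?_⟩
        push_cast
        ring
      · rw [e1, ha]
        refine ⟨(N / Q : ℕ) * a * V 0 1 + σ 1 1 * t, ?_⟩
        push_cast
        ring

theorem slashSum_slash_atkinLehner {V : SL(2, ℤ)} (h : IsScaleProduct Q W V)
    (hV : ∀ σ : SL(2, ℤ), σ * V ∈ cosetSet (N / Q) Q ↔ σ ∈ Gamma0 N) (m : ℕ) (φ : ℝ → ℝ) :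
    slashSum m φ (Gamma0 N) ∣[(2 : ℤ)] W = poincareSum m φ (N / Q) Q := by
  ext z
  rw [h.slash_apply, slashSum_slash m φ V hV, poincareSum_eq]

/-- The square of an Atkin-Lehner matrix is `Q` times a matrix in `Γ₀(N)`. -/
theorem IsAtkinLehnerMatrix.exists_sq (hQN : Q ∣ N) (hW : IsAtkinLehnerMatrix N Q W) :
    ∃ γ ∈ Gamma0 N, ∀ f : ℍ → ℂ, (f ∣[(2 : ℤ)] W) ∣[(2 : ℤ)] W = f ∣[(2 : ℤ)] γ := by
  obtain ⟨V, t, h00, h10, h11, hv⟩ := hW.exists_SL hQN (NeZero.pos Q)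
  have hN : Q * (N / Q : ℕ) = N := Nat.mul_div_cancel' hQN
  generalize N / Q = M at *
  have hdet := V.det_coe
  rw [Matrix.det_fin_two, h00, h10, h11, one_mul] at hdet
  set y := V 0 1 with hy
  -- This matrix is W²/Q, where W = (Q, y; QM, Qt) and N = QM; its determinant is (Qt - yM)² = 1.
  -- Scalar matrices act trivially in weight 2.
  have hd : (!![Q + y * M, y * (1 + t); N * (1 + t), M * y + Q * t * t] :
      Matrix (Fin 2) (Fin 2) ℤ).det = 1 := by
    rw [Matrix.det_fin_two_of, ← hN]
    push_cast
    linear_combination (Q * t - y * M + 1) * hdet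
  let γ : SL(2, ℤ) := ⟨!![Q + y * M, y * (1 + t); N * (1 + t), M * y + Q * t * t], hd⟩
  have hγ : γ ∈ Gamma0 N := mem_Gamma0_iff.2 (dvd_mul_right _ _)
  have hQ : (Q : ℝ) ≠ 0 := by exact_mod_cast NeZero.ne Q
  have hval : (W * W).val = (Q : ℝ) • (γ : GL (Fin 2) ℝ).val := by
    have hcoe : (γ : GL (Fin 2) ℝ).val = !![(Q + y * M : ℝ), y * (1 + t); N * (1 + t),
        M * y + Q * t * t] := by
      have e (i j) : (γ : GL (Fin 2) ℝ).val i j = ((γ i j : ℤ) : ℝ) := rfl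
      have g00 : γ 0 0 = Q + y * M := rfl
      have g01 : γ 0 1 = y * (1 + t) := rfl
      have g10 : γ 1 0 = N * (1 + t) := rfl
      have g11 : γ 1 1 = M * y + Q * t * t := rfl
      ext i j
      rw [e]
      fin_cases i <;> fin_cases j
      · exact (congrArg Int.cast g00).trans (by simp)
      · exact (congrArg Int.cast g01).trans (by simp)
      · exact (congrArg Int.cast g10).trans (by simp)
      · exact (congrArg Int.cast g11).trans (by simp)
    rw [Units.val_mul, hv, h11, hcoe, ← hN]
    ext i j
    fin_cases i <;> fin_cases j <;> simp [Matrix.mul_apply, Fin.sum_univ_two] <;> ring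
  have hdetW : (W * W).det.val = (Q : ℝ) ^ 2 := by
    have hg : (γ : GL (Fin 2) ℝ).val.det = 1 :=
      ((Matrix.SpecialLinearGroup.map (Int.castRingHom ℝ)) γ).det_coe
    rw [Matrix.GeneralLinearGroup.val_det_apply, hval, Matrix.det_smul, hg]
    simp
  have hpos : 0 < (W * W).det.val := by rw [hdetW]; positivity
  refine ⟨γ, hγ, fun f => ?_⟩
  rw [← SlashAction.slash_mul]
  ext z
  have hden : denom (W * W) z = Q * denom γ z := by
    simp only [denom, hval]
    simp
    ring
  have hsmul : (W * W) • z = γ • z := by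
    apply UpperHalfPlane.ext
    have hnum : num (W * W) z = Q * num (γ : GL (Fin 2) ℝ) z := by
      simp only [num, hval]
      simp
      ring
    have hdetγ : 0 < (γ : GL (Fin 2) ℝ).det.val := by simp
    have e : γ • z = (γ : GL (Fin 2) ℝ) • z := rfl
    rw [e, coe_smul_of_det_pos hpos, coe_smul_of_det_pos hdetγ, hden, hnum,
      mul_div_mul_left _ _ (by exact_mod_cast hQ)]
  rw [ModularForm.slash_apply, ModularForm.SL_slash_apply, hsmul, hden, hdetW, σ, if_pos hpos]
  have hQ' : (Q : ℂ) ≠ 0 := by exact_mod_cast NeZero.ne Q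
  simp only [abs_of_nonneg (sq_nonneg (Q : ℝ)), mul_zpow]
  simp
  field_simp

end AtkinLehner

/-! ### Unfolding over a fundamental domain -/

section Unfolding

/-- It suffices to look at 2i, which is interior to the standard fundamental domain. -/
theorem eq_one_or_neg_one_of_smul_eq {γ : SL(2, ℤ)} (h : ∀ z : ℍ, γ • z = z) : γ = 1 ∨ γ = -1 := by
  let z : ℍ := ⟨2 * Complex.I, by simp⟩
  have hz : z ∈ ModularGroup.fdo := by
    have h1 : (z : ℂ) = 2 * Complex.I := rfl
    have h2 : z.re = 0 := by rw [← coe_re, h1]; simp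
    refine ⟨?_, ?_⟩
    · rw [h1]; simp [Complex.normSq_apply]; norm_num
    · rw [h2]; norm_num
  exact ModularGroup.eq_one_or_neg_one_of_mem_fdo_mem_fdo hz (by rw [h z]; exact hz)

/-- The group of transformations of `ℍ` induced by `Γ₀(N)`. -/
abbrev Gamma0Trans (N : ℕ) : Subgroup (Equiv.Perm ℍ) := (MulAction.toPermHom (Gamma0 N) ℍ).range

instance countable_Gamma0Trans (N : ℕ) : Countable (Gamma0Trans N) :=
  (MonoidHom.rangeRestrict_surjective (MulAction.toPermHom (Gamma0 N) ℍ)).countable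

theorem exists_smul_eq_of_trans {N : ℕ} (g : Gamma0Trans N) :
    ∃ γ : Gamma0 N, ∀ z : ℍ, g • z = (γ : SL(2, ℤ)) • z := by
  obtain ⟨-, γ, rfl⟩ := g
  exact ⟨γ, fun z => rfl⟩

instance measurableConstSMul_Gamma0Trans (N : ℕ) : MeasurableConstSMul (Gamma0Trans N) ℍ := by
  constructor
  intro g
  obtain ⟨γ, hγ⟩ := (exists_smul_eq_of_trans g)
  rw [funext hγ]
  exact (continuous_SL_smul _).measurable

theorem measurePreserving_SL_smul (σ : SL(2, ℤ)) :
    MeasurePreserving (fun z : ℍ => σ • z) volume volume :=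
  measurePreserving_smul (Matrix.SpecialLinearGroup.mapGL ℝ σ) (volume : Measure ℍ)

instance smulInvariantMeasure_Gamma0Trans (N : ℕ) :
    SMulInvariantMeasure (Gamma0Trans N) ℍ volume := by
  constructor
  intro g s hs
  obtain ⟨γ, hγ⟩ := (exists_smul_eq_of_trans g)
  rw [funext hγ]
  exact (measurePreserving_SL_smul _).measure_preimage hs.nullMeasurableSet

/-- A section of the map from `Γ₀(N)` to the group of its transformations. -/
def transLift {N : ℕ} (g : Gamma0Trans N) : Gamma0 N := (exists_smul_eq_of_trans g).choose

theorem transLift_smul {N : ℕ} (g : Gamma0Trans N) (z : ℍ) :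
    (transLift g : SL(2, ℤ)) • z = g • z := ((exists_smul_eq_of_trans g).choose_spec z).symm

theorem Gamma0.neg_mem {N : ℕ} {γ : SL(2, ℤ)} (h : γ ∈ Gamma0 N) : -γ ∈ Gamma0 N := by
  rw [mem_Gamma0_iff] at h ⊢
  have : (-γ) 1 0 = -γ 1 0 := rfl
  rw [this]
  exact h.neg_right

/-- `Γ₀(N)` consists of two copies of the group of its transformations. -/
def transSumEquiv (N : ℕ) : Gamma0Trans N ⊕ Gamma0Trans N ≃ Gamma0 N :=
  Equiv.ofBijective
    (Sum.elim transLift fun g => ⟨-(transLift g : SL(2, ℤ)), Gamma0.neg_mem (transLift g).2⟩) (by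
    have hne (g g' : Gamma0Trans N) (h : ∀ z : ℍ, (transLift g : SL(2, ℤ)) • z =
        (transLift g' : SL(2, ℤ)) • z) : g = g' := by
      apply Subtype.ext
      apply Equiv.ext
      intro z
      have := h z
      rwa [transLift_smul g, transLift_smul g'] at this
    have hpm (γ : SL(2, ℤ)) : γ ≠ -γ := by
      intro h
      have h' (i j) : γ i j = 0 := by
        have h1 : γ i j = (-γ) i j := by rw [← h]
        have h2 : (-γ) i j = -γ i j := rfl
        rw [h2] at h1
        omega
      have hdet := γ.det_coe
      rw [Matrix.det_fin_two, h' 0 0, h' 0 1] at hdet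
      simp at hdet
    constructor
    · rintro (g | g) (g' | g') h
      · rw [hne g g' fun z => by rw [show transLift g = transLift g' from h]]
      · exfalso
        have h1 : (transLift g : SL(2, ℤ)) = -(transLift g' : SL(2, ℤ)) := congrArg Subtype.val h
        have := hne g g' fun z => by rw [h1, ModularGroup.SL_neg_smul]
        subst this
        exact hpm _ h1
      · exfalso
        have h1 : -(transLift g : SL(2, ℤ)) = (transLift g' : SL(2, ℤ)) := congrArg Subtype.val h
        have := hne g g' fun z => by rw [← h1, ModularGroup.SL_neg_smul]
        subst this
        exact hpm _ h1.symm
      · have h1 : -(transLift g : SL(2, ℤ)) = -(transLift g' : SL(2, ℤ)) := congrArg Subtype.val h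
        rw [hne g g' fun z => by rw [neg_injective h1]]
    · intro γ
      let g : Gamma0Trans N := ⟨MulAction.toPermHom (Gamma0 N) ℍ γ, γ, rfl⟩
      have hg (z : ℍ) : (transLift g : SL(2, ℤ)) • z = (γ : SL(2, ℤ)) • z := transLift_smul g z
      have h := eq_one_or_neg_one_of_smul_eq (γ := (transLift g : SL(2, ℤ))⁻¹ * γ) fun z => by
        rw [mul_smul, ← hg, inv_smul_smul]
      rcases h with h | h
      · exact ⟨Sum.inl g, Subtype.ext (inv_mul_eq_one.1 h)⟩
      · refine ⟨Sum.inr g, Subtype.ext ?_⟩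
        rw [inv_mul_eq_iff_eq_mul] at h
        change -(transLift g : SL(2, ℤ)) = γ
        rw [h, mul_neg, mul_one])

theorem tsum_Gamma0_ennreal {N : ℕ} (f : ℍ → ENNReal) (z : ℍ) :
    ∑' γ : Gamma0 N, f ((γ : SL(2, ℤ)) • z) = 2 * ∑' g : Gamma0Trans N, f (g • z) := by
  rw [← (transSumEquiv N).tsum_eq, Summable.tsum_sum ENNReal.summable ENNReal.summable]
  have h1 (g : Gamma0Trans N) : f (((transSumEquiv N (Sum.inl g) : Gamma0 N) : SL(2, ℤ)) • z)
      = f (g • z) := by rw [← transLift_smul g]; rfl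
  have h2 (g : Gamma0Trans N) : f (((transSumEquiv N (Sum.inr g) : Gamma0 N) : SL(2, ℤ)) • z)
      = f (g • z) := by
    rw [← transLift_smul g, ← ModularGroup.SL_neg_smul (transLift g : SL(2, ℤ))]; rfl
  simp only [h1, h2]
  rw [two_mul]

theorem hasSum_Gamma0 {N : ℕ} {f : ℍ → ℂ} {z : ℍ} (hs : Summable fun g : Gamma0Trans N => f (g • z)) :
    HasSum (fun γ : Gamma0 N => f ((γ : SL(2, ℤ)) • z)) (2 * ∑' g : Gamma0Trans N, f (g • z)) := by
  rw [← (transSumEquiv N).hasSum_iff, two_mul]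
  have h1 (g : Gamma0Trans N) : f (((transSumEquiv N (Sum.inl g) : Gamma0 N) : SL(2, ℤ)) • z)
      = f (g • z) := by rw [← transLift_smul g]; rfl
  have h2 (g : Gamma0Trans N) : f (((transSumEquiv N (Sum.inr g) : Gamma0 N) : SL(2, ℤ)) • z)
      = f (g • z) := by
    rw [← transLift_smul g, ← ModularGroup.SL_neg_smul (transLift g : SL(2, ℤ))]; rfl
  refine HasSum.sum ?_ ?_
  · exact (funext h1 : _ = fun g : Gamma0Trans N => f (g • z)) ▸ hs.hasSum
  · exact (funext h2 : _ = fun g : Gamma0Trans N => f (g • z)) ▸ hs.hasSum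

/-- The domain is fundamental for the group of transformations, which Γ₀(N) covers twice; hence the
factor 2. -/
theorem IsGamma0FundamentalDomain.lintegral_tsum_Gamma0 {N : ℕ} {D : Set ℍ}
    (hD : IsGamma0FundamentalDomain N D) {f : ℍ → ENNReal} (hf : Measurable f) :
    ∫⁻ z in D, ∑' γ : Gamma0 N, f ((γ : SL(2, ℤ)) • z) = 2 * ∫⁻ z, f z := by
  have hm (g : Gamma0Trans N) : Measurable fun z : ℍ => f (g • z) :=
    hf.comp (measurable_const_smul g)
  simp only [tsum_Gamma0_ennreal]
  rw [lintegral_const_mul _ (Measurable.tsum hm),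
    lintegral_tsum fun g => (hm g).aemeasurable, IsFundamentalDomain.lintegral_eq_tsum'' hD]

theorem IsGamma0FundamentalDomain.integral_tsum_Gamma0 {N : ℕ} {D : Set ℍ}
    (hD : IsGamma0FundamentalDomain N D) {f : ℍ → ℂ} (hfm : Measurable f) (hf : Integrable f)
    (hs : ∀ z : ℍ, Summable fun γ : Gamma0 N => f ((γ : SL(2, ℤ)) • z)) :
    ∫ z in D, ∑' γ : Gamma0 N, f ((γ : SL(2, ℤ)) • z) = 2 * ∫ z, f z := by
  have hm (g : Gamma0Trans N) : Measurable fun z : ℍ => f (g • z) :=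
    hfm.comp (measurable_const_smul g)
  have hs' (z : ℍ) : Summable fun g : Gamma0Trans N => f (g • z) := by
    have h := (hs z).comp_injective ((transSumEquiv N).injective.comp Sum.inl_injective)
    refine h.congr fun g => ?_
    rw [← transLift_smul g]
    rfl
  have h1 (z : ℍ) : ∑' γ : Gamma0 N, f ((γ : SL(2, ℤ)) • z) =
      2 * ∑' g : Gamma0Trans N, f (g • z) := (hasSum_Gamma0 (hs' z)).tsum_eq
  simp only [h1]
  rw [integral_const_mul, integral_tsum fun g => (hm g).aestronglyMeasurable,
    IsFundamentalDomain.integral_eq_tsum'' hD f hf]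
  have h2 := IsFundamentalDomain.lintegral_eq_tsum'' hD fun z => ‖f z‖ₑ
  rw [← h2]
  exact hf.2.ne

end Unfolding

/-! ### The hyperbolic measure in coordinates -/

section Measure

theorem measurable_ofComplex : Measurable (ofComplex : ℂ → ℍ) := by
  have e : (ofComplex : ℂ → ℍ) = Function.extend UpperHalfPlane.coe id
      fun _ => Classical.choice inferInstance := by
    ext1 w
    by_cases hw : 0 < w.im
    · have : w = UpperHalfPlane.coe ⟨w, hw⟩ := rfl
      rw [this, ofComplex_apply, UpperHalfPlane.coe_injective.extend_apply]
      rfl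
    · rw [ofComplex_apply_eq_ite, dif_neg hw, Function.extend_apply']
      rintro ⟨z, rfl⟩
      exact hw z.im_pos
  rw [e]
  exact measurableEmbedding_coe.measurable_extend measurable_id measurable_const

theorem measurable_linePoint : Measurable fun p : ℝ × ℝ => linePoint p.1 p.2 :=
  measurable_ofComplex.comp (by fun_prop)

/-- Reduces integrals over the upper half-plane to Fubini on the real plane with density 1/y². -/
theorem volume_eq_map_linePoint : (volume : Measure ℍ) =
    Measure.map (fun p : ℝ × ℝ => linePoint p.1 p.2)
      (((volume : Measure ℝ).prod (volume.restrict (Set.Ioi 0))).withDensity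
        fun p => ENNReal.ofReal (1 / p.2 ^ 2)) := by
  have hprod : (volume : Measure ℝ).prod (volume.restrict (Set.Ioi (0 : ℝ))) =
      (volume : Measure (ℝ × ℝ)).restrict (Set.univ ×ˢ Set.Ioi 0) := by
    have h := Measure.prod_restrict (μ := (volume : Measure ℝ)) (ν := (volume : Measure ℝ))
      Set.univ (Set.Ioi (0 : ℝ))
    rw [Measure.restrict_univ] at h
    exact h
  ext s hs
  have hs' := measurable_linePoint hs
  rw [Measure.map_apply measurable_linePoint hs, withDensity_apply _ hs', hprod,
    Measure.restrict_restrict hs', volume_eq_lintegral,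
    ← (Complex.volume_preserving_equiv_real_prod.symm).setLIntegral_comp_preimage_emb
      Complex.measurableEquivRealProd.symm.measurableEmbedding]
  have hset : (Complex.measurableEquivRealProd.symm ⁻¹' (UpperHalfPlane.coe '' s)) =
      (fun p : ℝ × ℝ => linePoint p.1 p.2) ⁻¹' s ∩ Set.univ ×ˢ Set.Ioi 0 := by
    ext ⟨x, y⟩
    have e : Complex.measurableEquivRealProd.symm (x, y) = x + y * Complex.I :=
      Complex.mk_eq_add_mul_I x y
    simp only [Set.mem_preimage, Set.mem_inter_iff, Set.mem_prod, Set.mem_univ, true_and,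
      Set.mem_Ioi, e]
    constructor
    · rintro ⟨z, hz, h⟩
      have hy : y = z.im := by
        have := congrArg Complex.im h
        simpa using this.symm
      have hx : x = z.re := by
        have := congrArg Complex.re h
        simpa using this.symm
      rw [hx, hy, linePoint_re_im]
      exact ⟨hz, z.im_pos⟩
    · rintro ⟨hz, hy⟩
      exact ⟨_, hz, coe_linePoint hy⟩
  rw [hset]
  refine setLIntegral_congr_fun (hs'.inter (MeasurableSet.univ.prod measurableSet_Ioi)) ?_
  rintro ⟨x, y⟩ ⟨-, -, hy⟩
  have hy' : 0 < y := hy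
  have e : (Complex.measurableEquivRealProd.symm (x, y)).im = y := rfl
  simp only [e]
  rw [one_div, one_div, ENNReal.ofReal, ENNReal.coe_inj]
  ext
  simp [hy'.le]

theorem lintegral_eq_lintegral_linePoint {f : ℍ → ENNReal} (hf : Measurable f) :
    ∫⁻ z, f z = ∫⁻ y in Set.Ioi (0 : ℝ), ∫⁻ x : ℝ,
      ENNReal.ofReal (1 / y ^ 2) * f (linePoint x y) := by
  have h1 : Measurable fun p : ℝ × ℝ => ENNReal.ofReal (1 / p.2 ^ 2) := by fun_prop
  have h2 : Measurable fun p : ℝ × ℝ => f (linePoint p.1 p.2) := hf.comp measurable_linePoint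
  rw [volume_eq_map_linePoint, lintegral_map hf measurable_linePoint,
    lintegral_withDensity_eq_lintegral_mul _ h1 h2,
    lintegral_prod_symm _ (h1.mul h2).aemeasurable]
  rfl

theorem integral_eq_integral_linePoint {f : ℍ → ℂ} (hf : Measurable f) (hfi : Integrable f) :
    ∫ z, f z = ∫ y in Set.Ioi (0 : ℝ), ∫ x : ℝ, ((1 / y ^ 2 : ℝ) : ℂ) * f (linePoint x y) := by
  have h1 : Measurable fun p : ℝ × ℝ => (1 / p.2 ^ 2).toNNReal := by fun_prop
  have hc : ∀ p : ℝ × ℝ, ((1 / p.2 ^ 2).toNNReal : ℝ) = 1 / p.2 ^ 2 :=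
    fun p => Real.coe_toNNReal _ (by positivity)
  rw [volume_eq_map_linePoint] at hfi ⊢
  rw [integrable_map_measure hf.aestronglyMeasurable measurable_linePoint.aemeasurable] at hfi
  rw [integral_map measurable_linePoint.aemeasurable hf.aestronglyMeasurable]
  have e : (fun p : ℝ × ℝ => ENNReal.ofReal (1 / p.2 ^ 2)) =
    fun p => (((1 / p.2 ^ 2).toNNReal : NNReal) : ENNReal) := rfl
  rw [e] at hfi ⊢
  rw [integrable_withDensity_iff_integrable_smul h1] at hfi
  simp only [Function.comp_apply] at hfi
  rw [integral_withDensity_eq_integral_smul h1, integral_prod_symm _ hfi]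
  refine setIntegral_congr_fun measurableSet_Ioi fun y _ => ?_
  refine integral_congr_ae (Filter.Eventually.of_forall fun x => ?_)
  simp only [NNReal.smul_def, Complex.real_smul]
  rw [hc (x, y)]

end Measure

/-! ### Finite volume, and comparison of other sets with the fundamental domain -/

section FiniteVolume

theorem measurableSet_halfStrip (X δ : ℝ) : MeasurableSet {z : ℍ | |z.re| ≤ X ∧ δ ≤ z.im} :=
  (measurableSet_le continuous_re.measurable.abs measurable_const).inter
    (measurableSet_le measurable_const continuous_im.measurable)

theorem volume_halfStrip_lt_top (X : ℝ) {δ : ℝ} (hδ : 0 < δ) :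
    volume {z : ℍ | |z.re| ≤ X ∧ δ ≤ z.im} < ⊤ := by
  set A := {z : ℍ | |z.re| ≤ X ∧ δ ≤ z.im} with hA
  have hAm : MeasurableSet A := measurableSet_halfStrip X δ
  rw [← lintegral_indicator_one hAm, lintegral_eq_lintegral_linePoint
    (measurable_one.indicator hAm)]
  -- The half-line starts at δ/2 because it is open and y = δ must be included.
  have h1 : ∀ y ∈ Set.Ioi (0 : ℝ), ∫⁻ x : ℝ, ENNReal.ofReal (1 / y ^ 2) *
      A.indicator 1 (linePoint x y) ≤
      (Set.Ioi (δ / 2)).indicator (fun y => ENNReal.ofReal (y ^ (-2 : ℝ))) y *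
        volume (Set.Icc (-X) X) := by
    intro y hy
    have hy' : 0 < y := hy
    rw [← lintegral_indicator_one measurableSet_Icc, ← lintegral_const_mul _
      (measurable_one.indicator measurableSet_Icc)]
    refine lintegral_mono fun x => ?_
    by_cases h : linePoint x y ∈ A
    · have h2 : |x| ≤ X ∧ δ ≤ y := by
        rwa [hA, Set.mem_ofPred_eq, linePoint_re hy', linePoint_im hy'] at h
      have h3 : y ∈ Set.Ioi (δ / 2) := by
        have := h2.2
        rw [Set.mem_Ioi]
        linarith
      have h4 : x ∈ Set.Icc (-X) X := abs_le.1 h2.1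
      rw [Set.indicator_of_mem h, Set.indicator_of_mem h3, Set.indicator_of_mem h4]
      have h5 : 1 / y ^ 2 = y ^ (-2 : ℝ) := by
        rw [Real.rpow_neg hy'.le, one_div]
        norm_num
      rw [h5]
      rfl
    · rw [Set.indicator_of_notMem h, mul_zero]
      exact zero_le
  refine (setLIntegral_mono' measurableSet_Ioi h1).trans_lt ?_
  refine (lintegral_mono' Measure.restrict_le_self le_rfl).trans_lt ?_
  rw [lintegral_mul_const _ ((by fun_prop : Measurable fun y : ℝ =>
    ENNReal.ofReal (y ^ (-2 : ℝ))).indicator measurableSet_Ioi),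
    lintegral_indicator measurableSet_Ioi]
  refine ENNReal.mul_lt_top ?_ (by simp)
  exact (integrableOn_Ioi_rpow_of_lt (by norm_num) (by positivity)).lintegral_lt_top

theorem volume_fd_lt_top : volume (ModularGroup.fd : Set ℍ) < ⊤ := by
  refine (measure_mono ?_).trans_lt (volume_halfStrip_lt_top (1 / 2) (δ := 1 / 2) (by norm_num))
  intro z hz
  refine ⟨hz.2, ?_⟩
  have h := ModularGroup.three_le_four_mul_im_sq_of_mem_fd hz
  nlinarith [z.im_pos]

theorem measurableSet_fd : MeasurableSet (ModularGroup.fd : Set ℍ) := by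
  have : IsClosed (ModularGroup.fd : Set ℍ) := ModularGroup.isClosed_fd
  exact this.measurableSet

/-- A set of finite volume whose translates by `Γ₀(N)` cover the upper half plane. -/
theorem exists_cover_Gamma0 {N : ℕ} (hN : 0 < N) : ∃ A : Set ℍ, MeasurableSet A ∧
    volume A < ⊤ ∧ ∀ z : ℍ, ∃ γ : Gamma0 N, (γ : SL(2, ℤ)) • z ∈ A := by
  have : NeZero N := ⟨hN.ne'⟩
  have : Finite (SL(2, ℤ) ⧸ Gamma0 N) := Subgroup.finite_quotient_of_finiteIndex
  refine ⟨⋃ q : SL(2, ℤ) ⧸ Gamma0 N, (fun z : ℍ => q.out • z) ⁻¹' ModularGroup.fd,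
    MeasurableSet.iUnion fun q => (continuous_SL_smul _).measurable measurableSet_fd, ?_, ?_⟩
  · have := Fintype.ofFinite (SL(2, ℤ) ⧸ Gamma0 N)
    refine (measure_iUnion_le _).trans_lt ?_
    rw [tsum_fintype]
    refine ENNReal.sum_lt_top.2 fun q _ => ?_
    rw [(measurePreserving_SL_smul _).measure_preimage measurableSet_fd.nullMeasurableSet]
    exact volume_fd_lt_top
  · intro z
    obtain ⟨σ, hσ⟩ := ModularGroup.exists_smul_mem_fd z
    refine ⟨⟨(σ : SL(2, ℤ) ⧸ Gamma0 N).out⁻¹ * σ, QuotientGroup.eq.1 (Quotient.out_eq _)⟩, ?_⟩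
    refine Set.mem_iUnion.2 ⟨(σ : SL(2, ℤ) ⧸ Gamma0 N), ?_⟩
    change _ • (_ • z) ∈ ModularGroup.fd
    rw [← mul_smul, mul_inv_cancel_left]
    exact hσ

variable {N : ℕ} {D : Set ℍ}

/-- Every point has a translate in the covering set A, so 1 ≤ ∑ 1_A(γz) on D, and unfolding bounds
the volume by 2 vol(A). -/
theorem IsGamma0FundamentalDomain.volume_lt_top (hN : 0 < N)
    (hD : IsGamma0FundamentalDomain N D) : volume D < ⊤ := by
  obtain ⟨A, hA, hAv, hc⟩ := exists_cover_Gamma0 hN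
  have h := hD.lintegral_tsum_Gamma0 (measurable_one.indicator hA)
  rw [lintegral_indicator_one hA] at h
  have h2 : volume D ≤ ∫⁻ z in D, ∑' γ : Gamma0 N, A.indicator 1 ((γ : SL(2, ℤ)) • z) := by
    rw [← setLIntegral_one]
    refine lintegral_mono fun z => ?_
    obtain ⟨γ, hγ⟩ := hc z
    refine le_trans ?_ (ENNReal.le_tsum γ)
    rw [Set.indicator_of_mem hγ]
    rfl
  rw [h] at h2
  exact h2.trans_lt (ENNReal.mul_lt_top (by simp) hAv)

/-- Unfold 1_A F: by invariance, at z the sum is F(z) times the number of γ with γz in A. This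
carries estimates on D over to any set of bounded multiplicity. -/
theorem IsGamma0FundamentalDomain.setLIntegral_le (hD : IsGamma0FundamentalDomain N D)
    {A : Set ℍ} (hA : MeasurableSet A) {C : ℕ}
    (hC : ∀ z : ℍ, {γ : Gamma0 N | (γ : SL(2, ℤ)) • z ∈ A}.encard ≤ C) {F : ℍ → ENNReal}
    (hF : Measurable F) (hinv : ∀ γ ∈ Gamma0 N, ∀ z : ℍ, F (γ • z) = F z) :
    ∫⁻ z in A, F z ≤ C * ∫⁻ z in D, F z := by
  have h := hD.lintegral_tsum_Gamma0 (hF.indicator hA)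
  rw [lintegral_indicator hA] at h
  have h1 : ∫⁻ z in A, F z ≤ 2 * ∫⁻ z in A, F z := by
    rw [two_mul]
    exact le_self_add
  refine h1.trans ?_
  rw [← h, ← lintegral_const_mul _ hF]
  refine lintegral_mono fun z => ?_
  have h2 : ∀ γ : Gamma0 N, A.indicator F ((γ : SL(2, ℤ)) • z) =
      {γ : Gamma0 N | (γ : SL(2, ℤ)) • z ∈ A}.indicator (fun _ => F z) γ := fun γ => by
    by_cases hm : (γ : SL(2, ℤ)) • z ∈ A
    · rw [Set.indicator_of_mem hm, Set.indicator_of_mem (by exact hm), hinv _ γ.2]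
    · rw [Set.indicator_of_notMem hm, Set.indicator_of_notMem (by exact hm)]
  simp only [h2]
  rw [← tsum_subtype, ENNReal.tsum_set_const]
  gcongr
  have := hC z
  exact_mod_cast ENat.toENNReal_le.2 this

end FiniteVolume

/-! ### Petersson products with truncated series -/

section PeterssonUnfolding

theorem petersson_two_apply (f g : ℍ → ℂ) (z : ℍ) :
    petersson 2 f g z = conj (f z) * g z * (z.im : ℂ) ^ 2 := by
  rw [petersson]
  norm_cast

theorem measurable_petersson_two {f g : ℍ → ℂ} (hf : Measurable f) (hg : Measurable g) :
    Measurable (petersson 2 f g) := by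
  have e : petersson 2 f g = fun z => conj (f z) * g z * (z.im : ℂ) ^ 2 :=
    funext (petersson_two_apply f g)
  rw [e]
  exact ((Complex.continuous_conj.measurable.comp hf).mul hg).mul
    ((Complex.measurable_ofReal.comp continuous_im.measurable).pow_const 2)

theorem norm_petersson_two (f g : ℍ → ℂ) (z : ℍ) :
    ‖petersson 2 f g z‖ = ‖f z‖ * z.im * (‖g z‖ * z.im) := by
  rw [petersson_two_apply, norm_mul, norm_mul, norm_pow, Complex.norm_real, RCLike.norm_conj,
    Real.norm_of_nonneg z.im_pos.le]
  ring

variable {m : ℕ} {φ : ℝ → ℝ} {δ : ℝ} {h : ℍ → ℂ} {B : ℝ}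

theorem petersson_stripFun_eq_zero (hφ : ∀ t ≤ δ, φ t = 0) {z : ℍ}
    (hz : z ∉ {z : ℍ | |z.re| ≤ 1 ∧ δ ≤ z.im}) : petersson 2 (stripFun m φ) h z = 0 := by
  have : stripFun m φ z = 0 := by
    unfold stripFun
    split_ifs with h0
    · have : ¬ δ ≤ z.im := fun h1 => hz ⟨abs_le.2 ⟨by linarith [h0.1], h0.2.le⟩, h1⟩
      rw [hφ _ (not_le.1 this).le]
      simp
    · rfl
  rw [petersson_two_apply, this]
  simp

theorem integrable_petersson_stripFun (hm : 0 < m) (hφm : Measurable φ) (hφ1 : ∀ t, |φ t| ≤ 1)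
    (hδ : 0 < δ) (hφ : ∀ t ≤ δ, φ t = 0) (hh : Measurable h) (hB : ∀ z, ‖h z‖ * z.im ≤ B) :
    Integrable (petersson 2 (stripFun m φ) h) := by
  have hon : IntegrableOn (petersson 2 (stripFun m φ) h) {z : ℍ | |z.re| ≤ 1 ∧ δ ≤ z.im} := by
    refine Measure.integrableOn_of_bounded (M := B) (volume_halfStrip_lt_top 1 hδ).ne
      (measurable_petersson_two (measurable_stripFun m hφm) hh).aestronglyMeasurable ?_
    refine Filter.Eventually.of_forall fun z => ?_
    rw [norm_petersson_two]
    refine (mul_le_of_le_one_left (mul_nonneg (norm_nonneg _) z.im_pos.le)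
      (norm_stripFun_mul_im_le hm hφ1 z)).trans (hB z)
  exact (integrableOn_iff_integrable_of_support_subset fun z hz => by
    by_contra hn
    exact hz (petersson_stripFun_eq_zero hφ hn)).1 hon

theorem petersson_slashSum {N : ℕ} (hδ : 0 < δ) (hφ : ∀ t ≤ δ, φ t = 0)
    (hinv : ∀ γ ∈ Gamma0 N, h ∣[(2 : ℤ)] γ = h) (z : ℍ) :
    petersson 2 (slashSum m φ (Gamma0 N)) h z =
      2⁻¹ * ∑' γ : Gamma0 N, petersson 2 (stripFun m φ) h ((γ : SL(2, ℤ)) • z) ∧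
    Summable fun γ : Gamma0 N => petersson 2 (stripFun m φ) h ((γ : SL(2, ℤ)) • z) := by
  have hs := summable_slash m hδ hφ (Gamma0 N : Set SL(2, ℤ)) z
  have hγ (γ : Gamma0 N) : petersson 2 (stripFun m φ) h ((γ : SL(2, ℤ)) • z) =
      conj ((stripFun m φ ∣[(2 : ℤ)] (γ : SL(2, ℤ))) z) * (h z * (z.im : ℂ) ^ 2) := by
    rw [← petersson_slash_SL, hinv _ γ.2, petersson_two_apply, mul_assoc]
  have hs' := Complex.hasSum_conj'.2 hs.hasSum
  simp only [hγ]
  refine ⟨?_, hs'.summable.mul_right _⟩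
  rw [tsum_mul_right, petersson_two_apply, slashSum, map_mul, ← Complex.conj_tsum]
  rw [map_inv₀, Complex.conj_ofNat, mul_assoc, mul_assoc]
  rfl

/-- The factor 1/2 cancels the two copies of the transformation group, and y² cancels the density of
the measure; integrating over the width of the strip leaves a Fourier coefficient of h. No
holomorphy is required of h, so h may itself be a truncated series. -/
theorem integral_petersson_slashSum {N : ℕ} {D : Set ℍ} (hD : IsGamma0FundamentalDomain N D)
    (hm : 0 < m) (hφm : Measurable φ) (hφ1 : ∀ t, |φ t| ≤ 1)
    (hδ : 0 < δ) (hφ : ∀ t ≤ δ, φ t = 0) (hh : Measurable h) (hB : ∀ z, ‖h z‖ * z.im ≤ B)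
    (hinv : ∀ γ ∈ Gamma0 N, h ∣[(2 : ℤ)] γ = h) :
    ∫ z in D, petersson 2 (slashSum m φ (Gamma0 N)) h z =
      ∫ y in Set.Ioi (0 : ℝ), (φ y * Real.exp (-(2 * π * m * y)) : ℝ) *
        ∫ x in (0 : ℝ)..1, h (linePoint x y) * expTwoPiI (-(m * x)) := by
  simp only [fun z => (petersson_slashSum (m := m) hδ hφ hinv z).1]
  have hi := integrable_petersson_stripFun hm hφm hφ1 hδ hφ hh hB
  have hpm := measurable_petersson_two (measurable_stripFun m hφm) hh
  rw [integral_const_mul, hD.integral_tsum_Gamma0 hpm hi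
    fun z => (petersson_slashSum hδ hφ hinv z).2, inv_mul_cancel_left₀ two_ne_zero,
    integral_eq_integral_linePoint hpm hi]
  refine setIntegral_congr_fun measurableSet_Ioi fun y hy => ?_
  have hy' : 0 < y := hy
  rw [intervalIntegral.integral_of_le zero_le_one, ← integral_Ico_eq_integral_Ioc,
    ← integral_indicator measurableSet_Ico, ← integral_const_mul]
  congr 1
  ext x
  rw [petersson_two_apply, stripFun, linePoint_re hy', linePoint_im hy', coe_linePoint hy']
  by_cases hx : 0 ≤ x ∧ x < 1
  · rw [if_pos hx, Set.indicator_of_mem (by exact hx), map_mul, conj_expTwoPiI, Complex.conj_ofReal]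
    have e : expTwoPiI (-conj ((m : ℂ) * (x + y * Complex.I))) =
        (Real.exp (-(2 * π * m * y)) : ℝ) * expTwoPiI (-(m * x)) := by
      rw [expTwoPiI, expTwoPiI, Complex.ofReal_exp, ← Complex.exp_add]
      congr 1
      simp only [map_mul, map_add, Complex.conj_ofReal, Complex.conj_I, Complex.conj_natCast]
      push_cast
      linear_combination (2 * π * m * y : ℂ) * Complex.I_sq
    rw [e]
    have hyc : (y : ℂ) ≠ 0 := by exact_mod_cast hy'.ne'
    push_cast
    field_simp
  · rw [if_neg hx, Set.indicator_of_notMem (by exact hx)]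
    simp

end PeterssonUnfolding

/-! ### Uniform bounds and limits of the Fourier coefficients -/

section FourierLimit

variable {M Q : ℕ}

theorem summable_majorant (m : ℕ) : Summable fun c : Modulus M Q =>
    2 * m * (((c.1 : ℕ).divisors.card : ℝ) * ((c.1 : ℕ) : ℝ) ^ (-9 / 8 : ℝ)) := by
  have hinj : Function.Injective fun c : Modulus M Q => (c.1 : ℕ) :=
    PNat.coe_injective.comp Subtype.val_injective
  exact ((summable_card_divisors_mul_rpow (s := -9 / 8) (by norm_num)).mul_left
    (2 * m : ℝ)).comp_injective hinj

theorem norm_kloosterman_mul_rpow_le [NeZero Q] {m : ℕ} (hm : 0 < m) (c : Modulus M Q)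
    (b : ZMod (c.1 : ℕ)) :
    ‖kloostermanSum (c.1 : ℕ) m b‖ * ((Q : ℝ) * (c.1 : ℕ) ^ 2) ^ (-15 / 16 : ℝ) ≤
      2 * m * (((c.1 : ℕ).divisors.card : ℝ) * ((c.1 : ℕ) : ℝ) ^ (-9 / 8 : ℝ)) := by
  refine le_trans ?_ (norm_kloostermanSum_mul_rpow_le (c.1 : ℕ) m hm b)
  have hc : (1 : ℝ) ≤ (c.1 : ℕ) := by exact_mod_cast c.1.pos
  have hQ : (1 : ℝ) ≤ Q := by exact_mod_cast NeZero.one_le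
  have e : ((c.1 : ℕ) : ℝ) ^ (-15 / 8 : ℝ) = (((c.1 : ℕ) : ℝ) ^ 2) ^ (-15 / 16 : ℝ) := by
    rw [← Real.rpow_natCast, ← Real.rpow_mul (by positivity)]
    norm_num
  rw [e]
  refine mul_le_mul_of_nonneg_left ?_ (norm_nonneg _)
  exact Real.rpow_le_rpow_of_nonpos (by positivity) (by nlinarith [sq_nonneg ((c.1 : ℕ) : ℝ)])
    (by norm_num)

theorem summable_norm_kloosterman [NeZero Q] {m : ℕ} (hm : 0 < m)
    (b : ∀ c : Modulus M Q, ZMod (c.1 : ℕ)) : Summable fun c : Modulus M Q =>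
      ‖kloostermanSum (c.1 : ℕ) m (b c)‖ * ((Q : ℝ) * (c.1 : ℕ) ^ 2) ^ (-15 / 16 : ℝ) :=
  Summable.of_nonneg_of_le (fun c => by positivity)
    (fun c => norm_kloosterman_mul_rpow_le hm c (b c)) (summable_majorant m)

/-- The `n`-th Fourier coefficient of `poincareSum m φ M Q` on the line of height `y`. -/
def poincareCoeff (m : ℕ) (n : ℤ) (φ : ℝ → ℝ) (M Q : ℕ) [NeZero Q] (y : ℝ) : ℂ :=
  ∫ x in (0 : ℝ)..1, poincareSum m φ M Q (linePoint x y) * expTwoPiI (-(n * x))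

theorem integral_expTwoPiI_line (m : ℕ) (n : ℤ) (y : ℝ) :
    ∫ x in (0 : ℝ)..1, expTwoPiI (m * (x + y * Complex.I)) * expTwoPiI (-(n * x)) =
      if (m : ℤ) = n then (Real.exp (-(2 * π * m * y)) : ℂ) else 0 := by
  have e (x : ℝ) : expTwoPiI (m * (x + y * Complex.I)) * expTwoPiI (-(n * x)) =
      (Real.exp (-(2 * π * m * y)) : ℝ) * Complex.exp (2 * π * Complex.I * ((m : ℤ) - n) * x) := by
    rw [← expTwoPiI_add, expTwoPiI, Complex.ofReal_exp, ← Complex.exp_add]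
    congr 1
    push_cast
    linear_combination (2 * π * m * y : ℂ) * Complex.I_sq
  simp only [e]
  rw [intervalIntegral.integral_const_mul]
  split_ifs with h
  · rw [h]
    simp
  · have hne : (2 * π * Complex.I * ((m : ℤ) - n) : ℂ) ≠ 0 := by
      refine mul_ne_zero Complex.two_pi_I_ne_zero ?_
      rw [sub_ne_zero]
      exact_mod_cast h
    rw [integral_exp_mul_complex hne]
    have : Complex.exp (2 * π * Complex.I * ((m : ℤ) - n) * (1 : ℝ)) = 1 := by
      have := expTwoPiI_intCast ((m : ℤ) - n)
      rw [expTwoPiI] at this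
      push_cast at this ⊢
      rw [mul_one]
      exact this
    rw [this]
    simp

theorem norm_poincareSum_mul_im (m : ℕ) (φ : ℝ → ℝ) (M Q : ℕ) [NeZero Q] (z : ℍ) :
    ‖poincareSum m φ M Q z‖ * z.im =
      ‖slashSum m φ (cosetSet M Q) (scalePoint Q z)‖ * (scalePoint Q z).im := by
  rw [poincareSum_eq, norm_mul, scalePoint_im, Complex.norm_natCast]
  ring

theorem continuous_scalePoint (Q : ℕ) [NeZero Q] : Continuous (scalePoint Q) := by
  rw [isOpenEmbedding_coe.isInducing.continuous_iff]
  exact continuous_const.mul continuous_coe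

theorem measurable_poincareSum (m : ℕ) {φ : ℝ → ℝ} (hφm : Measurable φ) {δ : ℝ} (hδ : 0 < δ)
    (hφ : ∀ t ≤ δ, φ t = 0) (M Q : ℕ) [NeZero Q] : Measurable (poincareSum m φ M Q) := by
  rw [funext (poincareSum_eq m φ M Q)]
  exact ((measurable_slashSum m hφm hδ hφ _).comp (continuous_scalePoint Q).measurable).const_mul _

theorem measurable_linePoint_left (y : ℝ) : Measurable fun x : ℝ => linePoint x y :=
  measurable_linePoint.comp (measurable_id.prodMk measurable_const)

/-- A measurable function `h` with `‖h z‖ Im z` bounded is integrable along horizontal segments. -/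
theorem intervalIntegrable_linePoint {h : ℍ → ℂ} (hh : Measurable h) {B : ℝ}
    (hB : ∀ z, ‖h z‖ * z.im ≤ B) (n : ℤ) {y : ℝ} (hy : 0 < y) (a b : ℝ) :
    IntervalIntegrable (fun x => h (linePoint x y) * expTwoPiI (-(n * x))) volume a b := by
  rw [intervalIntegrable_iff]
  refine Measure.integrableOn_of_bounded (M := B / y) (by simp) ?_ ?_
  · have he : Continuous fun x : ℝ => expTwoPiI (-(n * x)) := by fun_prop
    exact ((hh.comp (measurable_linePoint_left y)).mul he.measurable).aestronglyMeasurable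
  · refine Filter.Eventually.of_forall fun x => ?_
    rw [norm_mul, norm_expTwoPiI_neg_intCast_mul, mul_one, le_div_iff₀ hy]
    have := hB (linePoint x y)
    rwa [linePoint_im hy] at this

theorem hasSum_poincareCoeff [NeZero Q] {m : ℕ} (hm : 0 < m) (n : ℤ) {φ : ℝ → ℝ}
    (hφm : Measurable φ) (hφ1 : ∀ t, |φ t| ≤ 1) {δ : ℝ} (hδ : 0 < δ) (hφ : ∀ t ≤ δ, φ t = 0)
    {y : ℝ} (hy : 0 < y) :
    HasSum (fun c : Modulus M Q => kloostermanSum (c.1 : ℕ) m (n * (Q : ZMod (c.1 : ℕ))⁻¹) *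
      besselIntegral m n φ (Q * (c.1 : ℕ) ^ 2) y)
      (poincareCoeff m n φ M Q y -
        if Q = 1 ∧ (m : ℤ) = n then ((φ y * Real.exp (-(2 * π * m * y)) : ℝ) : ℂ) else 0) := by
  have h := hasSum_coeff_poincareSum (M := M) (Q := Q) m n hφm hφ1 hδ hφ hy
  convert h using 1
  obtain ⟨C, hC⟩ := exists_norm_slashSum_mul_im_le hm hφ1 hδ hφ
  have hi := intervalIntegrable_linePoint (measurable_poincareSum m hφm hδ hφ M Q)
    (B := C) (fun z => by rw [norm_poincareSum_mul_im]; exact hC _ _) n hy 0 1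
  simp only [sub_mul]
  rw [intervalIntegral.integral_sub hi, ← poincareCoeff]
  · congr 1
    by_cases hQ : Q = 1
    · simp only [hQ, if_true, true_and]
      simp only [mul_assoc]
      rw [intervalIntegral.integral_const_mul, integral_expTwoPiI_line]
      split_ifs <;> simp [mul_assoc]
    · simp [hQ]
  · refine Continuous.intervalIntegrable ?_ _ _
    split_ifs <;> fun_prop

/-- The `n`-th Fourier coefficient of the limit of `poincareSum m φ M Q` for `φ → 1`. -/
def limitCoeff (m M Q n : ℕ) : ℂ :=
  (if Q = 1 ∧ m = n then 1 else 0) - 2 * π * (√((m : ℝ) * n) / m : ℝ) *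
    ∑' c : Modulus M Q, kloostermanTermTwisted Q m n (c.1 : ℕ)

theorem kloosterman_mul_besselIntegral_one [NeZero Q] {m n : ℕ} (hm : 0 < m) (hn : 0 < n)
    (c : Modulus M Q) {y : ℝ} (hy : 0 < y) :
    kloostermanSum (c.1 : ℕ) m ((n : ℤ) * (Q : ZMod (c.1 : ℕ))⁻¹) *
      besselIntegral m n (fun _ => 1) (Q * (c.1 : ℕ) ^ 2) y =
    -(2 * π * (√((m : ℝ) * n) / m : ℝ)) * Real.exp (-(2 * π * n * y)) *
      kloostermanTermTwisted Q m n (c.1 : ℕ) := by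
  have hC : (0 : ℝ) < Q * (c.1 : ℕ) ^ 2 :=
    mul_pos (Nat.cast_pos.2 (NeZero.pos Q)) (by have := c.1.pos; positivity)
  have hs : √((Q : ℝ) * (c.1 : ℕ) ^ 2) = (c.1 : ℕ) * √(Q : ℝ) := by
    rw [Real.sqrt_mul (by positivity), Real.sqrt_sq (by positivity), mul_comm]
  rw [besselIntegral_one m hm n hC hy, if_pos (by exact_mod_cast hn), kloostermanTermTwisted, hs]
  push_cast
  ring

/-- Up to a nonzero constant the terms are the Kloosterman sums times Bessel integrals without
cutoff at height y = 1, to which the general majorant applies. -/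
theorem summable_kloostermanTermTwisted [NeZero Q] {m n : ℕ} (hm : 0 < m) (hn : 0 < n) :
    Summable fun c : Modulus M Q => kloostermanTermTwisted Q m n (c.1 : ℕ) := by
  have hC (c : Modulus M Q) : (0 : ℝ) < Q * (c.1 : ℕ) ^ 2 :=
    mul_pos (Nat.cast_pos.2 (NeZero.pos Q)) (by have := c.1.pos; positivity)
  have h : Summable fun c : Modulus M Q => kloostermanSum (c.1 : ℕ) m
      ((n : ℤ) * (Q : ZMod (c.1 : ℕ))⁻¹) *
      besselIntegral m n (fun _ => 1) (Q * (c.1 : ℕ) ^ 2) 1 := by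
    refine Summable.of_norm_bounded ((summable_norm_kloosterman hm
      fun c : Modulus M Q => (n : ℤ) * (Q : ZMod (c.1 : ℕ))⁻¹).mul_left besselBound) fun c => ?_
    rw [norm_mul]
    have := norm_besselIntegral_le hm n (φ := fun _ => 1) (fun _ => by simp) (hC c) one_pos
    rw [Real.one_rpow, mul_one] at this
    calc _ ≤ ‖kloostermanSum (c.1 : ℕ) m ((n : ℤ) * (Q : ZMod (c.1 : ℕ))⁻¹)‖ *
          (besselBound * (Q * (c.1 : ℕ) ^ 2 : ℝ) ^ (-15 / 16 : ℝ)) := by gcongr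
      _ = _ := by ring
  simp only [kloosterman_mul_besselIntegral_one hm hn _ one_pos] at h
  rw [summable_mul_left_iff] at h
  · exact h
  · have : (√((m : ℝ) * n) / m : ℝ) ≠ 0 := by positivity
    have hpi : (π : ℂ) ≠ 0 := by exact_mod_cast Real.pi_ne_zero
    refine mul_ne_zero (neg_ne_zero.2 (mul_ne_zero (mul_ne_zero two_ne_zero hpi) ?_)) ?_
    · exact_mod_cast this
    · exact_mod_cast Real.exp_ne_zero _

/-- A common bound for the Fourier coefficients of the truncated Poincaré series. -/
theorem exists_norm_poincareCoeff_le [NeZero Q] {m : ℕ} (hm : 0 < m) :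
    ∃ K : ℝ, 0 ≤ K ∧ ∀ (n : ℤ) (φ : ℝ → ℝ), Measurable φ → (∀ t, |φ t| ≤ 1) → ∀ δ : ℝ, 0 < δ →
      (∀ t ≤ δ, φ t = 0) → ∀ y : ℝ, 0 < y →
      ‖poincareCoeff m n φ M Q y‖ ≤ 1 + K * y ^ (-15 / 16 : ℝ) := by
  have hsum := (summable_majorant (M := M) (Q := Q) m).mul_left besselBound
  refine ⟨∑' c : Modulus M Q, besselBound * (2 * m *
    (((c.1 : ℕ).divisors.card : ℝ) * ((c.1 : ℕ) : ℝ) ^ (-9 / 8 : ℝ))),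
    tsum_nonneg fun c => mul_nonneg besselBound_nonneg (by positivity), ?_⟩
  intro n φ hφm hφ1 δ hδ hφ y hy
  have hC (c : Modulus M Q) : (0 : ℝ) < Q * (c.1 : ℕ) ^ 2 :=
    mul_pos (Nat.cast_pos.2 (NeZero.pos Q)) (by have := c.1.pos; positivity)
  have h := hasSum_poincareCoeff (M := M) (Q := Q) hm n hφm hφ1 hδ hφ hy
  have h2 := tsum_of_norm_bounded (hsum.mul_right (y ^ (-15 / 16 : ℝ))).hasSum
    (f := fun c : Modulus M Q => kloostermanSum (c.1 : ℕ) m (n * (Q : ZMod (c.1 : ℕ))⁻¹) *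
      besselIntegral m n φ (Q * (c.1 : ℕ) ^ 2) y) fun c => by
    rw [norm_mul]
    have := norm_besselIntegral_le hm n hφ1 (hC c) hy
    calc _ ≤ ‖kloostermanSum (c.1 : ℕ) m (n * (Q : ZMod (c.1 : ℕ))⁻¹)‖ *
          (besselBound * (Q * (c.1 : ℕ) ^ 2 : ℝ) ^ (-15 / 16 : ℝ) * y ^ (-15 / 16 : ℝ)) := by gcongr
      _ = besselBound * (‖kloostermanSum (c.1 : ℕ) m (n * (Q : ZMod (c.1 : ℕ))⁻¹)‖ *
          (Q * (c.1 : ℕ) ^ 2 : ℝ) ^ (-15 / 16 : ℝ)) * y ^ (-15 / 16 : ℝ) := by ring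
      _ ≤ _ := by
          exact mul_le_mul_of_nonneg_right (mul_le_mul_of_nonneg_left
            (norm_kloosterman_mul_rpow_le hm c _) besselBound_nonneg) (by positivity)
  rw [h.tsum_eq, tsum_mul_right] at h2
  have h3 : ‖if Q = 1 ∧ (m : ℤ) = n then ((φ y * Real.exp (-(2 * π * m * y)) : ℝ) : ℂ) else 0‖ ≤
      1 := by
    split_ifs
    · rw [Complex.norm_real, norm_mul, Real.norm_eq_abs, Real.norm_of_nonneg (Real.exp_nonneg _)]
      have : Real.exp (-(2 * π * m * y)) ≤ 1 := Real.exp_le_one_iff.2 (by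
        have : 0 ≤ 2 * π * m * y := by positivity
        linarith)
      exact mul_le_one₀ (hφ1 y) (Real.exp_nonneg _) this
    · simp
  calc _ = ‖(poincareCoeff m n φ M Q y -
        if Q = 1 ∧ (m : ℤ) = n then ((φ y * Real.exp (-(2 * π * m * y)) : ℝ) : ℂ) else 0) +
        (if Q = 1 ∧ (m : ℤ) = n then ((φ y * Real.exp (-(2 * π * m * y)) : ℝ) : ℂ) else 0)‖ := by
          rw [sub_add_cancel]
    _ ≤ _ := (norm_add_le _ _).trans (by linarith)

/-- Dominated convergence is used twice: inside each Bessel integral, and over the moduli, with the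
majorant that is uniform in the cutoff. For n ≤ 0 the full Bessel integral is 0, so only positive
frequencies remain in the limit. -/
theorem tendsto_poincareCoeff [NeZero Q] {m : ℕ} (hm : 0 < m) (n : ℤ) {φ : ℕ → ℝ → ℝ}
    (hφm : ∀ k, Measurable (φ k)) (hφ1 : ∀ k t, |φ k t| ≤ 1) {δ : ℕ → ℝ} (hδ : ∀ k, 0 < δ k)
    (hφ : ∀ k, ∀ t ≤ δ k, φ k t = 0)
    (hlim : ∀ t, 0 < t → Filter.Tendsto (fun k => φ k t) Filter.atTop (nhds 1))
    {y : ℝ} (hy : 0 < y) :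
    Filter.Tendsto (fun k => poincareCoeff m n (φ k) M Q y) Filter.atTop
      (nhds (if 0 < n then limitCoeff m M Q n.toNat * Real.exp (-(2 * π * n * y)) else 0)) := by
  have hC (c : Modulus M Q) : (0 : ℝ) < Q * (c.1 : ℕ) ^ 2 :=
    mul_pos (Nat.cast_pos.2 (NeZero.pos Q)) (by have := c.1.pos; positivity)
  have e (k : ℕ) : poincareCoeff m n (φ k) M Q y =
      (if Q = 1 ∧ (m : ℤ) = n then ((φ k y * Real.exp (-(2 * π * m * y)) : ℝ) : ℂ) else 0) +
      ∑' c : Modulus M Q, kloostermanSum (c.1 : ℕ) m (n * (Q : ZMod (c.1 : ℕ))⁻¹) *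
      besselIntegral m n (φ k) (Q * (c.1 : ℕ) ^ 2) y := by
    rw [(hasSum_poincareCoeff (M := M) (Q := Q) hm n (hφm k) (hφ1 k) (hδ k) (hφ k) hy).tsum_eq]
    ring
  have hsum := ((summable_norm_kloosterman hm
      fun c : Modulus M Q => (n : ZMod (c.1 : ℕ)) * (Q : ZMod (c.1 : ℕ))⁻¹).mul_left
      besselBound).mul_right (y ^ (-15 / 16 : ℝ))
  have h1 := tendsto_tsum_of_dominated_convergence (𝓕 := Filter.atTop)
    (f := fun k (c : Modulus M Q) => kloostermanSum (c.1 : ℕ) m (n * (Q : ZMod (c.1 : ℕ))⁻¹) *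
      besselIntegral m n (φ k) (Q * (c.1 : ℕ) ^ 2) y)
    (g := fun (c : Modulus M Q) => kloostermanSum (c.1 : ℕ) m (n * (Q : ZMod (c.1 : ℕ))⁻¹) *
      besselIntegral m n (fun _ => 1) (Q * (c.1 : ℕ) ^ 2) y) hsum
    (fun c => (tendsto_besselIntegral m n hφm hφ1 hlim (hC c) hy).const_mul _)
    (Filter.Eventually.of_forall fun k c => by
      rw [norm_mul]
      have := norm_besselIntegral_le hm n (hφ1 k) (hC c) hy
      calc _ ≤ ‖kloostermanSum (c.1 : ℕ) m (n * (Q : ZMod (c.1 : ℕ))⁻¹)‖ *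
            (besselBound * (Q * (c.1 : ℕ) ^ 2 : ℝ) ^ (-15 / 16 : ℝ) * y ^ (-15 / 16 : ℝ)) := by
              gcongr
        _ = _ := by ring)
  have h2 : Filter.Tendsto (fun k => if Q = 1 ∧ (m : ℤ) = n then
      ((φ k y * Real.exp (-(2 * π * m * y)) : ℝ) : ℂ) else 0) Filter.atTop
      (nhds (if Q = 1 ∧ (m : ℤ) = n then (Real.exp (-(2 * π * m * y)) : ℂ) else 0)) := by
    split_ifs
    · have := ((hlim y hy).mul_const (Real.exp (-(2 * π * m * y))))
      rw [one_mul] at this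
      exact (Complex.continuous_ofReal.tendsto _).comp this
    · exact tendsto_const_nhds
  have h3 := h2.add h1
  simp only [← e] at h3
  convert h3 using 2
  rcases lt_or_ge 0 n with hn | hn
  · lift n to ℕ using hn.le
    have hn' : 0 < n := by exact_mod_cast hn
    rw [if_pos hn]
    simp only [Int.cast_natCast, Int.toNat_natCast, Nat.cast_inj]
    have e2 (c : Modulus M Q) := kloosterman_mul_besselIntegral_one hm hn' c hy
    simp only [Int.cast_natCast] at e2
    simp only [e2]
    rw [tsum_mul_left, limitCoeff]
    by_cases hd : Q = 1 ∧ m = n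
    · rw [if_pos hd, if_pos hd, hd.2]
      ring
    · rw [if_neg hd, if_neg hd]
      ring
  · have hd : ¬ (Q = 1 ∧ (m : ℤ) = n) := fun h => by
      have : (0 : ℤ) < m := by exact_mod_cast hm
      omega
    rw [if_neg hn.not_gt, if_neg hd]
    have e2 (c : Modulus M Q) := besselIntegral_one m hm n (hC c) hy
    simp only [e2, if_neg hn.not_gt]
    simp

end FourierLimit

/-! ### The truncations form a Cauchy sequence in the Petersson norm -/

section CauchyOnDomain

/-- The indicator function of `t > 2⁻ᵏ`. -/
def cut (k : ℕ) (t : ℝ) : ℝ := if (1 / 2 : ℝ) ^ k < t then 1 else 0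

theorem measurable_cut (k : ℕ) : Measurable (cut k) :=
  Measurable.ite measurableSet_Ioi measurable_const measurable_const

theorem abs_cut_le (k : ℕ) (t : ℝ) : |cut k t| ≤ 1 := by
  unfold cut; split_ifs <;> simp

theorem cut_eq_zero (k : ℕ) : ∀ t ≤ (1 / 2 : ℝ) ^ k, cut k t = 0 := fun t ht => by
  rw [cut, if_neg ht.not_gt]

theorem half_pow_pos (k : ℕ) : (0 : ℝ) < (1 / 2) ^ k := by positivity

theorem tendsto_cut {t : ℝ} (ht : 0 < t) :
    Filter.Tendsto (fun k => cut k t) Filter.atTop (nhds 1) := by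
  have h := tendsto_pow_atTop_nhds_zero_of_lt_one (r := (1 / 2 : ℝ)) (by norm_num) (by norm_num)
  refine tendsto_const_nhds.congr' ?_
  filter_upwards [h.eventually_lt_const ht] with k hk
  rw [cut, if_pos hk]

theorem slashSum_sub (m : ℕ) {φ ψ : ℝ → ℝ} {δ δ' : ℝ} (hδ : 0 < δ) (hφ : ∀ t ≤ δ, φ t = 0)
    (hδ' : 0 < δ') (hψ : ∀ t ≤ δ', ψ t = 0) (S : Set SL(2, ℤ)) (w : ℍ) :
    slashSum m (fun t => φ t - ψ t) S w = slashSum m φ S w - slashSum m ψ S w := by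
  rw [slashSum, slashSum, slashSum, ← mul_sub,
    ← (summable_slash m hδ hφ S w).tsum_sub (summable_slash m hδ' hψ S w)]
  congr 1
  refine tsum_congr fun σ => ?_
  rw [stripFun_slash_apply, stripFun_slash_apply, stripFun_slash_apply, ← sub_mul]
  congr 1
  unfold stripFun
  split_ifs
  · push_cast; ring
  · simp

theorem poincareSum_one (m : ℕ) (φ : ℝ → ℝ) (N : ℕ) :
    poincareSum m φ N 1 = slashSum m φ (Gamma0 N) := by
  ext z
  have hz : scalePoint 1 z = z := UpperHalfPlane.ext (by simp)
  rw [poincareSum_eq, hz, cosetSet_one, Nat.cast_one, one_mul]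

theorem petersson_two_self (f : ℍ → ℂ) (z : ℍ) :
    petersson 2 f f z = (((‖f z‖ * z.im) ^ 2 : ℝ) : ℂ) := by
  rw [petersson_two_apply, Complex.conj_mul']
  push_cast
  ring

theorem integrableOn_petersson {D : Set ℍ} (hD : volume D < ⊤) {f g : ℍ → ℂ}
    (hf : Measurable f) (hg : Measurable g) {A B : ℝ} (hA : ∀ z, ‖f z‖ * z.im ≤ A)
    (hB : ∀ z, ‖g z‖ * z.im ≤ B) : IntegrableOn (petersson 2 f g) D := by
  refine Measure.integrableOn_of_bounded (M := A * B) hD.ne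
    (measurable_petersson_two hf hg).aestronglyMeasurable (Filter.Eventually.of_forall fun z => ?_)
  rw [norm_petersson_two]
  have h1 : 0 ≤ ‖f z‖ * z.im := mul_nonneg (norm_nonneg _) z.im_pos.le
  have h2 : 0 ≤ ‖g z‖ * z.im := mul_nonneg (norm_nonneg _) z.im_pos.le
  exact mul_le_mul (hA z) (hB z) h2 (h1.trans (hA z))

/-- The square of the Petersson norm, as an extended real number. -/
def normSqOn (D : Set ℍ) (f : ℍ → ℂ) : ENNReal :=
  ∫⁻ z in D, ENNReal.ofReal ((‖f z‖ * z.im) ^ 2)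

theorem normSqOn_eq {D : Set ℍ} {f : ℍ → ℂ} (hi : IntegrableOn (petersson 2 f f) D) :
    normSqOn D f = ENNReal.ofReal ‖∫ z in D, petersson 2 f f z‖ := by
  have e : (fun z => petersson 2 f f z) = fun z => (((‖f z‖ * z.im) ^ 2 : ℝ) : ℂ) :=
    funext (petersson_two_self f)
  have hi' : IntegrableOn (fun z => (‖f z‖ * z.im) ^ 2) D := by
    have := hi.re
    refine this.congr (Filter.Eventually.of_forall fun z => ?_)
    simp only [petersson_two_self]
    exact Complex.ofReal_re _
  have hnn : 0 ≤ ∫ z in D, (‖f z‖ * z.im) ^ 2 := integral_nonneg fun z => sq_nonneg _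
  rw [normSqOn, ← ofReal_integral_eq_lintegral_ofReal hi'
    (Filter.Eventually.of_forall fun z => sq_nonneg _), e, integral_complex_ofReal,
    Complex.norm_real, Real.norm_of_nonneg hnn]

variable {N : ℕ} {D : Set ℍ}

/-- The primitive of y^(-15/16) is 16 y^(1/16), and b ≤ b^(1/16) for b ≤ 1. -/
theorem integral_Ioc_one_add_mul_rpow_le {K b : ℝ} (hb : 0 < b) (hb1 : b ≤ 1) :
    IntegrableOn (fun y : ℝ => 1 + K * y ^ (-15 / 16 : ℝ)) (Set.Ioc 0 b) ∧
    ∫ y in Set.Ioc 0 b, (1 + K * y ^ (-15 / 16 : ℝ)) ≤ (1 + 16 * K) * b ^ (1 / 16 : ℝ) := by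
  have hi : IntervalIntegrable (fun y : ℝ => K * y ^ (-15 / 16 : ℝ)) volume 0 b :=
    (intervalIntegral.intervalIntegrable_rpow' (by norm_num)).const_mul K
  have hi1 : IntervalIntegrable (fun _ : ℝ => (1 : ℝ)) volume 0 b := intervalIntegrable_const
  refine ⟨(intervalIntegrable_iff_integrableOn_Ioc_of_le hb.le).1 (hi1.add hi), ?_⟩
  rw [← intervalIntegral.integral_of_le hb.le, intervalIntegral.integral_add hi1 hi,
    intervalIntegral.integral_const_mul, integral_rpow (Or.inl (by norm_num))]
  have e : (-15 / 16 + 1 : ℝ) = 1 / 16 := by norm_num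
  rw [e, Real.zero_rpow (by norm_num)]
  have : b ≤ b ^ (1 / 16 : ℝ) := by
    conv_lhs => rw [← Real.rpow_one b]
    exact Real.rpow_le_rpow_of_exponent_ge hb hb1 (by norm_num)
  simp
  linarith

/-- The difference is the series with cutoff ψ = 1 on (2⁻ᵏ, 2⁻ʲ] and 0 elsewhere. Unfolding it
against itself leaves the integral of ψ(y) e^(-2πmy) times its own m-th coefficient, which is at
most 1 + K y^(-15/16). The rate is geometric, so almost everywhere convergence will need no
subsequence. -/
theorem exists_normSqOn_sub_le (hN : 0 < N) (hD : IsGamma0FundamentalDomain N D) {m : ℕ}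
    (hm : 0 < m) : ∃ K : ℝ, 0 ≤ K ∧ ∀ j k : ℕ, j ≤ k →
      normSqOn D (fun z => slashSum m (cut k) (Gamma0 N) z - slashSum m (cut j) (Gamma0 N) z) ≤
        ENNReal.ofReal (K * ((1 / 2) ^ j) ^ (1 / 16 : ℝ)) := by
  obtain ⟨K, hK0, hK⟩ := exists_norm_poincareCoeff_le (M := N) (Q := 1) hm
  refine ⟨1 + 16 * K, by positivity, fun j k hjk => ?_⟩
  set ψ : ℝ → ℝ := fun t => cut k t - cut j t with hψ
  have hle : (1 / 2 : ℝ) ^ k ≤ (1 / 2) ^ j :=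
    pow_le_pow_of_le_one (by norm_num) (by norm_num) hjk
  have hψm : Measurable ψ := (measurable_cut k).sub (measurable_cut j)
  have hψ0 : ∀ t ≤ (1 / 2 : ℝ) ^ k, ψ t = 0 := fun t ht => by
    simp only [hψ]; rw [cut_eq_zero k t ht, cut_eq_zero j t (ht.trans hle), sub_zero]
  have hψv (t : ℝ) : ψ t = 0 ∨ (ψ t = 1 ∧ t ≤ (1 / 2) ^ j) := by
    simp only [hψ, cut]
    split_ifs with h1 h2 h2
    · simp
    · right; exact ⟨by simp, not_lt.1 h2⟩
    · exact absurd (hle.trans_lt h2) h1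
    · simp
  have hψ1 (t : ℝ) : |ψ t| ≤ 1 := by rcases hψv t with h | ⟨h, -⟩ <;> simp [h]
  have e : (fun z => slashSum m (cut k) (Gamma0 N) z - slashSum m (cut j) (Gamma0 N) z) =
      slashSum m ψ (Gamma0 N) := by
    ext z
    rw [slashSum_sub m (half_pow_pos k) (cut_eq_zero k) (half_pow_pos j) (cut_eq_zero j)]
  obtain ⟨C, hC⟩ := exists_norm_slashSum_mul_im_le hm hψ1 (half_pow_pos k) hψ0
  have hmeas := measurable_slashSum m hψm (half_pow_pos k) hψ0 (Gamma0 N : Set SL(2, ℤ))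
  rw [e, normSqOn_eq (integrableOn_petersson (hD.volume_lt_top hN) hmeas hmeas (hC _) (hC _)),
    integral_petersson_slashSum hD hm hψm hψ1 (half_pow_pos k) hψ0 hmeas (hC _)
      fun γ hγ => slashSum_Gamma0_slash m ψ hγ]
  refine ENNReal.ofReal_le_ofReal ?_
  obtain ⟨hi, hib⟩ := integral_Ioc_one_add_mul_rpow_le (K := K) (half_pow_pos j)
    (pow_le_one₀ (n := j) (by norm_num) (by norm_num : (1 / 2 : ℝ) ≤ 1))
  refine le_trans ?_ hib
  rw [← integral_indicator measurableSet_Ioc]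
  have hib' : Integrable ((Set.Ioc 0 ((1 / 2 : ℝ) ^ j)).indicator
      fun y : ℝ => 1 + K * y ^ (-15 / 16 : ℝ)) := (integrable_indicator_iff measurableSet_Ioc).2 hi
  refine (norm_integral_le_of_norm_le hib'.integrableOn ?_).trans
    (setIntegral_le_integral hib' (Filter.Eventually.of_forall fun y => ?_))
  · refine (ae_restrict_iff' measurableSet_Ioi).2 (Filter.Eventually.of_forall fun y hy => ?_)
    have hy' : 0 < y := hy
    rw [norm_mul]
    rcases hψv y with h | ⟨h, hyj⟩
    · rw [h]
      simp only [zero_mul, Complex.ofReal_zero, norm_zero]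
      exact Set.indicator_nonneg (fun y hy => by have := hy.1; positivity) _
    · rw [Set.indicator_of_mem (by exact ⟨hy', hyj⟩), h, one_mul, Complex.norm_real,
        Real.norm_of_nonneg (Real.exp_nonneg _)]
      have h2 := hK m ψ hψm hψ1 _ (half_pow_pos k) hψ0 y hy'
      rw [poincareCoeff, poincareSum_one] at h2
      have h3 : Real.exp (-(2 * π * m * y)) ≤ 1 := Real.exp_le_one_iff.2 (by
        have : 0 ≤ 2 * π * m * y := by positivity
        linarith)
      exact (mul_le_of_le_one_left (norm_nonneg _) h3).trans h2
  · exact Set.indicator_nonneg (fun y hy => by have := hy.1; positivity) _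

end CauchyOnDomain

/-! ### Parseval's identity and lower semicontinuity -/

section Parseval

theorem integral_fourier_unit (u : ℝ → ℂ) (n : ℤ) :
    fourierCoeffOn (zero_lt_one' ℝ) u n = ∫ x in (0 : ℝ)..1, u x * expTwoPiI (-(n * x)) := by
  rw [fourierCoeffOn_eq_integral]
  simp only [sub_zero, div_one, one_smul]
  congr 1
  ext x
  rw [fourier_coe_apply, smul_eq_mul, mul_comm, expTwoPiI]
  congr 2
  push_cast
  ring

/-- Parseval's identity for bounded measurable functions on the unit interval. -/
theorem lintegral_sq_eq_tsum {u : ℝ → ℂ} (hu : Measurable u) {B : ℝ} (hB : ∀ x, ‖u x‖ ≤ B) :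
    ∫⁻ x in Set.Ioc (0 : ℝ) 1, ENNReal.ofReal (‖u x‖ ^ 2) =
      ∑' n : ℤ, ENNReal.ofReal (‖∫ x in (0 : ℝ)..1, u x * expTwoPiI (-(n * x))‖ ^ 2) := by
  have hL : MemLp u 2 (volume.restrict (Set.Ioc (0 : ℝ) 1)) :=
    MemLp.of_bound hu.aestronglyMeasurable B (Filter.Eventually.of_forall hB)
  have h := hasSum_sq_fourierCoeffOn (zero_lt_one' ℝ) hL
  simp only [integral_fourier_unit, sub_zero, inv_one, one_smul] at h
  have hi : Integrable (fun x => ‖u x‖ ^ 2) (volume.restrict (Set.Ioc (0 : ℝ) 1)) :=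
    hL.integrable_norm_pow two_ne_zero
  rw [← ofReal_integral_eq_lintegral_ofReal hi (Filter.Eventually.of_forall fun x => sq_nonneg _),
    ← intervalIntegral.integral_of_le zero_le_one, ← h.tsum_eq,
    ENNReal.ofReal_tsum_of_nonneg (fun n => sq_nonneg _) h.summable]

/-- If the Fourier coefficients converge, then the `L²` norms on the unit interval are
lower semicontinuous. -/
theorem lintegral_sq_le_liminf {u : ℝ → ℂ} (hu : Measurable u) {B : ℝ} (hB : ∀ x, ‖u x‖ ≤ B)
    {v : ℕ → ℝ → ℂ} (hv : ∀ k, Measurable (v k)) {B' : ℕ → ℝ} (hB' : ∀ k x, ‖v k x‖ ≤ B' k)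
    (hlim : ∀ n : ℤ, Filter.Tendsto
      (fun k => ∫ x in (0 : ℝ)..1, v k x * expTwoPiI (-(n * x))) Filter.atTop
      (nhds (∫ x in (0 : ℝ)..1, u x * expTwoPiI (-(n * x))))) :
    ∫⁻ x in Set.Ioc (0 : ℝ) 1, ENNReal.ofReal (‖u x‖ ^ 2) ≤
      Filter.liminf (fun k => ∫⁻ x in Set.Ioc (0 : ℝ) 1, ENNReal.ofReal (‖v k x‖ ^ 2))
        Filter.atTop := by
  rw [lintegral_sq_eq_tsum hu hB]
  simp only [fun k => lintegral_sq_eq_tsum (hv k) (hB' k)]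
  -- As an integral for the counting measure, the sum over frequencies is subject to Fatou's lemma.
  simp only [← lintegral_count]
  refine le_trans (le_of_eq ?_) (lintegral_liminf_le fun k => measurable_of_countable _)
  congr 1
  ext n
  exact ((ENNReal.continuous_ofReal.tendsto _).comp ((hlim n).norm.pow 2)).liminf_eq.symm

end Parseval

/-! ### Exponential series with coefficients of linear growth -/

section ExpSum

/-- The sum of the series `∑ aₙ e^{2iπnz}`. -/
def expSum (a : ℕ → ℂ) (z : ℂ) : ℂ := ∑' n : ℕ, a n * expTwoPiI (n * z)

variable {a : ℕ → ℂ} {A : ℝ}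

theorem summable_expSum_majorant (A : ℝ) {y : ℝ} (hy : 0 < y) :
    Summable fun n : ℕ => A * (n + 1) * Real.exp (-(2 * π * (n * y))) := by
  have hr : ‖Real.exp (-(2 * π * y))‖ < 1 := by
    rw [Real.norm_of_nonneg (Real.exp_nonneg _), Real.exp_lt_one_iff]
    have : 0 < 2 * π * y := by positivity
    linarith
  have h1 := summable_pow_mul_geometric_of_norm_lt_one 1 hr
  have h0 := summable_geometric_of_norm_lt_one hr
  refine ((h1.add h0).mul_left A).congr fun n => ?_
  have : Real.exp (-(2 * π * (n * y))) = Real.exp (-(2 * π * y)) ^ n := by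
    rw [← Real.exp_nat_mul]
    congr 1
    ring
  rw [this]
  ring

theorem norm_expSum_term_le (ha : ∀ n, ‖a n‖ ≤ A * (n + 1)) {y : ℝ} {z : ℂ} (hz : y ≤ z.im)
    (n : ℕ) : ‖a n * expTwoPiI (n * z)‖ ≤ A * (n + 1) * Real.exp (-(2 * π * (n * y))) := by
  rw [norm_mul, norm_expTwoPiI]
  have h1 : ((n : ℂ) * z).im = n * z.im := by simp
  rw [h1]
  refine mul_le_mul (ha n) (Real.exp_le_exp.2 ?_) (Real.exp_nonneg _) ((norm_nonneg _).trans (ha n))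
  have : (n : ℝ) * y ≤ n * z.im := by gcongr
  nlinarith [Real.pi_pos]

theorem differentiableOn_expSum (ha : ∀ n, ‖a n‖ ≤ A * (n + 1)) :
    DifferentiableOn ℂ (expSum a) {z | 0 < z.im} := by
  intro z hz
  have hz' : 0 < z.im := hz
  have hopen : IsOpen {w : ℂ | z.im / 2 < w.im} :=
    isOpen_lt continuous_const Complex.continuous_im
  have h := Complex.differentiableOn_tsum_of_summable_norm
    (F := fun (n : ℕ) (w : ℂ) => a n * expTwoPiI (n * w))
    (summable_expSum_majorant A (half_pos hz')) (fun n => by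
      unfold expTwoPiI
      fun_prop) hopen
    fun n w hw => norm_expSum_term_le ha (le_of_lt hw) n
  exact ((h z (by simpa using hz')).differentiableAt
    (hopen.mem_nhds (by simpa using hz'))).differentiableWithinAt

theorem norm_expSum_le (ha : ∀ n, ‖a n‖ ≤ A * (n + 1)) {y : ℝ} (hy : 0 < y) {z : ℂ}
    (hz : y ≤ z.im) :
    ‖expSum a z‖ ≤ ∑' n : ℕ, A * (n + 1) * Real.exp (-(2 * π * (n * y))) :=
  tsum_of_norm_bounded (summable_expSum_majorant A hy).hasSum (norm_expSum_term_le ha hz)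

theorem integral_expSum (ha : ∀ n, ‖a n‖ ≤ A * (n + 1)) (n : ℤ) {y : ℝ} (hy : 0 < y) :
    ∫ x in (0 : ℝ)..1, expSum a (x + y * Complex.I) * expTwoPiI (-(n * x)) =
      if 0 ≤ n then a n.toNat * Real.exp (-(2 * π * n * y)) else 0 := by
  have hs := hasSum_integral_of_summable_integral_norm (μ := volume.restrict (Set.Ioc (0 : ℝ) 1))
    (F := fun (k : ℕ) (x : ℝ) => a k * expTwoPiI (k * (x + y * Complex.I)) * expTwoPiI (-(n * x)))
    (fun k => (Continuous.integrableOn_Icc (a := 0) (b := 1) (by fun_prop)).mono_set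
      Set.Ioc_subset_Icc_self) (by
      refine Summable.of_nonneg_of_le (fun k => integral_nonneg fun x => norm_nonneg _) (fun k => ?_)
        (summable_expSum_majorant A hy)
      refine (integral_mono_of_nonneg (Filter.Eventually.of_forall fun x => norm_nonneg _)
        (integrable_const (A * (k + 1) * Real.exp (-(2 * π * (k * y)))))
        (Filter.Eventually.of_forall fun x => ?_)).trans (by simp)
      change ‖a k * expTwoPiI (k * (x + y * Complex.I)) * expTwoPiI (-(n * x))‖ ≤ _
      rw [norm_mul, norm_expTwoPiI_neg_intCast_mul, mul_one]
      exact norm_expSum_term_le ha (by simp) k)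
  have h1 (x : ℝ) : ∑' k : ℕ, a k * expTwoPiI (k * (x + y * Complex.I)) * expTwoPiI (-(n * x)) =
      expSum a (x + y * Complex.I) * expTwoPiI (-(n * x)) := by
    rw [tsum_mul_right]; rfl
  simp only [h1] at hs
  have h2 (k : ℕ) : ∫ x in Set.Ioc (0 : ℝ) 1, a k * expTwoPiI (k * (x + y * Complex.I)) *
      expTwoPiI (-(n * x)) = if (k : ℤ) = n then a k * Real.exp (-(2 * π * k * y)) else 0 := by
    simp only [mul_assoc (a k)]
    rw [integral_const_mul, ← intervalIntegral.integral_of_le zero_le_one, integral_expTwoPiI_line]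
    split_ifs <;> simp
  simp only [h2] at hs
  rw [intervalIntegral.integral_of_le zero_le_one]
  refine hs.unique ?_
  split_ifs with hn
  · lift n to ℕ using hn
    have e : (fun k : ℕ => if (k : ℤ) = (n : ℤ) then a k * (Real.exp (-(2 * π * k * y)) : ℂ) else 0)
        = fun k => if k = n then a n * (Real.exp (-(2 * π * n * y)) : ℂ) else 0 := by
      ext k
      simp only [Nat.cast_inj]
      split_ifs with h
      · rw [h]
      · rfl
    rw [e]
    exact hasSum_ite_eq n _
  · have : (fun k : ℕ => if (k : ℤ) = n then a k * (Real.exp (-(2 * π * k * y)) : ℂ) else 0) =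
        fun _ => 0 := by
      ext k
      rw [if_neg]
      omega
    rw [this]
    exact hasSum_zero

end ExpSum

/-! ### The holomorphic limit and its distance to the truncations -/

section LimitForm

theorem SL_slash_two_apply (f : ℍ → ℂ) (σ : SL(2, ℤ)) (w : ℍ) :
    (f ∣[(2 : ℤ)] σ) w = f (σ • w) * (((σ 1 0 : ℂ) * w + (σ 1 1 : ℂ)) ^ 2)⁻¹ := by
  rw [ModularForm.SL_slash_apply, ModularGroup.denom_apply]
  rfl

/-- Allows almost everywhere equal continuous functions to be identified. -/
instance isOpenPosMeasure_volume : (volume : Measure ℍ).IsOpenPosMeasure := by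
  constructor
  intro U hU hne h0
  rw [volume_eq_lintegral, lintegral_eq_zero_iff (by fun_prop)] at h0
  have hopen : IsOpen (UpperHalfPlane.coe '' U) := isOpenEmbedding_coe.isOpenMap U hU
  have h1 : ∀ᵐ z ∂(volume.restrict (UpperHalfPlane.coe '' U)), z ∈ UpperHalfPlane.coe '' U :=
    ae_restrict_mem hopen.measurableSet
  have h2 : ∀ᵐ z ∂((volume : Measure ℂ).restrict (UpperHalfPlane.coe '' U)), False := by
    filter_upwards [h0, h1] with z hz hzU
    obtain ⟨w, -, rfl⟩ := hzU
    have : (1 / ‖(w : ℂ).im‖₊) ^ 2 = 0 := by simpa using hz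
    simp at this
    exact w.im_ne_zero this
  rw [Filter.eventually_false_iff_eq_bot, ae_eq_bot, Measure.restrict_eq_zero] at h2
  exact (hopen.measure_pos volume (hne.image _)).ne' h2

variable {m N : ℕ}

/-- The Fourier coefficients of the limit form. -/
def formCoeff (m N n : ℕ) : ℂ := if n = 0 then 0 else limitCoeff m N 1 n

/-- Take y = 1/n in the uniform bound on a_n e^(-2πny): the exponential costs e^(2π), and y^(-15/16)
≤ n. -/
theorem exists_norm_formCoeff_le (hm : 0 < m) (N : ℕ) :
    ∃ A : ℝ, ∀ n, ‖formCoeff m N n‖ ≤ A * (n + 1) := by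
  obtain ⟨K, hK0, hK⟩ := exists_norm_poincareCoeff_le (M := N) (Q := 1) hm
  refine ⟨Real.exp (2 * π) * (1 + K), fun n => ?_⟩
  unfold formCoeff
  split_ifs with hn
  · rw [norm_zero]; positivity
  · have hn' : 0 < n := Nat.pos_of_ne_zero hn
    have hnr : (1 : ℝ) ≤ n := by exact_mod_cast hn'
    have hy : (0 : ℝ) < 1 / n := by positivity
    have h := tendsto_poincareCoeff (M := N) (Q := 1) hm n measurable_cut abs_cut_le half_pow_pos
      cut_eq_zero (fun t ht => tendsto_cut ht) hy
    rw [if_pos (by exact_mod_cast hn'), Int.toNat_natCast] at h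
    have h2 := le_of_tendsto h.norm (Filter.Eventually.of_forall fun k =>
      hK n _ (measurable_cut k) (abs_cut_le k) _ (half_pow_pos k) (cut_eq_zero k) _ hy)
    rw [norm_mul, Complex.norm_real, Real.norm_of_nonneg (Real.exp_nonneg _)] at h2
    have e1 : -(2 * π * ((n : ℤ) : ℝ) * (1 / n)) = -(2 * π) := by
      push_cast
      field_simp
    have e2 : (1 / n : ℝ) ^ (-15 / 16 : ℝ) ≤ n := by
      rw [one_div, Real.inv_rpow (by positivity), ← Real.rpow_neg (by positivity)]
      conv_rhs => rw [← Real.rpow_one (n : ℝ)]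
      exact Real.rpow_le_rpow_of_exponent_le hnr (by norm_num)
    rw [e1, Real.exp_neg, ← div_eq_mul_inv, div_le_iff₀ (Real.exp_pos _)] at h2
    refine h2.trans ?_
    rw [mul_comm, mul_assoc]
    refine mul_le_mul_of_nonneg_left ?_ (Real.exp_nonneg _)
    nlinarith [mul_le_mul_of_nonneg_left e2 hK0]

/-- The limit of the truncated Poincaré series. -/
def limitForm (m N : ℕ) (z : ℍ) : ℂ := expSum (formCoeff m N) z

theorem continuous_limitForm (hm : 0 < m) (N : ℕ) : Continuous (limitForm m N) := by
  obtain ⟨A, hA⟩ := exists_norm_formCoeff_le hm N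
  have h := (differentiableOn_expSum hA).continuousOn
  exact h.comp_continuous continuous_coe fun z => z.im_pos

theorem limitForm_linePoint {x y : ℝ} (hy : 0 < y) :
    limitForm m N (linePoint x y) = expSum (formCoeff m N) (x + y * Complex.I) := by
  rw [limitForm, coe_linePoint hy]

theorem integral_limitForm (hm : 0 < m) (N : ℕ) (n : ℤ) {y : ℝ} (hy : 0 < y) :
    ∫ x in (0 : ℝ)..1, limitForm m N (linePoint x y) * expTwoPiI (-(n * x)) =
      if 0 < n then limitCoeff m N 1 n.toNat * Real.exp (-(2 * π * n * y)) else 0 := by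
  obtain ⟨A, hA⟩ := exists_norm_formCoeff_le hm N
  simp only [limitForm_linePoint hy]
  rw [integral_expSum hA n hy]
  rcases lt_trichotomy n 0 with h | h | h
  · rw [if_neg h.not_ge, if_neg h.not_gt]
  · simp [h, formCoeff]
  · have : n.toNat ≠ 0 := by omega
    rw [if_pos h.le, if_pos h, formCoeff, if_neg this]

/-- The rectangle `0 < x ≤ 1`, `y₁ ≤ y ≤ y₂`. -/
def rect (y₁ y₂ : ℝ) : Set ℍ := {z | (0 < z.re ∧ z.re ≤ 1) ∧ y₁ ≤ z.im ∧ z.im ≤ y₂}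

theorem measurableSet_rect (y₁ y₂ : ℝ) : MeasurableSet (rect y₁ y₂) :=
  ((measurableSet_lt measurable_const continuous_re.measurable).inter
    (measurableSet_le continuous_re.measurable measurable_const)).inter
  ((measurableSet_le measurable_const continuous_im.measurable).inter
    (measurableSet_le continuous_im.measurable measurable_const))

theorem lintegral_rect {f : ℍ → ℂ} (hf : Measurable f) {y₁ : ℝ} (hy : 0 < y₁) (y₂ : ℝ) :
    ∫⁻ z in rect y₁ y₂, ENNReal.ofReal ((‖f z‖ * z.im) ^ 2) =
      ∫⁻ y in Set.Icc y₁ y₂, ∫⁻ x in Set.Ioc (0 : ℝ) 1, ENNReal.ofReal (‖f (linePoint x y)‖ ^ 2) := by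
  have hm : Measurable fun z : ℍ => ENNReal.ofReal ((‖f z‖ * z.im) ^ 2) :=
    ((hf.norm.mul continuous_im.measurable).pow_const 2).ennreal_ofReal
  rw [← lintegral_indicator (measurableSet_rect _ _),
    lintegral_eq_lintegral_linePoint (hm.indicator (measurableSet_rect _ _)),
    ← lintegral_indicator measurableSet_Ioi, ← lintegral_indicator measurableSet_Icc]
  congr 1
  ext y
  by_cases hyI : y ∈ Set.Icc y₁ y₂
  · have hy0 : 0 < y := hy.trans_le hyI.1
    rw [Set.indicator_of_mem (by exact hy0), Set.indicator_of_mem hyI,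
      ← lintegral_indicator measurableSet_Ioc]
    congr 1
    ext x
    by_cases hx : x ∈ Set.Ioc (0 : ℝ) 1
    · have hmem : linePoint x y ∈ rect y₁ y₂ := by
        refine ⟨?_, ?_⟩
        · rw [linePoint_re hy0]; exact hx
        · rw [linePoint_im hy0]; exact hyI
      rw [Set.indicator_of_mem hx, Set.indicator_of_mem hmem, linePoint_im hy0,
        ← ENNReal.ofReal_mul (by positivity)]
      congr 1
      field_simp
    · have hmem : linePoint x y ∉ rect y₁ y₂ := fun h => hx (by
        have := h.1
        rwa [linePoint_re hy0] at this)
      rw [Set.indicator_of_notMem hx, Set.indicator_of_notMem hmem, mul_zero]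
  · rw [Set.indicator_of_notMem hyI]
    by_cases hy0 : y ∈ Set.Ioi (0 : ℝ)
    · have hy0' : 0 < y := hy0
      have : ∀ x, (rect y₁ y₂).indicator (fun z : ℍ => ENNReal.ofReal ((‖f z‖ * z.im) ^ 2))
          (linePoint x y) = 0 := fun x => by
        refine Set.indicator_of_notMem (fun h => hyI ?_) _
        have := h.2
        rwa [linePoint_im hy0'] at this
      rw [Set.indicator_of_mem hy0]
      simp [this]
    · rw [Set.indicator_of_notMem hy0]

/-- Points are moved into a bounded rectangle by boundedly many elements of `Γ₀(N)`. -/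
theorem exists_encard_Gamma0_le {A K : Set ℍ} (hK : IsCompact K) (hA : A ⊆ K) : ∃ C : ℕ, ∀ z : ℍ,
    {γ : Gamma0 N | (γ : SL(2, ℤ)) • z ∈ A}.encard ≤ C := by
  obtain ⟨C, hC⟩ := exists_encard_smul_mem_le hK
  refine ⟨C, fun z => le_trans ?_ (hC z)⟩
  exact Set.encard_le_encard_of_injOn (f := Subtype.val) (fun γ hγ => hA hγ)
    Subtype.val_injective.injOn

theorem rect_subset (y₁ y₂ : ℝ) : rect y₁ y₂ ⊆ {z : ℍ | |z.re| ≤ 1 ∧ y₁ ≤ z.im ∧ z.im ≤ y₂} :=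
  fun _ hz => ⟨abs_le.2 ⟨by linarith [hz.1.1], hz.1.2⟩, hz.2⟩

variable {D : Set ℍ}

theorem normSq_invariant {f : ℍ → ℂ} {γ : SL(2, ℤ)} (h : f ∣[(2 : ℤ)] γ = f) (z : ℍ) :
    (‖f (γ • z)‖ * (γ • z).im) ^ 2 = (‖f z‖ * z.im) ^ 2 := by
  have h1 := petersson_slash_SL 2 f f γ z
  rw [h, petersson_two_self, petersson_two_self] at h1
  exact_mod_cast h1.symm

theorem sub_slash_eq {f g : ℍ → ℂ} {γ : SL(2, ℤ)} (hf : f ∣[(2 : ℤ)] γ = f)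
    (hg : g ∣[(2 : ℤ)] γ = g) : (fun z => f z - g z) ∣[(2 : ℤ)] γ = fun z => f z - g z := by
  ext z
  rw [SL_slash_two_apply]
  have h1 := congrFun hf z
  have h2 := congrFun hg z
  rw [SL_slash_two_apply] at h1 h2
  linear_combination h1 - h2

theorem lintegral_subset_le (hD : IsGamma0FundamentalDomain N D) {A : Set ℍ}
    (hA : MeasurableSet A) {C : ℕ}
    (hC : ∀ z : ℍ, {γ : Gamma0 N | (γ : SL(2, ℤ)) • z ∈ A}.encard ≤ C) {f : ℍ → ℂ}
    (hf : Measurable f) (hinv : ∀ γ ∈ Gamma0 N, f ∣[(2 : ℤ)] γ = f) :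
    ∫⁻ z in A, ENNReal.ofReal ((‖f z‖ * z.im) ^ 2) ≤ C * normSqOn D f :=
  hD.setLIntegral_le hA hC ((hf.norm.mul continuous_im.measurable).pow_const 2).ennreal_ofReal
    fun γ hγ z => by rw [normSq_invariant (hinv γ hγ)]

theorem measurable_slashSum_cut (m : ℕ) (k : ℕ) (S : Set SL(2, ℤ)) :
    Measurable (slashSum m (cut k) S) :=
  measurable_slashSum m (measurable_cut k) (half_pow_pos k) (cut_eq_zero k) S

theorem exists_norm_slashSum_cut_le (hm : 0 < m) (k : ℕ) :
    ∃ C : ℝ, ∀ S w, ‖slashSum m (cut k) S w‖ * w.im ≤ C :=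
  exists_norm_slashSum_mul_im_le hm (abs_cut_le k) (half_pow_pos k) (cut_eq_zero k)

/-- On a line only the Fourier coefficients of the truncations are known to converge, to those of
the limit form; lower semicontinuity of the L² norm turns this into an inequality. -/
theorem lintegral_line_sub_le (hm : 0 < m) (N j : ℕ) {y : ℝ} (hy : 0 < y) :
    ∫⁻ x in Set.Ioc (0 : ℝ) 1, ENNReal.ofReal (‖slashSum m (cut j) (Gamma0 N) (linePoint x y) -
      limitForm m N (linePoint x y)‖ ^ 2) ≤
    Filter.liminf (fun k => ∫⁻ x in Set.Ioc (0 : ℝ) 1, ENNReal.ofReal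
      (‖slashSum m (cut k) (Gamma0 N) (linePoint x y) -
        slashSum m (cut j) (Gamma0 N) (linePoint x y)‖ ^ 2)) Filter.atTop := by
  obtain ⟨A, hA⟩ := exists_norm_formCoeff_le hm N
  choose C hC using fun k => exists_norm_slashSum_cut_le hm k
  have hP (k : ℕ) : Measurable fun x : ℝ => slashSum m (cut k) (Gamma0 N) (linePoint x y) :=
    (measurable_slashSum_cut m k _).comp (measurable_linePoint_left y)
  have hG : Measurable fun x : ℝ => limitForm m N (linePoint x y) :=
    (continuous_limitForm hm N).measurable.comp (measurable_linePoint_left y)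
  have hPb (k : ℕ) (x : ℝ) : ‖slashSum m (cut k) (Gamma0 N) (linePoint x y)‖ ≤ C k / y := by
    rw [le_div_iff₀ hy]
    have := hC k (Gamma0 N) (linePoint x y)
    rwa [linePoint_im hy] at this
  have hGb (x : ℝ) : ‖limitForm m N (linePoint x y)‖ ≤
      ∑' n : ℕ, A * (n + 1) * Real.exp (-(2 * π * (n * y))) := by
    rw [limitForm_linePoint hy]
    exact norm_expSum_le hA hy (by simp)
  have hPi (k : ℕ) (n : ℤ) : IntervalIntegrable (fun x =>
      slashSum m (cut k) (Gamma0 N) (linePoint x y) * expTwoPiI (-(n * x))) volume 0 1 :=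
    intervalIntegrable_linePoint (measurable_slashSum_cut m k _) (hC k _) n hy 0 1
  have hGi (n : ℤ) : IntervalIntegrable (fun x =>
      limitForm m N (linePoint x y) * expTwoPiI (-(n * x))) volume 0 1 := by
    refine Continuous.intervalIntegrable (Continuous.mul ?_ (by fun_prop)) _ _
    refine (continuous_limitForm hm N).comp ?_
    rw [isOpenEmbedding_coe.isInducing.continuous_iff]
    have : (UpperHalfPlane.coe ∘ fun x : ℝ => linePoint x y) = fun x : ℝ => x + y * Complex.I :=
      funext fun x => coe_linePoint hy
    rw [this]
    fun_prop
  have hrev : ∀ k x, ‖slashSum m (cut k) (Gamma0 N) (linePoint x y) -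
        slashSum m (cut j) (Gamma0 N) (linePoint x y)‖ =
      ‖slashSum m (cut j) (Gamma0 N) (linePoint x y) -
        slashSum m (cut k) (Gamma0 N) (linePoint x y)‖ := fun k x => norm_sub_rev _ _
  simp only [hrev]
  refine lintegral_sq_le_liminf ((hP j).sub hG)
    (fun x => (norm_sub_le _ _).trans (add_le_add (hPb j x) (hGb x)))
    (fun k => (hP j).sub (hP k))
    (fun k x => (norm_sub_le _ _).trans (add_le_add (hPb j x) (hPb k x))) fun n => ?_
  simp only [Pi.sub_apply, sub_mul]
  rw [intervalIntegral.integral_sub (hPi j n) (hGi n), integral_limitForm hm N n hy]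
  simp only [fun k => intervalIntegral.integral_sub (hPi j n) (hPi k n)]
  refine Filter.Tendsto.const_sub _ ?_
  have h := tendsto_poincareCoeff (M := N) (Q := 1) hm n measurable_cut abs_cut_le half_pow_pos
      cut_eq_zero (fun t ht => tendsto_cut ht) hy
  simp only [poincareCoeff, poincareSum_one] at h
  exact h

end LimitForm

/-! ### Almost everywhere convergence and modularity of the limit -/

section AlmostEverywhere

variable {m N : ℕ} {D : Set ℍ}

/-- Integrate `lintegral_line_sub_le` over the heights, apply Fatou once more, and compare the
rectangle with D by bounded multiplicity. -/
theorem lintegral_rect_sub_le (hD : IsGamma0FundamentalDomain N D) (hm : 0 < m) {K : ℝ}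
    (hK : ∀ j k : ℕ, j ≤ k →
      normSqOn D (fun z => slashSum m (cut k) (Gamma0 N) z - slashSum m (cut j) (Gamma0 N) z) ≤
        ENNReal.ofReal (K * ((1 / 2) ^ j) ^ (1 / 16 : ℝ))) {y₁ : ℝ} (hy : 0 < y₁) (y₂ : ℝ) :
    ∃ C : ℕ, ∀ j, ∫⁻ z in rect y₁ y₂, ENNReal.ofReal
      ((‖slashSum m (cut j) (Gamma0 N) z - limitForm m N z‖ * z.im) ^ 2) ≤
        C * ENNReal.ofReal (K * ((1 / 2) ^ j) ^ (1 / 16 : ℝ)) := by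
  obtain ⟨C, hC⟩ := exists_encard_Gamma0_le (N := N) (isCompact_rectangle 1 y₂ hy)
    (rect_subset y₁ y₂)
  refine ⟨C, fun j => ?_⟩
  have hmeas (k : ℕ) := measurable_slashSum_cut m k (Gamma0 N : Set SL(2, ℤ))
  rw [lintegral_rect (f := fun z => slashSum m (cut j) (Gamma0 N) z - limitForm m N z)
    ((hmeas j).sub (continuous_limitForm hm N).measurable) hy]
  have h1 : ∫⁻ y in Set.Icc y₁ y₂, ∫⁻ x in Set.Ioc (0 : ℝ) 1, ENNReal.ofReal
      (‖slashSum m (cut j) (Gamma0 N) (linePoint x y) - limitForm m N (linePoint x y)‖ ^ 2) ≤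
      ∫⁻ y in Set.Icc y₁ y₂, Filter.liminf (fun k => ∫⁻ x in Set.Ioc (0 : ℝ) 1, ENNReal.ofReal
        (‖slashSum m (cut k) (Gamma0 N) (linePoint x y) -
        slashSum m (cut j) (Gamma0 N) (linePoint x y)‖ ^ 2)) Filter.atTop :=
    setLIntegral_mono' measurableSet_Icc fun y hyI =>
      lintegral_line_sub_le hm N j (hy.trans_le hyI.1)
  refine h1.trans ?_
  have hm2 (k : ℕ) : Measurable fun p : ℝ × ℝ => ENNReal.ofReal
        (‖slashSum m (cut k) (Gamma0 N) (linePoint p.1 p.2) -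
        slashSum m (cut j) (Gamma0 N) (linePoint p.1 p.2)‖ ^ 2) :=
    (((((hmeas k).sub (hmeas j)).comp measurable_linePoint).norm).pow_const 2).ennreal_ofReal
  refine (lintegral_liminf_le fun k => ?_).trans ?_
  · exact (hm2 k).lintegral_prod_left' (μ := volume.restrict (Set.Ioc (0 : ℝ) 1))
  · refine Filter.liminf_le_of_frequently_le' (Filter.Eventually.frequently ?_)
    filter_upwards [Filter.eventually_ge_atTop j] with k hk
    rw [← lintegral_rect (f := fun z => slashSum m (cut k) (Gamma0 N) z -
      slashSum m (cut j) (Gamma0 N) z) ((hmeas k).sub (hmeas j)) hy]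
    refine (lintegral_subset_le hD (measurableSet_rect _ _) hC ((hmeas k).sub (hmeas j))
      fun γ hγ => sub_slash_eq (slashSum_Gamma0_slash m _ hγ) (slashSum_Gamma0_slash m _ hγ)).trans ?_
    gcongr
    exact hK j k hk

theorem half_pow_rpow (j : ℕ) :
    (((1 / 2 : ℝ) ^ j) ^ (1 / 16 : ℝ)) = ((1 / 2 : ℝ) ^ (1 / 16 : ℝ)) ^ j := by
  rw [← Real.rpow_natCast, ← Real.rpow_natCast, ← Real.rpow_mul (by norm_num),
    ← Real.rpow_mul (by norm_num), mul_comm]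

theorem half_rpow_lt_one : ((1 / 2 : ℝ) ^ (1 / 16 : ℝ)) < 1 :=
  Real.rpow_lt_one (by norm_num) (by norm_num) (by norm_num)

/-- The integrals of the squared errors decay geometrically, so the errors have a finite sum of
squares at almost every point. -/
theorem ae_rect_tendsto (hD : IsGamma0FundamentalDomain N D) (hm : 0 < m) {K : ℝ} (hK0 : 0 ≤ K)
    (hK : ∀ j k : ℕ, j ≤ k →
      normSqOn D (fun z => slashSum m (cut k) (Gamma0 N) z - slashSum m (cut j) (Gamma0 N) z) ≤
        ENNReal.ofReal (K * ((1 / 2) ^ j) ^ (1 / 16 : ℝ))) {y₁ : ℝ} (hy : 0 < y₁) (y₂ : ℝ) :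
    ∀ᵐ z ∂(volume : Measure ℍ).restrict (rect y₁ y₂), Filter.Tendsto
      (fun j => slashSum m (cut j) (Gamma0 N) z) Filter.atTop (nhds (limitForm m N z)) := by
  obtain ⟨C, hC⟩ := lintegral_rect_sub_le hD hm hK hy y₂
  set F : ℕ → ℍ → ENNReal := fun j z => ENNReal.ofReal
      ((‖slashSum m (cut j) (Gamma0 N) z - limitForm m N z‖ * z.im) ^ 2) with hF
  have hFm (j : ℕ) : Measurable (F j) :=
    ((((measurable_slashSum_cut m j _).sub (continuous_limitForm hm N).measurable).norm.mul
      continuous_im.measurable).pow_const 2).ennreal_ofReal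
  have hfin : ∫⁻ z in rect y₁ y₂, ∑' j, F j z < ⊤ := by
    rw [lintegral_tsum fun j => (hFm j).aemeasurable]
    refine (ENNReal.tsum_le_tsum hC).trans_lt ?_
    rw [ENNReal.tsum_mul_left]
    refine ENNReal.mul_lt_top (by simp) ?_
    rw [← ENNReal.ofReal_tsum_of_nonneg (fun j => by positivity)]
    · exact ENNReal.ofReal_lt_top
    · simp only [half_pow_rpow]
      exact (summable_geometric_of_lt_one (by positivity) half_rpow_lt_one).mul_left K
  filter_upwards [ae_lt_top (Measurable.tsum hFm) hfin.ne] with z hz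
  have h1 := ENNReal.tendsto_atTop_zero_of_tsum_ne_top hz.ne
  have h2 := (ENNReal.tendsto_toReal ENNReal.zero_ne_top).comp h1
  have h3 : Filter.Tendsto (fun j => (‖slashSum m (cut j) (Gamma0 N) z - limitForm m N z‖ * z.im) ^ 2)
      Filter.atTop (nhds 0) := by
    refine h2.congr fun j => ?_
    simp only [hF, Function.comp_apply]
    exact ENNReal.toReal_ofReal (sq_nonneg _)
  have h4 := h3.sqrt
  rw [Real.sqrt_zero] at h4
  have h5 := h4.div_const z.im
  rw [zero_div] at h5
  rw [tendsto_iff_norm_sub_tendsto_zero]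
  refine h5.congr fun j => ?_
  rw [Real.sqrt_sq (mul_nonneg (norm_nonneg _) z.im_pos.le), mul_div_cancel_right₀ _ z.im_ne_zero]

theorem T_zpow_mem_Gamma0 (N : ℕ) (n : ℤ) : (ModularGroup.T ^ n : SL(2, ℤ)) ∈ Gamma0 N := by
  rw [mem_Gamma0_iff]
  have h10 : (ModularGroup.T ^ n : SL(2, ℤ)) 1 0 = 0 := by rw [ModularGroup.coe_T_zpow]; rfl
  rw [h10]
  exact dvd_zero _

theorem T_zpow_slash_apply (f : ℍ → ℂ) (n : ℤ) (z : ℍ) :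
    (f ∣[(2 : ℤ)] (ModularGroup.T ^ n : SL(2, ℤ))) z = f ((ModularGroup.T ^ n : SL(2, ℤ)) • z) := by
  rw [SL_slash_two_apply]
  have h10 : (ModularGroup.T ^ n : SL(2, ℤ)) 1 0 = 0 := by rw [ModularGroup.coe_T_zpow]; rfl
  have h11 : (ModularGroup.T ^ n : SL(2, ℤ)) 1 1 = 1 := by rw [ModularGroup.coe_T_zpow]; rfl
  rw [h10, h11]
  simp

theorem expSum_add_int (a : ℕ → ℂ) (z : ℂ) (n : ℤ) : expSum a (z + n) = expSum a z := by
  unfold expSum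
  congr 1
  ext k
  congr 1
  rw [← expTwoPiI_add_intCast (k * z) (k * n)]
  congr 1
  push_cast
  ring

theorem limitForm_T_zpow (m N : ℕ) (n : ℤ) (z : ℍ) :
    limitForm m N ((ModularGroup.T ^ n : SL(2, ℤ)) • z) = limitForm m N z := by
  rw [modular_T_zpow_smul, limitForm, limitForm, coe_vadd, add_comm]
  exact_mod_cast expSum_add_int _ _ n

/-- Rectangles exhaust the strip 0 < x ≤ 1. Truncations and limit have period 1, so the exceptional
set is covered by countably many translates of its part in the strip. -/
theorem ae_tendsto_limitForm (hN : 0 < N) (hD : IsGamma0FundamentalDomain N D) (hm : 0 < m) :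
    ∀ᵐ z : ℍ, Filter.Tendsto
      (fun j => slashSum m (cut j) (Gamma0 N) z) Filter.atTop (nhds (limitForm m N z)) := by
  obtain ⟨K, hK0, hK⟩ := exists_normSqOn_sub_le hN hD hm
  set Bad : Set ℍ := {z | ¬ Filter.Tendsto
      (fun j => slashSum m (cut j) (Gamma0 N) z) Filter.atTop (nhds (limitForm m N z))} with hBad
  have h1 (i : ℕ) : volume (Bad ∩ rect (1 / (i + 1)) (i + 1)) = 0 := by
    have h := ae_rect_tendsto hD hm hK0 hK (y₁ := 1 / (i + 1)) (by positivity) (i + 1)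
    rw [ae_iff, Measure.restrict_apply' (measurableSet_rect _ _)] at h
    exact h
  have h2 : volume (Bad ∩ {z : ℍ | 0 < z.re ∧ z.re ≤ 1}) = 0 := by
    refine measure_mono_null ?_ (measure_iUnion_null h1)
    rintro z ⟨hz, hx⟩
    obtain ⟨a, ha⟩ := exists_nat_ge (max z.im (1 / z.im))
    refine Set.mem_iUnion.2 ⟨a, hz, hx, ?_, ?_⟩
    · rw [one_div_le (by positivity) z.im_pos]
      linarith [le_max_right z.im (1 / z.im)]
    · linarith [le_max_left z.im (1 / z.im)]
  have hinv (n : ℤ) (z : ℍ) (hz : z ∈ Bad) : (ModularGroup.T ^ n : SL(2, ℤ)) • z ∈ Bad := by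
    intro h
    refine hz ?_
    rw [limitForm_T_zpow] at h
    refine h.congr fun j => ?_
    rw [← T_zpow_slash_apply (slashSum m (cut j) (Gamma0 N)), slashSum_Gamma0_slash m _ (T_zpow_mem_Gamma0 N n)]
  refine measure_mono_null (t := ⋃ n : ℤ, (fun z : ℍ => (ModularGroup.T ^ n : SL(2, ℤ)) • z) ⁻¹'
    (Bad ∩ {z : ℍ | 0 < z.re ∧ z.re ≤ 1})) ?_ (measure_iUnion_null fun n =>
      (measurePreserving_SL_smul _).quasiMeasurePreserving.preimage_null h2)
  intro z hz
  refine Set.mem_iUnion.2 ⟨-(⌈z.re⌉ - 1), hinv _ z hz, ?_⟩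
  change 0 < ((ModularGroup.T ^ (-(⌈z.re⌉ - 1)) : SL(2, ℤ)) • z).re ∧
    ((ModularGroup.T ^ (-(⌈z.re⌉ - 1)) : SL(2, ℤ)) • z).re ≤ 1
  rw [modular_T_zpow_smul, vadd_re]
  push_cast
  constructor
  · linarith [Int.ceil_lt_add_one z.re]
  · linarith [Int.le_ceil z.re]

/-- The limit form is modular. -/
theorem limitForm_slash (hN : 0 < N) (hD : IsGamma0FundamentalDomain N D) (hm : 0 < m)
    {γ : SL(2, ℤ)} (hγ : γ ∈ Gamma0 N) : limitForm m N ∣[(2 : ℤ)] γ = limitForm m N := by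
  have h := ae_tendsto_limitForm hN hD hm
  have h' := (measurePreserving_SL_smul γ).quasiMeasurePreserving.ae h
  -- Both sides are limits of the truncations, which are exactly modular, at almost every z;
  -- continuity then gives equality everywhere.
  have hae : (limitForm m N ∣[(2 : ℤ)] γ) =ᵐ[volume] limitForm m N := by
    filter_upwards [h, h'] with z hz hz'
    rw [SL_slash_two_apply]
    refine tendsto_nhds_unique (hz'.mul_const _) ?_
    refine hz.congr fun j => ?_
    rw [← SL_slash_two_apply, slashSum_Gamma0_slash m _ hγ]
  refine (Continuous.ae_eq_iff_eq volume ?_ (continuous_limitForm hm N)).1 hae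
  have e : (limitForm m N ∣[(2 : ℤ)] γ) = fun w : ℍ => limitForm m N (γ • w) *
      (((γ 1 0 : ℂ) * w + (γ 1 1 : ℂ)) ^ 2)⁻¹ := funext (SL_slash_two_apply _ γ)
  rw [e]
  refine ((continuous_limitForm hm N).comp (continuous_SL_smul γ)).mul
    (Continuous.inv₀ (by fun_prop) fun z => pow_ne_zero _ ?_)
  have := denom_ne_zero (γ : GL (Fin 2) ℝ) z
  rwa [ModularGroup.denom_apply] at this

/-- The truncated Poincaré series converge to the limit form in the Petersson norm. -/
theorem tendsto_normSqOn_sub (hN : 0 < N) (hD : IsGamma0FundamentalDomain N D) (hm : 0 < m) :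
    Filter.Tendsto (fun j => normSqOn D
      (fun z => slashSum m (cut j) (Gamma0 N) z - limitForm m N z)) Filter.atTop (nhds 0) := by
  obtain ⟨K, hK0, hK⟩ := exists_normSqOn_sub_le hN hD hm
  have hmeas (k : ℕ) := measurable_slashSum_cut m k (Gamma0 N : Set SL(2, ℤ))
  have hle (j : ℕ) : normSqOn D (fun z => slashSum m (cut j) (Gamma0 N) z - limitForm m N z) ≤
      ENNReal.ofReal (K * ((1 / 2) ^ j) ^ (1 / 16 : ℝ)) := by
    -- Fatou on D: the Cauchy estimate between truncations j and k passes to the limit in k.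
    have h1 : normSqOn D (fun z => slashSum m (cut j) (Gamma0 N) z - limitForm m N z) ≤
        ∫⁻ z in D, Filter.liminf (fun k => ENNReal.ofReal ((‖slashSum m (cut k) (Gamma0 N) z -
          slashSum m (cut j) (Gamma0 N) z‖ * z.im) ^ 2)) Filter.atTop := by
      refine lintegral_mono_ae ?_
      filter_upwards [ae_restrict_of_ae (ae_tendsto_limitForm hN hD hm)] with z hz
      rw [norm_sub_rev]
      have h2 := (ENNReal.continuous_ofReal.tendsto _).comp
        ((((hz.sub_const (slashSum m (cut j) (Gamma0 N) z)).norm).mul_const z.im).pow 2)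
      exact h2.liminf_eq.ge
    refine h1.trans ((lintegral_liminf_le fun k =>
      ((((hmeas k).sub (hmeas j)).norm.mul continuous_im.measurable).pow_const 2).ennreal_ofReal).trans
        (Filter.liminf_le_of_frequently_le' (Filter.Eventually.frequently ?_)))
    filter_upwards [Filter.eventually_ge_atTop j] with k hk
    exact hK j k hk
  refine tendsto_of_tendsto_of_tendsto_of_le_of_le tendsto_const_nhds ?_ (fun _ => zero_le) hle
  rw [← ENNReal.ofReal_zero]
  refine (ENNReal.continuous_ofReal.tendsto _).comp ?_
  simp only [half_pow_rpow]
  have := (tendsto_pow_atTop_nhds_zero_of_lt_one (r := (1 / 2 : ℝ) ^ (1 / 16 : ℝ)) (by positivity)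
    half_rpow_lt_one).const_mul K
  rwa [mul_zero] at this

end AlmostEverywhere

/-! ### The mean value inequality in L² -/

section MeanValue

/-- The mean value inequality for the square of a holomorphic function on a disc. -/
theorem ofReal_normSq_le_lintegral_ball {f : ℂ → ℂ} {U : Set ℂ} (hf : DifferentiableOn ℂ f U)
    {c : ℂ} {R : ℝ} (hR : 0 < R) (hU : Metric.ball c R ⊆ U) (hfm : Measurable f) :
    ENNReal.ofReal (π * R ^ 2 * ‖f c‖ ^ 2) ≤
      ∫⁻ z in Metric.ball c R, ENNReal.ofReal (‖f z‖ ^ 2) := by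
  have hfm' : Measurable fun z => ENNReal.ofReal (‖f z‖ ^ 2) :=
    (hfm.norm.pow_const 2).ennreal_ofReal
  have hcirc : ∀ r ∈ Set.Ioo 0 R, ENNReal.ofReal (2 * π * ‖f c‖ ^ 2) ≤
      ∫⁻ θ in Set.Ioo (-π) π, ENNReal.ofReal (‖f (circleMap c r θ)‖ ^ 2) := by
    intro r hr
    have hsub : Metric.closedBall c |r| ⊆ U := by
      rw [abs_of_pos hr.1]
      exact (Metric.closedBall_subset_ball hr.2).trans hU
    -- Averaging f² instead of f over circles yields |f(c)|² ≤ mean of |f|² without Cauchy–Schwarz;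
    -- polar coordinates do the rest.
    have hf2 : DifferentiableOn ℂ (fun z => f z ^ 2) U := hf.pow 2
    have hmean := (hf2.mono hsub).diffContOnCl_ball subset_rfl |>.circleAverage
    have hcont : Continuous fun θ => ‖f (circleMap c r θ)‖ ^ 2 := by
      refine Continuous.pow (Continuous.norm ?_) 2
      refine (hf.continuousOn.mono hsub).comp_continuous (continuous_circleMap c r) fun θ => ?_
      exact Metric.sphere_subset_closedBall (circleMap_mem_sphere' c r θ)
    have h1 : 2 * π * ‖f c‖ ^ 2 ≤ ∫ θ in (0 : ℝ)..2 * π, ‖f (circleMap c r θ)‖ ^ 2 := by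
      rw [← norm_pow, ← hmean, Real.circleAverage, norm_smul, Real.norm_of_nonneg (by positivity),
        mul_inv_cancel_left₀ (by positivity)]
      refine (intervalIntegral.norm_integral_le_integral_norm (by positivity)).trans (le_of_eq ?_)
      simp only [norm_pow]
    have hper : Function.Periodic (fun θ => ‖f (circleMap c r θ)‖ ^ 2) (2 * π) := fun θ => by
      simp only [periodic_circleMap c r θ]
    have h2 := hper.intervalIntegral_add_eq 0 (-π)
    rw [zero_add, show -π + 2 * π = π by ring] at h2
    rw [h2, intervalIntegral.integral_of_le (by linarith [Real.pi_pos]),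
      integral_Ioc_eq_integral_Ioo] at h1
    refine (ENNReal.ofReal_le_ofReal h1).trans (le_of_eq ?_)
    refine ofReal_integral_eq_lintegral_ofReal ?_ (Filter.Eventually.of_forall fun θ => sq_nonneg _)
    exact (hcont.integrableOn_Icc).mono_set Set.Ioo_subset_Icc_self
  rw [← lintegral_indicator Metric.isOpen_ball.measurableSet,
    ← lintegral_add_left_eq_self _ c, ← Complex.lintegral_comp_polarCoord_symm]
  have hpol (p : ℝ × ℝ) : c + Complex.polarCoord.symm p = circleMap c p.1 p.2 := by
    rw [circleMap, Complex.polarCoord_symm_apply, Complex.exp_mul_I, Complex.ofReal_cos,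
      Complex.ofReal_sin]
  simp only [hpol, smul_eq_mul]
  have hmono : Set.Ioo 0 R ×ˢ Set.Ioo (-π) π ⊆ polarCoord.target :=
    Set.prod_mono Set.Ioo_subset_Ioi_self subset_rfl
  have hmeasF : Measurable fun p : ℝ × ℝ => ENNReal.ofReal p.1 *
      ENNReal.ofReal (‖f (circleMap c p.1 p.2)‖ ^ 2) := by
    have : Continuous fun p : ℝ × ℝ => circleMap c p.1 p.2 := by
      unfold circleMap
      fun_prop
    exact measurable_fst.ennreal_ofReal.mul (hfm'.comp this.measurable)
  refine le_trans ?_ (lintegral_mono_set hmono)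
  have h1 : ∫⁻ p in Set.Ioo 0 R ×ˢ Set.Ioo (-π) π, ENNReal.ofReal p.1 *
      (Metric.ball c R).indicator (fun z => ENNReal.ofReal (‖f z‖ ^ 2)) (circleMap c p.1 p.2) =
      ∫⁻ p in Set.Ioo 0 R ×ˢ Set.Ioo (-π) π, ENNReal.ofReal p.1 *
        ENNReal.ofReal (‖f (circleMap c p.1 p.2)‖ ^ 2) := by
    refine setLIntegral_congr_fun (measurableSet_Ioo.prod measurableSet_Ioo) fun p hp => ?_
    have hmem : circleMap c p.1 p.2 ∈ Metric.ball c R := by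
      rw [Metric.mem_ball, dist_eq_norm, circleMap_sub_center, norm_circleMap_zero,
        abs_of_pos hp.1.1]
      exact hp.1.2
    simp only [Set.indicator_of_mem hmem]
  rw [h1, Measure.volume_eq_prod, ← Measure.prod_restrict, lintegral_prod _ hmeasF.aemeasurable]
  have h2 : ENNReal.ofReal (π * R ^ 2 * ‖f c‖ ^ 2) =
      ∫⁻ r in Set.Ioo 0 R, ENNReal.ofReal r * ENNReal.ofReal (2 * π * ‖f c‖ ^ 2) := by
    have h3 : ∫⁻ r in Set.Ioo 0 R, ENNReal.ofReal r = ENNReal.ofReal (∫ r in Set.Ioo 0 R, r) :=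
      (ofReal_integral_eq_lintegral_ofReal
        (continuous_id.integrableOn_Icc.mono_set Set.Ioo_subset_Icc_self)
        ((ae_restrict_iff' measurableSet_Ioo).2
          (Filter.Eventually.of_forall fun r hr => hr.1.le))).symm
    rw [lintegral_mul_const _ (by fun_prop), h3,
      ← integral_Ioc_eq_integral_Ioo, ← intervalIntegral.integral_of_le hR.le, integral_id,
      ← ENNReal.ofReal_mul (by nlinarith)]
    congr 1
    ring
  rw [h2]
  refine setLIntegral_mono' measurableSet_Ioo fun r hr => ?_
  rw [lintegral_const_mul' _ _ ENNReal.ofReal_ne_top]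
  gcongr
  exact hcirc r hr

end MeanValue

/-! ### Multiplicity of a half strip -/

section StripCount

theorem finite_SL_of_abs_le (K : ℤ) : {σ : SL(2, ℤ) | ∀ i j, |σ i j| ≤ K}.Finite := by
  have h : {u : Fin 2 → Fin 2 → ℤ | ∀ i, u i ∈ {v : Fin 2 → ℤ | ∀ j, v j ∈ Set.Icc (-K) K}}.Finite :=
    Set.Finite.pi' fun _ => Set.Finite.pi' fun _ => Set.finite_Icc _ _
  refine Set.Finite.of_finite_image (f := fun σ : SL(2, ℤ) => (fun i j => σ i j)) (h.subset ?_) ?_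
  · rintro _ ⟨σ, hσ, rfl⟩
    exact fun i j => abs_le.1 (hσ i j)
  · intro σ _ τ _ h
    ext i j
    exact congrFun (congrFun h i) j

/-- Points are moved into a vertical half strip by boundedly many elements of `SL(2, ℤ)`. -/
theorem exists_encard_smul_mem_halfStrip_le (X : ℝ) : ∃ C : ℕ, ∀ w : ℍ,
    {σ : SL(2, ℤ) | σ • w ∈ {z : ℍ | |z.re| ≤ X ∧ 1 < z.im}}.encard ≤ C := by
  have hfin := finite_SL_of_abs_le (max 1 ⌈2 * X⌉)
  refine ⟨hfin.toFinset.card, fun w => ?_⟩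
  rcases Set.eq_empty_or_nonempty {σ : SL(2, ℤ) | σ • w ∈ {z : ℍ | |z.re| ≤ X ∧ 1 < z.im}}
    with h | ⟨σ₀, h₀⟩
  · rw [h]; simp
  rw [← Set.encard_coe_eq_coe_finsetCard, hfin.coe_toFinset]
  refine Set.encard_le_encard_of_injOn (f := fun σ => σ * σ₀⁻¹) ?_
    (mul_left_injective σ₀⁻¹).injOn
  intro σ hσ
  have hz : σ • w = (σ * σ₀⁻¹) • (σ₀ • w) := by rw [← mul_smul, inv_mul_cancel_right]
  have h1 : |(σ • w).re| ≤ X ∧ 1 < (σ • w).im := hσ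
  have h2 : |(σ₀ • w).re| ≤ X ∧ 1 < (σ₀ • w).im := h₀
  rw [hz] at h1
  generalize σ₀ • w = z at h1 h2
  change ∀ i j, |(σ * σ₀⁻¹) i j| ≤ _
  generalize σ * σ₀⁻¹ = τ at h1
  have hdet := τ.det_coe
  rw [Matrix.det_fin_two] at hdet
  -- τ maps a point above height 1 to another such point, which excludes a nonzero lower left entry.
  -- So τ is ± a translation, by at most 2X.
  have hc : τ 1 0 = 0 := by
    by_contra hc
    have := im_SL_smul_le_of_ne_zero τ z hc
    have h4 : 1 / z.im < 1 := by
      rw [div_lt_one z.im_pos]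
      exact h2.2
    linarith [h1.2]
  rw [hc, mul_zero, sub_zero] at hdet
  have hre : (τ • z).re = z.re + (τ 0 1 : ℝ) * (τ 1 1 : ℝ) := by
    have h5 := congrArg Complex.re (coe_specialLinearGroup_apply τ z)
    rw [coe_re] at h5
    rw [h5, hc]
    rcases Int.mul_eq_one_iff_eq_one_or_neg_one.1 hdet with ⟨h6, h7⟩ | ⟨h6, h7⟩ <;>
      (simp [h6, h7, div_neg]; try ring)
  have hb : |τ 0 1| ≤ ⌈2 * X⌉ := by
    have h8 : |(τ 0 1 : ℝ)| ≤ 2 * X := by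
      have h9 := abs_sub (τ • z).re z.re
      have e : (τ • z).re - z.re = (τ 0 1 : ℝ) * (τ 1 1 : ℝ) := by rw [hre]; ring
      rw [e, abs_mul] at h9
      have h10 : |(τ 1 1 : ℝ)| = 1 := by
        rcases Int.mul_eq_one_iff_eq_one_or_neg_one.1 hdet with ⟨h6, h7⟩ | ⟨h6, h7⟩ <;> simp [h7]
      rw [h10, mul_one] at h9
      linarith [h1.1, h2.1]
    have h11 : ((|τ 0 1| : ℤ) : ℝ) ≤ (⌈2 * X⌉ : ℤ) := by
      push_cast
      exact h8.trans (Int.le_ceil _)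
    exact_mod_cast h11
  have had : |τ 0 0| ≤ 1 ∧ |τ 1 1| ≤ 1 := by
    rcases Int.mul_eq_one_iff_eq_one_or_neg_one.1 hdet with ⟨h6, h7⟩ | ⟨h6, h7⟩ <;> simp [h6, h7]
  intro i j
  fin_cases i <;> fin_cases j
  · exact had.1.trans (le_max_left _ _)
  · exact hb.trans (le_max_right _ _)
  · change |τ 1 0| ≤ _
    rw [hc]
    simp
  · exact had.2.trans (le_max_left _ _)

end StripCount

/-! ### Square integrability implies vanishing at infinity -/

section Decay

theorem setLIntegral_coe_image (s : Set ℍ) (hs : MeasurableSet s) {g : ℂ → ENNReal}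
    (hg : Measurable g) :
    ∫⁻ z in UpperHalfPlane.coe '' s, g z = ∫⁻ z in s, g z * ENNReal.ofReal (z.im ^ 2) := by
  have h : MeasurePreserving UpperHalfPlane.coe (volume.comap UpperHalfPlane.coe)
      (volume.restrict (Set.range UpperHalfPlane.coe)) :=
    ⟨measurable_coe, by rw [measurableEmbedding_coe.map_comap]⟩
  have hρ : Measurable fun z : ℍ =>
      (((1 / NNReal.mk z.im z.im_pos.le : NNReal) ^ 2 : NNReal) : ENNReal) := by
    refine Measurable.coe_nnreal_ennreal (Measurable.pow_const (Measurable.div measurable_const ?_) 2)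
    exact (continuous_im.subtype_mk _).measurable
  rw [volume_def, restrict_withDensity hs, lintegral_withDensity_eq_lintegral_mul _ hρ
      (g := fun z : ℍ => g z * ENNReal.ofReal (z.im ^ 2))
      ((hg.comp measurable_coe).mul (continuous_im.measurable.pow_const 2).ennreal_ofReal),
    ← Set.inter_eq_self_of_subset_left (Set.image_subset_range _ s),
    ← Measure.restrict_restrict' measurableEmbedding_coe.measurableSet_range,
    ← h.setLIntegral_comp_emb measurableEmbedding_coe]
  refine lintegral_congr fun z => ?_
  have e : (((1 / NNReal.mk z.im z.im_pos.le : NNReal) ^ 2 : NNReal) : ENNReal) =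
      ENNReal.ofReal (1 / z.im ^ 2) := by
    rw [ENNReal.ofReal, ENNReal.coe_inj]
    ext
    rw [Real.coe_toNNReal _ (by positivity)]
    simp
  simp only [Pi.mul_apply, e]
  rw [mul_comm, mul_assoc, ← ENNReal.ofReal_mul (by positivity), mul_one_div_cancel
    (pow_ne_zero 2 z.im_ne_zero), ENNReal.ofReal_one, mul_one]

/-- A holomorphic periodic function whose square is integrable near `i∞` tends to `0` there. -/
theorem isZeroAtImInfty_of_lintegral_lt_top {f : ℍ → ℂ}
    (hf : DifferentiableOn ℂ (f ∘ ofComplex) {z | 0 < z.im}) {N : ℕ} (hN : 0 < N)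
    (hper : ∀ (n : ℤ) (z : ℍ), f (((n * N : ℝ)) +ᵥ z) = f z)
    (hfin : ∫⁻ z in {z : ℍ | |z.re| ≤ N + 1 ∧ 1 < z.im}, ENNReal.ofReal ((‖f z‖ * z.im) ^ 2) < ⊤) :
    IsZeroAtImInfty f := by
  set S : Set ℍ := {z : ℍ | |z.re| ≤ N + 1 ∧ 1 < z.im} with hS
  have hSm : MeasurableSet S := (measurableSet_le continuous_re.measurable.abs measurable_const).inter
    (measurableSet_lt measurable_const continuous_im.measurable)
  have hfc : Measurable f := by
    have : f = (f ∘ ofComplex) ∘ UpperHalfPlane.coe := by ext z; simp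
    rw [this]
    exact (hf.continuousOn.comp_continuous continuous_coe fun z => z.im_pos).measurable
  set F : ℍ → ENNReal := fun z => ENNReal.ofReal ((‖f z‖ * z.im) ^ 2) with hF
  have hFm : Measurable F := ((hfc.norm.mul continuous_im.measurable).pow_const 2).ennreal_ofReal
  -- The L² mass above height k tends to 0. A disc of radius 1/2 about a point with 0 ≤ Re z ≤ N and
  -- Im z ≥ k + 1 stays in that region, so the mean value inequality bounds f at its centre;
  -- periodicity covers the other points.
  have htail : Filter.Tendsto (fun k : ℕ => ∫⁻ z in {z : ℍ | (k : ℝ) < z.im} ∩ S, F z) Filter.atTop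
      (nhds 0) := by
    have hm (k : ℕ) : MeasurableSet {z : ℍ | (k : ℝ) < z.im} :=
      measurableSet_lt measurable_const continuous_im.measurable
    have h := tendsto_measure_iInter_atTop (μ := (volume.restrict S).withDensity F)
      (s := fun k : ℕ => {z : ℍ | (k : ℝ) < z.im}) (fun k => (hm k).nullMeasurableSet)
      (fun i j hij z hz => lt_of_le_of_lt (by exact_mod_cast hij) (show (j : ℝ) < z.im from hz))
      ⟨0, ((measure_mono (Set.subset_univ _)).trans_lt (by
        rw [withDensity_apply _ MeasurableSet.univ, Measure.restrict_univ]
        exact hfin)).ne⟩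
    have he : (⋂ k : ℕ, {z : ℍ | (k : ℝ) < z.im}) = ∅ := by
      refine Set.eq_empty_of_forall_notMem fun z hz => ?_
      obtain ⟨k, hk⟩ := exists_nat_ge z.im
      exact absurd (Set.mem_iInter.1 hz k : (k : ℝ) < z.im) hk.not_gt
    rw [he, measure_empty] at h
    refine h.congr fun k => ?_
    rw [Function.comp_apply, withDensity_apply _ (hm k), Measure.restrict_restrict (hm k)]
  rw [isZeroAtImInfty_iff]
  intro ε hε
  have hev := (ENNReal.tendsto_nhds_zero.1 htail) (ENNReal.ofReal (π * (1 / 2) ^ 2 * ε ^ 2))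
    (by rw [gt_iff_lt, ENNReal.ofReal_pos]; positivity)
  obtain ⟨k, hk, hk1⟩ := (hev.and (Filter.eventually_ge_atTop 1)).exists
  have hk1' : (1 : ℝ) ≤ k := by exact_mod_cast hk1
  have hbox : ∀ z : ℍ, 0 ≤ z.re → z.re ≤ N → (k : ℝ) + 1 ≤ z.im → ‖f z‖ ≤ ε := by
    intro z h0 h1 h2
    have hball : ∀ w ∈ Metric.ball (z : ℂ) (1 / 2), |w.re - z.re| < 1 / 2 ∧ |w.im - z.im| < 1 / 2 := by
      intro w hw
      rw [Metric.mem_ball, dist_eq_norm] at hw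
      exact ⟨by simpa using (Complex.abs_re_le_norm (w - z)).trans_lt hw,
        by simpa using (Complex.abs_im_le_norm (w - z)).trans_lt hw⟩
    have hpos : ∀ w ∈ Metric.ball (z : ℂ) (1 / 2), (k : ℝ) < w.im := fun w hw => by
      have := abs_lt.1 (hball w hw).2
      linarith
    have hmean := ofReal_normSq_le_lintegral_ball hf (c := (z : ℂ)) (R := 1 / 2) (by norm_num)
      (fun w hw => lt_trans (by linarith) (hpos w hw)) (hfc.comp measurable_ofComplex)
    have himg : Metric.ball (z : ℂ) (1 / 2) =
        UpperHalfPlane.coe '' (UpperHalfPlane.coe ⁻¹' Metric.ball (z : ℂ) (1 / 2)) := by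
      rw [Set.image_preimage_eq_of_subset]
      intro w hw
      exact ⟨⟨w, lt_trans (by linarith) (hpos w hw)⟩, rfl⟩
    rw [himg, setLIntegral_coe_image _ (measurable_coe Metric.isOpen_ball.measurableSet)
      ((hfc.comp measurable_ofComplex).norm.pow_const 2).ennreal_ofReal] at hmean
    have hle : ∫⁻ w in (UpperHalfPlane.coe ⁻¹' Metric.ball (z : ℂ) (1 / 2)),
        ENNReal.ofReal (‖(f ∘ ofComplex) w‖ ^ 2) * ENNReal.ofReal (w.im ^ 2) ≤
        ∫⁻ w in {w : ℍ | (k : ℝ) < w.im} ∩ S, F w := by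
      have e (w : ℍ) : ENNReal.ofReal (‖(f ∘ ofComplex) w‖ ^ 2) * ENNReal.ofReal (w.im ^ 2) = F w := by
        change _ = ENNReal.ofReal ((‖f w‖ * w.im) ^ 2)
        rw [← ENNReal.ofReal_mul (by positivity), Function.comp_apply, ofComplex_apply, mul_pow]
      simp only [e]
      refine lintegral_mono_set fun w hw => ?_
      have h5 := hpos _ hw
      have h6 := abs_lt.1 (hball _ hw).1
      rw [coe_re] at h6
      exact ⟨h5, abs_le.2 ⟨by linarith, by linarith⟩, hk1'.trans_lt h5⟩
    have h7 := hmean.trans (hle.trans hk)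
    rw [ENNReal.ofReal_le_ofReal_iff (by positivity), Function.comp_apply, ofComplex_apply] at h7
    have h8 : ‖f z‖ ^ 2 ≤ ε ^ 2 := le_of_mul_le_mul_left h7 (by positivity)
    exact (sq_le_sq₀ (norm_nonneg _) hε.le).1 h8
  refine ⟨k + 1, fun z hz => ?_⟩
  have hNr : (0 : ℝ) < N := by exact_mod_cast hN
  rw [← hper (-⌊z.re / N⌋) z]
  have h9 := Int.floor_le (z.re / N)
  have h10 := Int.lt_floor_add_one (z.re / N)
  rw [le_div_iff₀ hNr] at h9
  rw [div_lt_iff₀ hNr] at h10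
  refine hbox _ ?_ ?_ ?_
  · rw [vadd_re]; push_cast; linarith
  · rw [vadd_re]; push_cast; linarith
  · rwa [vadd_im]

end Decay

open scoped Manifold

/-! ### Square integrable modular functions are cusp forms -/

section CuspFormOfSquareIntegrable

variable {N : ℕ} {D : Set ℍ}

/-- T^(nN) lies in Γ(N), which is normal and contained in Γ₀(N); so f|σ has period N for every σ. -/
theorem T_zpow_mul_slash {f : ℍ → ℂ} (hinv : ∀ γ ∈ Gamma0 N, f ∣[(2 : ℤ)] γ = f) (σ : SL(2, ℤ))
    (n : ℤ) : (f ∣[(2 : ℤ)] σ) ∣[(2 : ℤ)] (ModularGroup.T ^ (n * N) : SL(2, ℤ)) =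
      f ∣[(2 : ℤ)] σ := by
  have hT : (ModularGroup.T ^ (n * N) : SL(2, ℤ)) ∈ Gamma N :=
    ModularGroup_T_pow_mem_Gamma N (n * N) (dvd_mul_left _ _)
  have hconj : σ * ModularGroup.T ^ (n * N) * σ⁻¹ ∈ Gamma0 N := by
    have h := (Gamma_normal N).conj_mem _ hT σ
    rw [Gamma_mem] at h
    rw [Gamma0_mem]
    exact h.2.2.1
  rw [← SlashAction.slash_mul]
  have e : σ * ModularGroup.T ^ (n * N) = (σ * ModularGroup.T ^ (n * N) * σ⁻¹) * σ := by group
  rw [e, SlashAction.slash_mul, hinv _ hconj]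

theorem normSq_slash (f : ℍ → ℂ) (σ : SL(2, ℤ)) (z : ℍ) :
    (‖(f ∣[(2 : ℤ)] σ) z‖ * z.im) ^ 2 = (‖f (σ • z)‖ * (σ • z).im) ^ 2 := by
  have h1 := petersson_slash_SL 2 f f σ z
  rw [petersson_two_self, petersson_two_self] at h1
  exact_mod_cast h1

/-- A square integrable weakly modular holomorphic function vanishes at the cusps. -/
theorem isZeroAtImInfty_slash (hN : 0 < N) (hD : IsGamma0FundamentalDomain N D) {f : ℍ → ℂ}
    (hf : MDiff f) (hinv : ∀ γ ∈ Gamma0 N, f ∣[(2 : ℤ)] γ = f) (hfin : normSqOn D f < ⊤)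
    (σ : SL(2, ℤ)) : IsZeroAtImInfty (f ∣[(2 : ℤ)] σ) := by
  have hfm : Measurable f := hf.continuous.measurable
  refine isZeroAtImInfty_of_lintegral_lt_top (mdifferentiable_iff.1 (hf.slash 2 (σ : GL (Fin 2) ℝ)))
    hN (fun n z => ?_) ?_
  · have h := congrFun (T_zpow_mul_slash hinv σ n) z
    rw [T_zpow_slash_apply, modular_T_zpow_smul] at h
    push_cast at h
    exact h
  · simp only [normSq_slash]
    set S : Set ℍ := {z : ℍ | |z.re| ≤ N + 1 ∧ 1 < z.im} with hS
    have hSm : MeasurableSet S :=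
      (measurableSet_le continuous_re.measurable.abs measurable_const).inter
        (measurableSet_lt measurable_const continuous_im.measurable)
    set A : Set ℍ := {w | σ⁻¹ • w ∈ S} with hA
    have hAm : MeasurableSet A := (continuous_SL_smul σ⁻¹).measurable hSm
    have hpre : S = (fun z : ℍ => σ • z) ⁻¹' A := by
      ext z
      simp [hA]
    have hmeas : Measurable fun w : ℍ => ENNReal.ofReal ((‖f w‖ * w.im) ^ 2) :=
      ((hfm.norm.mul continuous_im.measurable).pow_const 2).ennreal_ofReal
    -- The image of the half strip under σ reaches a cusp and is not relatively compact, but its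
    -- multiplicity is still bounded, so the norm over D controls the mass there.
    obtain ⟨C, hC⟩ := exists_encard_smul_mem_halfStrip_le (N + 1 : ℝ)
    rw [hpre, (measurePreserving_SL_smul σ).setLIntegral_comp_preimage hAm hmeas]
    refine (lintegral_subset_le hD hAm (C := C) (fun w => le_trans ?_ (hC w)) hfm hinv).trans_lt
      (ENNReal.mul_lt_top (by simp) hfin)
    refine Set.encard_le_encard_of_injOn (f := fun γ : Gamma0 N => σ⁻¹ * (γ : SL(2, ℤ))) ?_ ?_
    · intro γ hγ
      have h : σ⁻¹ • ((γ : SL(2, ℤ)) • w) ∈ S := hγ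
      rwa [← mul_smul] at h
    · intro γ _ δ _ h
      exact Subtype.ext (mul_left_cancel h)

/-- A square integrable weakly modular holomorphic function, as a cusp form. -/
def cuspFormOfSquareIntegrable (hN : 0 < N) (hD : IsGamma0FundamentalDomain N D) {f : ℍ → ℂ}
    (hf : MDiff f) (hinv : ∀ γ ∈ Gamma0 N, f ∣[(2 : ℤ)] γ = f) (hfin : normSqOn D f < ⊤) :
    S2Gamma0 N where
  toFun := f
  slash_action_eq' := by
    rintro _ ⟨γ, hγ, rfl⟩
    exact hinv γ hγ
  holo' := hf
  zero_at_cusps' {c} hc := by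
    have hc' : IsCusp c 𝒮ℒ := hc.mono (by
      rintro _ ⟨γ, -, rfl⟩
      exact ⟨γ, rfl⟩)
    exact (OnePoint.isZeroAt_iff_forall_SL2Z hc').2 fun σ _ =>
      isZeroAtImInfty_slash hN hD hf hinv hfin σ

end CuspFormOfSquareIntegrable

/-! ### The Poincaré series as a cusp form -/

section PoincareForm

variable {m N : ℕ} {D : Set ℍ}

theorem normSqOn_lt_top_of_bounded (hN : 0 < N) (hD : IsGamma0FundamentalDomain N D) {f : ℍ → ℂ}
    {A : ℝ} (hA : ∀ z, ‖f z‖ * z.im ≤ A) : normSqOn D f < ⊤ := by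
  have hvol := hD.volume_lt_top hN
  refine (lintegral_mono (g := fun _ => ENNReal.ofReal (A ^ 2)) fun z => ?_).trans_lt ?_
  · refine ENNReal.ofReal_le_ofReal (pow_le_pow_left₀ (mul_nonneg (norm_nonneg _) z.im_pos.le)
      (hA z) 2)
  · rw [setLIntegral_const]
    exact ENNReal.mul_lt_top ENNReal.ofReal_lt_top hvol

theorem normSqOn_le_add {f g : ℍ → ℂ} (hf : Measurable f) :
    normSqOn D g ≤ 2 * normSqOn D f + 2 * normSqOn D (fun z => f z - g z) := by
  unfold normSqOn
  have hm : Measurable fun z : ℍ => ENNReal.ofReal ((‖f z‖ * z.im) ^ 2) :=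
    ((hf.norm.mul continuous_im.measurable).pow_const 2).ennreal_ofReal
  rw [← lintegral_const_mul' _ _ (by simp), ← lintegral_const_mul' _ _ (by simp),
    ← lintegral_add_left (hm.const_mul 2)]
  refine lintegral_mono fun z => ?_
  have e2 : (2 : ENNReal) = ENNReal.ofReal 2 := by simp
  rw [e2, ← ENNReal.ofReal_mul (by norm_num), ← ENNReal.ofReal_mul (by norm_num),
    ← ENNReal.ofReal_add (by positivity) (by positivity)]
  refine ENNReal.ofReal_le_ofReal ?_
  have h1 : ‖g z‖ * z.im ≤ ‖f z‖ * z.im + ‖f z - g z‖ * z.im := by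
    rw [← add_mul]
    refine mul_le_mul_of_nonneg_right ?_ z.im_pos.le
    have := norm_sub_norm_le (g z) (f z)
    rw [norm_sub_rev] at this
    linarith
  have h2 : 0 ≤ ‖g z‖ * z.im := mul_nonneg (norm_nonneg _) z.im_pos.le
  nlinarith [sq_nonneg (‖f z‖ * z.im - ‖f z - g z‖ * z.im)]

theorem normSqOn_limitForm_lt_top (hN : 0 < N) (hD : IsGamma0FundamentalDomain N D) (hm : 0 < m) :
    normSqOn D (limitForm m N) < ⊤ := by
  obtain ⟨j, hj⟩ := ((tendsto_normSqOn_sub hN hD hm).eventually_lt_const ENNReal.zero_lt_top).exists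
  obtain ⟨C, hC⟩ := exists_norm_slashSum_cut_le hm j
  refine (normSqOn_le_add (measurable_slashSum_cut m j (Gamma0 N))).trans_lt (ENNReal.add_lt_top.2
    ⟨ENNReal.mul_lt_top (by simp) ?_, ENNReal.mul_lt_top (by simp) hj⟩)
  exact normSqOn_lt_top_of_bounded hN hD (hC _)

theorem mdifferentiable_limitForm (hm : 0 < m) (N : ℕ) : MDiff (limitForm m N) := by
  obtain ⟨A, hA⟩ := exists_norm_formCoeff_le hm N
  rw [mdifferentiable_iff]
  refine (differentiableOn_expSum hA).congr fun z hz => ?_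
  rw [Function.comp_apply, limitForm, ofComplex_apply_of_im_pos hz]

/-- The Poincaré series of weight `2`, as a cusp form. -/
def poincareForm (hN : 0 < N) (hD : IsGamma0FundamentalDomain N D) (hm : 0 < m) : S2Gamma0 N :=
  cuspFormOfSquareIntegrable hN hD (mdifferentiable_limitForm hm N)
    (fun _ hγ => limitForm_slash hN hD hm hγ) (normSqOn_limitForm_lt_top hN hD hm)

theorem coe_poincareForm (hN : 0 < N) (hD : IsGamma0FundamentalDomain N D) (hm : 0 < m) :
    ⇑(poincareForm hN hD hm) = limitForm m N := rfl

end PoincareForm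

/-! ### Fourier coefficients of cusp forms as line integrals -/

section FourierCoefficients

variable {N : ℕ} {D : Set ℍ}

theorem exists_norm_mul_im_le (hN : 0 < N) (f : S2Gamma0 N) : ∃ A, ∀ z, ‖f z‖ * z.im ≤ A := by
  have : NeZero N := ⟨hN.ne'⟩
  obtain ⟨C, hC⟩ := CuspFormClass.petersson_bounded_left 2
    ((Gamma0 N).map (Matrix.SpecialLinearGroup.mapGL ℝ)) f f
  refine ⟨√C, fun z => Real.le_sqrt_of_sq_le ?_⟩
  have h := hC z
  rw [petersson_two_self, Complex.norm_real, Real.norm_of_nonneg (sq_nonneg _)] at h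
  exact h

theorem measurable_S2Gamma0 (f : S2Gamma0 N) : Measurable f :=
  (CuspFormClass.holo f).continuous.measurable

theorem S2Gamma0_slash (f : S2Gamma0 N) {γ : SL(2, ℤ)} (hγ : γ ∈ Gamma0 N) :
    (f : ℍ → ℂ) ∣[(2 : ℤ)] γ = f :=
  SlashInvariantFormClass.slash_action_eq f _ ⟨γ, hγ, rfl⟩

theorem integral_linePoint_eq_fourierCoeff0 (hN : 0 < N) (f : S2Gamma0 N) (n : ℕ) {y : ℝ}
    (hy : 0 < y) : ∫ x in (0 : ℝ)..1, f (linePoint x y) * expTwoPiI (-(n * x)) =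
      fourierCoeff0 n f * Real.exp (-(2 * π * n * y)) := by
  have : NeZero N := ⟨hN.ne'⟩
  have h := ModularFormClass.qExpansion_coeff_eq_intervalIntegral (f := f) (h := 1) one_pos
    (by rw [strictPeriods_Gamma0]; exact AddSubgroup.mem_zmultiples 1) n hy
  rw [fourierCoeff0, h, Complex.ofReal_one, div_one, one_mul,
    ← intervalIntegral.integral_mul_const]
  refine intervalIntegral.integral_congr fun x _ => ?_
  have e : linePoint x y = ⟨x + y * Complex.I, by simpa using hy⟩ :=
    UpperHalfPlane.ext (coe_linePoint hy)
  simp only [e]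
  rw [mul_right_comm, mul_comm]
  congr 1
  rw [one_div, Function.Periodic.qParam, ← Complex.exp_nat_mul, ← Complex.exp_neg, expTwoPiI,
    Complex.ofReal_exp, ← Complex.exp_add]
  congr 1
  push_cast
  linear_combination (2 * π * n * y : ℂ) * Complex.I_sq

variable {m : ℕ}

theorem fourierCoeff0_poincareForm (hN : 0 < N) (hD : IsGamma0FundamentalDomain N D) (hm : 0 < m)
    {n : ℕ} (hn : 0 < n) : fourierCoeff0 n (poincareForm hN hD hm) = limitCoeff m N 1 n := by
  have h := integral_linePoint_eq_fourierCoeff0 hN (poincareForm hN hD hm) n one_pos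
  have h' := integral_limitForm hm N (n : ℤ) one_pos
  rw [if_pos (by exact_mod_cast hn), Int.toNat_natCast] at h'
  rw [coe_poincareForm] at h
  push_cast at h h'
  rw [h'] at h
  exact (mul_right_cancel₀ (Complex.exp_ne_zero _) h).symm

end FourierCoefficients

/-! ### The Petersson product with the Poincaré series -/

section Petersson

variable {m N : ℕ} {D : Set ℍ}

theorem integral_Ioi_exp_neg {a : ℝ} (ha : 0 < a) :
    ∫ y in Set.Ioi (0 : ℝ), Real.exp (-(a * y)) = 1 / a := by
  have h := integral_exp_mul_Ioi (a := -a) (by linarith) 0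
  simp only [neg_mul] at h
  rw [h]
  simp

theorem tendsto_integral_cut_mul_exp {a : ℝ} (ha : 0 < a) :
    Filter.Tendsto (fun k => ∫ y in Set.Ioi (0 : ℝ), cut k y * Real.exp (-(a * y))) Filter.atTop
      (nhds (1 / a)) := by
  rw [← integral_Ioi_exp_neg ha]
  have hint : IntegrableOn (fun y : ℝ => Real.exp (-(a * y))) (Set.Ioi 0) := by
    simpa only [neg_mul] using integrableOn_exp_mul_Ioi (a := -a) (by linarith) 0
  refine tendsto_integral_of_dominated_convergence (fun y => Real.exp (-(a * y)))
    (fun k => ((measurable_cut k).mul (by fun_prop)).aestronglyMeasurable) hint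
    (fun k => Filter.Eventually.of_forall fun y => ?_) ?_
  · rw [norm_mul, Real.norm_of_nonneg (Real.exp_nonneg _), Real.norm_eq_abs]
    exact mul_le_of_le_one_left (Real.exp_nonneg _) (abs_cut_le k y)
  · refine (ae_restrict_iff' measurableSet_Ioi).2 (Filter.Eventually.of_forall fun y hy => ?_)
    have := (tendsto_cut hy).mul_const (Real.exp (-(a * y)))
    rwa [one_mul] at this

/-- Cauchy–Schwarz against the constant 1; useful because D has finite volume. -/
theorem lintegral_norm_le_normSqOn {f : ℍ → ℂ} (hf : Measurable f) :
    ∫⁻ z in D, ENNReal.ofReal (‖f z‖ * z.im) ≤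
      normSqOn D f ^ (1 / 2 : ℝ) * volume D ^ (1 / 2 : ℝ) := by
  have hm : Measurable fun z : ℍ => ENNReal.ofReal (‖f z‖ * z.im) :=
    (hf.norm.mul continuous_im.measurable).ennreal_ofReal
  have h := ENNReal.lintegral_mul_le_Lp_mul_Lq (volume.restrict D) Real.HolderConjugate.two_two
    hm.aemeasurable (aemeasurable_const (b := (1 : ENNReal)))
  simp only [Pi.mul_apply, mul_one, ENNReal.one_rpow, lintegral_const, one_mul,
    Measure.restrict_apply_univ] at h
  refine h.trans (le_of_eq ?_)
  congr 2
  unfold normSqOn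
  refine lintegral_congr fun z => ?_
  rw [ENNReal.ofReal_pow (mul_nonneg (norm_nonneg _) z.im_pos.le)]
  norm_cast

/-- The Petersson product with the Poincaré series is a Fourier coefficient. -/
theorem peterssonInner_poincareForm (hN : 0 < N) (hD : IsGamma0FundamentalDomain N D) (hm : 0 < m)
    (f : S2Gamma0 N) :
    peterssonInner D (poincareForm hN hD hm) f = fourierCoeff0 m f / (4 * π * m) := by
  obtain ⟨B, hB⟩ := exists_norm_mul_im_le hN f
  obtain ⟨A, hA⟩ := exists_norm_mul_im_le hN (poincareForm hN hD hm)
  rw [coe_poincareForm] at hA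
  have hfm := measurable_S2Gamma0 f
  have hGm : Measurable (limitForm m N) := (continuous_limitForm hm N).measurable
  have hPm (k : ℕ) := measurable_slashSum_cut m k (Gamma0 N : Set SL(2, ℤ))
  have hvol := hD.volume_lt_top hN
  have hmr : (0 : ℝ) < m := by exact_mod_cast hm
  -- Unfolding gives one factor e^(-2πmy) from the truncated exponential and one from the m-th
  -- coefficient of f.
  have h1 (k : ℕ) : ∫ z in D, petersson 2 (slashSum m (cut k) (Gamma0 N)) f z =
      fourierCoeff0 m f *
        ((∫ y in Set.Ioi (0 : ℝ), cut k y * Real.exp (-(4 * π * m * y)) : ℝ) : ℂ) := by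
    rw [integral_petersson_slashSum hD hm (measurable_cut k) (abs_cut_le k) (half_pow_pos k)
      (cut_eq_zero k) hfm hB (fun γ hγ => S2Gamma0_slash f hγ), ← integral_complex_ofReal,
      ← integral_const_mul]
    refine setIntegral_congr_fun measurableSet_Ioi fun y hy => ?_
    rw [integral_linePoint_eq_fourierCoeff0 hN f m hy]
    have e : Real.exp (-(4 * π * m * y)) = Real.exp (-(2 * π * m * y)) * Real.exp (-(2 * π * m * y)) := by
      rw [← Real.exp_add]
      congr 1
      ring
    rw [e]
    push_cast
    ring
  have h2 : Filter.Tendsto (fun k => ∫ z in D, petersson 2 (slashSum m (cut k) (Gamma0 N)) f z)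
      Filter.atTop (nhds (fourierCoeff0 m f * ((1 / (4 * π * m) : ℝ) : ℂ))) := by
    simp only [h1]
    exact ((Complex.continuous_ofReal.tendsto _).comp
      (tendsto_integral_cut_mul_exp (by positivity))).const_mul _
  -- L² convergence on a domain of finite volume, paired with the bounded function |f| Im z, is
  -- convergence in L¹.
  have h3 : Filter.Tendsto (fun k => ∫ z in D, petersson 2 (slashSum m (cut k) (Gamma0 N)) f z)
      Filter.atTop (nhds (∫ z in D, petersson 2 (limitForm m N) f z)) := by
    refine tendsto_integral_of_L1 _ (integrableOn_petersson hvol hGm hfm hA hB).aestronglyMeasurable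
      (Filter.Eventually.of_forall fun k => ?_) ?_
    · obtain ⟨C, hC⟩ := exists_norm_slashSum_cut_le hm k
      exact integrableOn_petersson hvol (hPm k) hfm (hC _) hB
    · have hle (k : ℕ) : ∫⁻ z in D, ‖petersson 2 (slashSum m (cut k) (Gamma0 N)) f z -
          petersson 2 (limitForm m N) f z‖ₑ ≤ ENNReal.ofReal B *
          (normSqOn D (fun z => slashSum m (cut k) (Gamma0 N) z - limitForm m N z) ^ (1 / 2 : ℝ) *
            volume D ^ (1 / 2 : ℝ)) := by
        refine le_trans ?_ (mul_le_mul_right (lintegral_norm_le_normSqOn ((hPm k).sub hGm)) _)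
        rw [← lintegral_const_mul' _ _ ENNReal.ofReal_ne_top]
        refine lintegral_mono fun z => ?_
        have hB0 : 0 ≤ B := (mul_nonneg (norm_nonneg _) z.im_pos.le).trans (hB z)
        rw [← ENNReal.ofReal_mul hB0, ← ofReal_norm]
        refine ENNReal.ofReal_le_ofReal ?_
        have e : petersson 2 (slashSum m (cut k) (Gamma0 N)) f z - petersson 2 (limitForm m N) f z =
            petersson 2 (fun z => slashSum m (cut k) (Gamma0 N) z - limitForm m N z) f z := by
          simp only [petersson_two_apply, map_sub]
          ring
        rw [e, norm_petersson_two, mul_comm]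
        exact mul_le_mul_of_nonneg_right (hB z) (mul_nonneg (norm_nonneg _) z.im_pos.le)
      refine tendsto_of_tendsto_of_tendsto_of_le_of_le tendsto_const_nhds ?_ (fun _ => zero_le) hle
      have h4 := (tendsto_normSqOn_sub hN hD hm).ennrpow_const (1 / 2 : ℝ)
      rw [ENNReal.zero_rpow_of_pos (by norm_num)] at h4
      have hv : volume D ^ (1 / 2 : ℝ) ≠ ⊤ := ENNReal.rpow_ne_top_of_nonneg (by norm_num) hvol.ne
      have h5 := ENNReal.Tendsto.const_mul (a := ENNReal.ofReal B)
        (ENNReal.Tendsto.mul_const (b := volume D ^ (1 / 2 : ℝ)) h4 (Or.inr hv))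
        (Or.inr ENNReal.ofReal_ne_top)
      rwa [zero_mul, mul_zero] at h5
  have h6 := tendsto_nhds_unique h3 h2
  rw [peterssonInner, coe_poincareForm, h6]
  push_cast
  ring

end Petersson

/-! ### Fourier coefficients of the Atkin–Lehner image -/

section AtkinLehnerCoefficients

variable {m N Q : ℕ} {D : Set ℍ} {W : GL (Fin 2) ℝ}

theorem normSq_slash_GL (f : ℍ → ℂ) (hW : 0 < W.det.val) (z : ℍ) :
    (‖(f ∣[(2 : ℤ)] W) z‖ * z.im) ^ 2 = (‖f (W • z)‖ * (W • z).im) ^ 2 := by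
  have h1 := petersson_slash 2 f f W z
  rw [petersson_two_self, petersson_two_self, σ, if_pos hW, sub_self, zpow_zero, one_mul] at h1
  exact Complex.ofReal_injective h1

/-- The action of W preserves both the measure and the density, and sends the rectangle into a
compact set, which has bounded multiplicity. -/
theorem exists_lintegral_slash_le (hD : IsGamma0FundamentalDomain N D) (hW : 0 < W.det.val)
    {y₁ : ℝ} (hy : 0 < y₁) (y₂ : ℝ) : ∃ C : ℕ, ∀ f : ℍ → ℂ, Measurable f →
      (∀ γ ∈ Gamma0 N, f ∣[(2 : ℤ)] γ = f) →
      ∫⁻ z in rect y₁ y₂, ENNReal.ofReal ((‖(f ∣[(2 : ℤ)] W) z‖ * z.im) ^ 2) ≤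
        C * normSqOn D f := by
  have hmp : MeasurePreserving (fun z : ℍ => W • z) := measurePreserving_smul W volume
  set A : Set ℍ := {w | W⁻¹ • w ∈ rect y₁ y₂} with hA
  have hAm : MeasurableSet A :=
    (measurePreserving_smul W⁻¹ (volume : Measure ℍ)).measurable (measurableSet_rect y₁ y₂)
  have hpre : rect y₁ y₂ = (fun z : ℍ => W • z) ⁻¹' A := by
    ext z
    simp [hA]
  have hK := (isCompact_rectangle 1 y₂ hy).image (continuous_const_smul W)
  obtain ⟨C, hC⟩ := exists_encard_Gamma0_le (N := N) (A := A) hK fun w hw =>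
    ⟨W⁻¹ • w, rect_subset _ _ hw, smul_inv_smul W w⟩
  refine ⟨C, fun f hf hinv => ?_⟩
  have hmeas : Measurable fun w : ℍ => ENNReal.ofReal ((‖f w‖ * w.im) ^ 2) :=
    ((hf.norm.mul continuous_im.measurable).pow_const 2).ennreal_ofReal
  simp only [normSq_slash_GL f hW]
  rw [hpre, hmp.setLIntegral_comp_preimage hAm hmeas]
  exact lintegral_subset_le hD hAm hC hf hinv

theorem ofReal_normSq_integral_le {u : ℝ → ℂ} (hu : Measurable u) {B : ℝ} (hB : ∀ x, ‖u x‖ ≤ B)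
    (n : ℤ) : ENNReal.ofReal (‖∫ x in (0 : ℝ)..1, u x * expTwoPiI (-(n * x))‖ ^ 2) ≤
      ∫⁻ x in Set.Ioc (0 : ℝ) 1, ENNReal.ofReal (‖u x‖ ^ 2) := by
  rw [lintegral_sq_eq_tsum hu hB]
  exact ENNReal.le_tsum (f := fun n : ℤ =>
    ENNReal.ofReal (‖∫ x in (0 : ℝ)..1, u x * expTwoPiI (-(n * x))‖ ^ 2)) n

/-- The Fourier coefficients of the image of the Poincaré series under the Atkin-Lehner
involution. -/
theorem fourierCoeff0_of_eq_slash [NeZero Q] (hN : 0 < N) (hD : IsGamma0FundamentalDomain N D)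
    (hm : 0 < m) (hQN : Q ∣ N) (hW : IsAtkinLehnerMatrix N Q W) {n : ℕ} (hn : 0 < n)
    {g : S2Gamma0 N} (hg : (g : ℍ → ℂ) = limitForm m N ∣[(2 : ℤ)] W) :
    fourierCoeff0 n g = limitCoeff m (N / Q) Q n := by
  obtain ⟨V, hWV, hV⟩ := hW.exists_isScaleProduct hQN
  obtain ⟨C, hC⟩ := exists_lintegral_slash_le hD hWV.det_pos one_pos 2
  obtain ⟨B, hB⟩ := exists_norm_mul_im_le hN g
  choose A hA using fun k => exists_norm_slashSum_cut_le hm k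
  have hgm := measurable_S2Gamma0 g
  have hGm : Measurable (limitForm m N) := (continuous_limitForm hm N).measurable
  have hPm (k : ℕ) := measurable_slashSum_cut m k (Gamma0 N : Set SL(2, ℤ))
  set u : ℕ → ℍ → ℂ := fun k => poincareSum m (cut k) (N / Q) Q with hu
  have hum (k : ℕ) : Measurable (u k) :=
    measurable_poincareSum m (measurable_cut k) (half_pow_pos k) (cut_eq_zero k) (N / Q) Q
  have hub (k : ℕ) (z : ℍ) : ‖u k z‖ * z.im ≤ A k := by
    rw [norm_poincareSum_mul_im]
    exact hA k _ _
  -- Applying W to the differences keeps the L² convergence on a rectangle. Any range of heights of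
  -- positive length would do.
  have hnorm (k : ℕ) : ∫⁻ y in Set.Icc (1 : ℝ) 2, ∫⁻ x in Set.Ioc (0 : ℝ) 1,
      ENNReal.ofReal (‖u k (linePoint x y) - g (linePoint x y)‖ ^ 2) ≤
      C * normSqOn D (fun z => slashSum m (cut k) (Gamma0 N) z - limitForm m N z) := by
    have e : (fun z => u k z - g z) =
        (fun z => slashSum m (cut k) (Gamma0 N) z - limitForm m N z) ∣[(2 : ℤ)] W := by
      rw [hg, hu]
      simp only [← slashSum_slash_atkinLehner hWV hV]
      ext z
      simp only [ModularForm.slash_apply, map_sub]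
      ring
    rw [← lintegral_rect (f := fun z => u k z - g z) ((hum k).sub hgm) one_pos]
    simp only [congrFun e]
    exact hC _ ((hPm k).sub hGm) fun γ hγ =>
      sub_slash_eq (slashSum_Gamma0_slash m _ hγ) (limitForm_slash hN hD hm hγ)
  have hlim0 : Filter.Tendsto (fun k => (C : ENNReal) * normSqOn D
      (fun z => slashSum m (cut k) (Gamma0 N) z - limitForm m N z)) Filter.atTop (nhds 0) := by
    have := ENNReal.Tendsto.const_mul (a := (C : ENNReal)) (tendsto_normSqOn_sub hN hD hm)
      (Or.inr (by simp))
    rwa [mul_zero] at this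
  set I : ℕ → ℝ → ENNReal := fun k y => ENNReal.ofReal
    (‖∫ x in (0 : ℝ)..1, (u k (linePoint x y) - g (linePoint x y)) * expTwoPiI (-((n : ℤ) * x))‖ ^ 2)
    with hI
  set δ : ℂ := limitCoeff m (N / Q) Q n - fourierCoeff0 n g with hδ
  have hIlim : ∀ y ∈ Set.Icc (1 : ℝ) 2, Filter.Tendsto (fun k => I k y) Filter.atTop
      (nhds (ENNReal.ofReal (‖δ * Real.exp (-(2 * π * n * y))‖ ^ 2))) := by
    intro y hy
    have hy0 : 0 < y := one_pos.trans_le hy.1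
    refine (ENNReal.continuous_ofReal.tendsto _).comp (Filter.Tendsto.pow (Filter.Tendsto.norm ?_) 2)
    have h1 := tendsto_poincareCoeff (M := N / Q) (Q := Q) hm n measurable_cut abs_cut_le
      half_pow_pos cut_eq_zero (fun t ht => tendsto_cut ht) hy0
    rw [if_pos (by exact_mod_cast hn), Int.toNat_natCast] at h1
    have h2 := integral_linePoint_eq_fourierCoeff0 hN g n hy0
    have h3 := h1.sub_const (fourierCoeff0 n g * Real.exp (-(2 * π * n * y)))
    rw [hδ, sub_mul]
    refine h3.congr fun k => ?_
    simp only [sub_mul]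
    rw [intervalIntegral.integral_sub
      (intervalIntegrable_linePoint (hum k) (hub k) n hy0 0 1)
      (intervalIntegrable_linePoint hgm hB n hy0 0 1), ← h2]
    rfl
  have hIle (k : ℕ) : ∫⁻ y in Set.Icc (1 : ℝ) 2, I k y ≤
      C * normSqOn D (fun z => slashSum m (cut k) (Gamma0 N) z - limitForm m N z) := by
    refine (setLIntegral_mono' measurableSet_Icc fun y hy => ?_).trans (hnorm k)
    have hy0 : 0 < y := one_pos.trans_le hy.1
    refine ofReal_normSq_integral_le (u := fun x => u k (linePoint x y) - g (linePoint x y))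
      (B := A k / y + B / y)
      (((hum k).sub hgm).comp (measurable_linePoint_left y)) (fun x => ?_) n
    refine (norm_sub_le _ _).trans (add_le_add ?_ ?_)
    · rw [le_div_iff₀ hy0]
      have := hub k (linePoint x y)
      rwa [linePoint_im hy0] at this
    · rw [le_div_iff₀ hy0]
      have := hB (linePoint x y)
      rwa [linePoint_im hy0] at this
  have hIm (k : ℕ) : Measurable (I k) := by
    refine Measurable.ennreal_ofReal (Measurable.pow_const (Measurable.norm ?_) 2)
    simp only [intervalIntegral.integral_of_le zero_le_one]
    refine (StronglyMeasurable.integral_prod_left' (f := fun p : ℝ × ℝ =>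
      (u k (linePoint p.1 p.2) - g (linePoint p.1 p.2)) * expTwoPiI (-((n : ℤ) * p.1)))
      (Measurable.stronglyMeasurable ?_)).measurable
    have he : Continuous fun p : ℝ × ℝ => expTwoPiI (-((n : ℤ) * p.1)) := by
      unfold expTwoPiI
      fun_prop
    exact (((hum k).sub hgm).comp measurable_linePoint).mul he.measurable
  -- Pointwise in y, the n-th coefficients of the differences tend to δe^(-2πny), while their L²
  -- norms over 1 ≤ y ≤ 2 tend to 0; Fatou forces δ = 0.
  have hzero : ∫⁻ y in Set.Icc (1 : ℝ) 2,
      ENNReal.ofReal (‖δ * Real.exp (-(2 * π * n * y))‖ ^ 2) = 0 := by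
    refine le_antisymm ?_ zero_le
    calc _ = ∫⁻ y in Set.Icc (1 : ℝ) 2, Filter.liminf (fun k => I k y) Filter.atTop :=
          setLIntegral_congr_fun measurableSet_Icc fun y hy => (hIlim y hy).liminf_eq.symm
      _ ≤ Filter.liminf (fun k => ∫⁻ y in Set.Icc (1 : ℝ) 2, I k y) Filter.atTop :=
          lintegral_liminf_le hIm
      _ ≤ Filter.liminf (fun k => (C : ENNReal) * normSqOn D
          (fun z => slashSum m (cut k) (Gamma0 N) z - limitForm m N z)) Filter.atTop :=
          Filter.liminf_le_liminf (Filter.Eventually.of_forall hIle)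
      _ = 0 := hlim0.liminf_eq
  by_contra hne
  have hδ0 : δ ≠ 0 := fun h => hne (sub_eq_zero.1 h).symm
  have hpos : ∀ y ∈ Set.Icc (1 : ℝ) 2, ENNReal.ofReal ((‖δ‖ * Real.exp (-(4 * π * n))) ^ 2) ≤
      ENNReal.ofReal (‖δ * Real.exp (-(2 * π * n * y))‖ ^ 2) := by
    intro y hy
    refine ENNReal.ofReal_le_ofReal (pow_le_pow_left₀ (by positivity) ?_ 2)
    rw [norm_mul, Complex.norm_real, Real.norm_of_nonneg (Real.exp_nonneg _)]
    refine mul_le_mul_of_nonneg_left (Real.exp_le_exp.2 ?_) (norm_nonneg _)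
    have : 2 * π * n * y ≤ 2 * π * n * 2 := mul_le_mul_of_nonneg_left hy.2 (by positivity)
    linarith
  have h := setLIntegral_mono' (μ := volume) measurableSet_Icc hpos
  rw [hzero, setLIntegral_const, Real.volume_Icc] at h
  have h9 : 0 < ENNReal.ofReal ((‖δ‖ * Real.exp (-(4 * π * n))) ^ 2) := by
    rw [ENNReal.ofReal_pos]
    have := norm_pos_iff.2 hδ0
    positivity
  norm_num at h
  exact absurd h9 (by simpa using h)

end AtkinLehnerCoefficients

/-! ### Linear forms on cusp forms and definiteness of the Petersson product -/

section Eigenbasis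

variable {m n N Q : ℕ} {D : Set ℍ} {W : GL (Fin 2) ℝ}

/-- The Fourier coefficients, as linear forms. -/
def fourierCoeffLin (hN : 0 < N) (n : ℕ) : S2Gamma0 N →ₗ[ℂ] ℂ where
  toFun := fourierCoeff0 n
  map_add' f g := by
    have : NeZero N := ⟨hN.ne'⟩
    rw [fourierCoeff0, FunLike.coe_add, ModularForm.qExpansion_add one_pos
      (by rw [strictPeriods_Gamma0]; exact AddSubgroup.mem_zmultiples 1), map_add]
    rfl
  map_smul' c f := by
    have : NeZero N := ⟨hN.ne'⟩
    rw [fourierCoeff0, FunLike.coe_smul, ModularForm.qExpansion_smul one_pos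
      (by rw [strictPeriods_Gamma0]; exact AddSubgroup.mem_zmultiples 1), map_smul]
    rfl

theorem integrableOn_petersson_S2Gamma0 (hN : 0 < N) (hD : IsGamma0FundamentalDomain N D)
    (f g : S2Gamma0 N) : IntegrableOn (petersson 2 f g) D := by
  obtain ⟨A, hA⟩ := exists_norm_mul_im_le hN f
  obtain ⟨B, hB⟩ := exists_norm_mul_im_le hN g
  exact integrableOn_petersson (hD.volume_lt_top hN) (measurable_S2Gamma0 f) (measurable_S2Gamma0 g)
    hA hB

/-- The Petersson product, as a linear form in the second variable. -/
def peterssonLin (hN : 0 < N) (hD : IsGamma0FundamentalDomain N D) (f : S2Gamma0 N) :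
    S2Gamma0 N →ₗ[ℂ] ℂ where
  toFun := peterssonInner D f
  map_add' g h := by
    rw [peterssonInner, peterssonInner, peterssonInner,
      ← integral_add (integrableOn_petersson_S2Gamma0 hN hD f g)
        (integrableOn_petersson_S2Gamma0 hN hD f h)]
    congr 1
    ext z
    simp only [petersson_two_apply, FunLike.coe_add, Pi.add_apply]
    ring
  map_smul' c g := by
    rw [RingHom.id_apply, peterssonInner, peterssonInner, smul_eq_mul, ← integral_const_mul]
    congr 1
    ext z
    simp only [petersson_two_apply, FunLike.coe_smul, Pi.smul_apply, smul_eq_mul]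
    ring

theorem peterssonInner_conj (f g : S2Gamma0 N) :
    conj (peterssonInner D f g) = peterssonInner D g f := by
  rw [peterssonInner, peterssonInner, ← integral_conj]
  congr 1
  ext z
  exact (petersson_symm 2 f g z).symm

/-- A zero norm over D would, by bounded multiplicity, give zero norm over a small open set on which
f does not vanish. -/
theorem peterssonInner_self_ne_zero (hN : 0 < N) (hD : IsGamma0FundamentalDomain N D)
    {f : S2Gamma0 N} (hf : f ≠ 0) : peterssonInner D f f ≠ 0 := by
  intro h0
  have hns := normSqOn_eq (integrableOn_petersson_S2Gamma0 hN hD f f)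
  have h0' : ∫ z in D, petersson 2 f f z = 0 := h0
  rw [h0', norm_zero, ENNReal.ofReal_zero] at hns
  have hfc : Continuous f := (CuspFormClass.holo f).continuous
  obtain ⟨z₀, hz₀⟩ : ∃ z, f z ≠ 0 := by
    by_contra! hall
    exact hf (DFunLike.ext _ _ hall)
  obtain ⟨K, hK, hKz⟩ := exists_compact_mem_nhds z₀
  set U : Set ℍ := interior K ∩ {z | f z ≠ 0} with hU
  have hUo : IsOpen U := isOpen_interior.inter (isOpen_ne_fun hfc continuous_const)
  obtain ⟨C, hC⟩ := exists_encard_Gamma0_le (N := N) hK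
    (show U ⊆ K from fun z hz => interior_subset hz.1)
  have h1 := lintegral_subset_le hD hUo.measurableSet hC (measurable_S2Gamma0 f)
    fun γ hγ => S2Gamma0_slash f hγ
  have hm : Measurable fun z : ℍ => ENNReal.ofReal ((‖f z‖ * z.im) ^ 2) :=
    ((((measurable_S2Gamma0 f).norm.mul continuous_im.measurable).pow_const 2).ennreal_ofReal)
  rw [hns, mul_zero, nonpos_iff_eq_zero, lintegral_eq_zero_iff hm] at h1
  have h2 : ∀ᵐ z ∂(volume : Measure ℍ).restrict U, False := by
    filter_upwards [h1, ae_restrict_mem hUo.measurableSet] with z hz hzU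
    have h3 : 0 < (‖f z‖ * z.im) ^ 2 := pow_pos (mul_pos (norm_pos_iff.2 hzU.2) z.im_pos) 2
    exact absurd hz (ENNReal.ofReal_pos.2 h3).ne'
  rw [Filter.eventually_false_iff_eq_bot, ae_eq_bot, Measure.restrict_eq_zero] at h2
  exact (hUo.measure_pos volume ⟨z₀, mem_interior_iff_mem_nhds.2 hKz, hz₀⟩).ne' h2

/-- The linear map from cusp forms to functions. -/
def coeLin (N : ℕ) : S2Gamma0 N →ₗ[ℂ] (ℍ → ℂ) where
  toFun f := f
  map_add' _ _ := rfl
  map_smul' _ _ := rfl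

/-- The slash operator of a matrix of positive determinant, as a linear map. -/
def slashLin (hW : 0 < W.det.val) : (ℍ → ℂ) →ₗ[ℂ] (ℍ → ℂ) where
  toFun f := f ∣[(2 : ℤ)] W
  map_add' f g := SlashAction.add_slash 2 W f g
  map_smul' c f := by
    rw [ModularForm.smul_slash, σ, if_pos hW]
    rfl

end Eigenbasis

/-! ### The spectral expansion and the trace formula -/

section Formula

variable {m n N Q : ℕ} {D : Set ℍ} {W : GL (Fin 2) ℝ}

theorem kloostermanTermTwisted_one (m n c : ℕ) [NeZero c] :
    kloostermanTermTwisted 1 m n c = kloostermanTerm m n c := by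
  have h : ((1 : ℕ) : ZMod c)⁻¹ = 1 := by
    rw [Nat.cast_one]
    exact ZMod.inv_one c
  rw [kloostermanTermTwisted, kloostermanTerm, h, mul_one, Nat.cast_one, Real.sqrt_one,
    Complex.ofReal_one, mul_one]

/-- The moduli prime to `1`. -/
def modulusOneEquiv (N : ℕ) : {c : ℕ+ // N ∣ (c : ℕ)} ≃ Modulus N 1 :=
  Equiv.subtypeEquivRight fun c => by simp

theorem summable_kloostermanTerm (hm : 0 < m) (hn : 0 < n) (N : ℕ) :
    Summable fun c : {c : ℕ+ // N ∣ (c : ℕ)} => kloostermanTerm m n (c.1 : ℕ) := by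
  have h := (modulusOneEquiv N).summable_iff.2
    (summable_kloostermanTermTwisted (M := N) (Q := 1) hm hn)
  refine h.congr fun c => ?_
  exact kloostermanTermTwisted_one m n _

theorem tsum_kloostermanTermTwisted_one (m n N : ℕ) :
    ∑' c : Modulus N 1, kloostermanTermTwisted 1 m n (c.1 : ℕ) =
      ∑' c : {c : ℕ+ // N ∣ (c : ℕ)}, kloostermanTerm m n (c.1 : ℕ) := by
  rw [← (modulusOneEquiv N).tsum_eq]
  exact tsum_congr fun c => kloostermanTermTwisted_one m n _

/-- The sum over the eigenforms with given eigenvalue, in terms of the Poincaré series. -/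
theorem finsum_eigenbasis_eq [NeZero Q] (hm : 0 < m) (hn : 0 < n) (hN : 0 < N) (hQN : Q ∣ N)
    {ε : ℂ} (hε : ε = 1 ∨ ε = -1) (hD : IsGamma0FundamentalDomain N D)
    (hW : IsAtkinLehnerMatrix N Q W) {ι : Type*} (B : Module.Basis ι ℂ (S2Gamma0 N))
    (hB : IsAtkinLehnerEigenbasis D W B) :
    ∑ᶠ i ∈ {i : ι | (⇑(B i) : ℍ → ℂ) ∣[(2 : ℤ)] W = ε • (⇑(B i) : ℍ → ℂ)},
      conj (fourierCoeff0 m (B i)) * fourierCoeff0 n (B i) / peterssonInner D (B i) (B i) =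
    2 * π * m * (limitCoeff m N 1 n + ε * limitCoeff m (N / Q) Q n) := by
  classical
  obtain ⟨V, hWV, -⟩ := hW.exists_isScaleProduct hQN
  obtain ⟨γ, hγ, hsq⟩ := hW.exists_sq hQN
  choose a ha using hB.eigenvector
  have hmc : (m : ℂ) ≠ 0 := by exact_mod_cast hm.ne'
  have hπ : (π : ℂ) ≠ 0 := by exact_mod_cast Real.pi_ne_zero
  have hB0 (i : ι) : (⇑(B i) : ℍ → ℂ) ≠ 0 := fun h => B.ne_zero i (DFunLike.coe_injective h)
  -- W² acts as an element of Γ₀(N), which fixes the cusp form.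
  have ha2 (i : ι) : a i * a i = 1 := by
    have h1 := hsq (B i)
    rw [S2Gamma0_slash (B i) hγ, ha i] at h1
    have h2 := (slashLin hWV.det_pos).map_smul (a i) (B i)
    change (a i • (⇑(B i) : ℍ → ℂ)) ∣[(2 : ℤ)] W = a i • ((⇑(B i) : ℍ → ℂ) ∣[(2 : ℤ)] W) at h2
    rw [h2, ha i, smul_smul] at h1
    have h3 : (a i * a i - 1) • (⇑(B i) : ℍ → ℂ) = 0 := by
      rw [sub_smul, h1, one_smul, sub_self]
    exact sub_eq_zero.1 ((smul_eq_zero.1 h3).resolve_right (hB0 i))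
  set G := poincareForm hN hD hm with hG
  set x := B.repr G with hx
  have hxsum : x.sum (fun i c => c • B i) = G := B.linearCombination_repr G
  -- Pairing with the i-th basis form isolates one coordinate of G. The conjugate appears because
  -- the reproducing formula has G in the first variable.
  have hxp (i : ι) : x i * peterssonInner D (B i) (B i) =
      conj (fourierCoeff0 m (B i)) / (4 * π * m) := by
    have h1 : peterssonLin hN hD (B i) G = x i * peterssonInner D (B i) (B i) := by
      rw [← hxsum, map_finsuppSum, Finsupp.sum_eq_single i]
      · rw [map_smul]; rfl
      · intro j _ hji
        rw [map_smul]
        change x j • peterssonInner D (B i) (B j) = 0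
        rw [hB.orthogonal i j hji.symm, smul_zero]
      · intro _
        rw [zero_smul, map_zero]
    rw [← h1]
    change peterssonInner D (B i) G = _
    rw [← peterssonInner_conj, hG, peterssonInner_poincareForm hN hD hm,
      map_div₀, map_mul, map_mul, Complex.conj_ofReal, map_natCast, map_ofNat]
  have hF (i : ι) : conj (fourierCoeff0 m (B i)) * fourierCoeff0 n (B i) /
      peterssonInner D (B i) (B i) = 4 * π * m * x i * fourierCoeff0 n (B i) := by
    have hp := peterssonInner_self_ne_zero hN hD (B.ne_zero i)
    have h := hxp i
    rw [eq_div_iff (mul_ne_zero (mul_ne_zero (by norm_num) hπ) hmc)] at h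
    rw [div_eq_iff hp, ← h]
    ring
  have hmem (i : ι) : (⇑(B i) : ℍ → ℂ) ∣[(2 : ℤ)] W = ε • (⇑(B i) : ℍ → ℂ) ↔ a i = ε := by
    rw [ha i]
    constructor
    · intro h
      have h3 : (a i - ε) • (⇑(B i) : ℍ → ℂ) = 0 := by rw [sub_smul, h, sub_self]
      exact sub_eq_zero.1 ((smul_eq_zero.1 h3).resolve_right (hB0 i))
    · rintro h
      rw [h]
  -- Both a and ε are ±1, so (1 + εa)/2 is the indicator of a = ε.
  have hite (i : ι) (c : ℂ) : (if a i = ε then c else 0) = 2⁻¹ * (1 + ε * a i) * c := by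
    have hε2 : ε * ε = 1 := by rcases hε with rfl | rfl <;> norm_num
    split_ifs with h
    · rw [h, hε2]
      ring
    · have : a i = -ε := by
        have h4 : (a i - ε) * (a i + ε) = 0 := by linear_combination ha2 i - hε2
        exact eq_neg_of_add_eq_zero_left
          ((mul_eq_zero.1 h4).resolve_left fun h5 => h (sub_eq_zero.1 h5))
      rw [this]
      linear_combination (2⁻¹ * c) * hε2
  -- Defining the involution through the eigenbasis shows at once that G|W is a cusp form.
  set T : S2Gamma0 N →ₗ[ℂ] S2Gamma0 N := B.constr ℂ fun i => a i • B i with hT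
  have hTW : (⇑(T G) : ℍ → ℂ) = (⇑G : ℍ → ℂ) ∣[(2 : ℤ)] W := by
    have h : (coeLin N).comp T = (slashLin hWV.det_pos).comp (coeLin N) := by
      refine B.ext fun i => ?_
      rw [LinearMap.comp_apply, hT, B.constr_basis]
      exact (ha i).symm
    exact LinearMap.congr_fun h G
  have hTn : fourierCoeff0 n (T G) = ∑ i ∈ x.support, x i * a i * fourierCoeff0 n (B i) := by
    have h : fourierCoeff0 n (T G) = fourierCoeffLin hN n (T G) := rfl
    rw [h, hT, B.constr_apply, map_finsuppSum]
    refine Finset.sum_congr rfl fun i _ => ?_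
    change fourierCoeffLin hN n (x i • a i • B i) = _
    rw [map_smul, map_smul, smul_eq_mul, smul_eq_mul, ← mul_assoc]
    rfl
  have hGn : fourierCoeff0 n G = ∑ i ∈ x.support, x i * fourierCoeff0 n (B i) := by
    have h : fourierCoeff0 n G = fourierCoeffLin hN n G := rfl
    rw [h, ← hxsum, map_finsuppSum]
    refine Finset.sum_congr rfl fun i _ => ?_
    change fourierCoeffLin hN n (x i • B i) = _
    rw [map_smul, smul_eq_mul]
    rfl
  rw [fourierCoeff0_poincareForm hN hD hm hn] at hGn
  rw [fourierCoeff0_of_eq_slash hN hD hm hQN hW hn (hTW.trans (by rw [hG, coe_poincareForm]))] at hTn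
  -- The terms are proportional to the coordinates of G, hence vanish off a finite set even if the
  -- basis is not known to be finite.
  rw [finsum_mem_def, finsum_eq_sum_of_support_subset (s := x.support)]
  · rw [hGn, hTn, Finset.mul_sum, ← Finset.sum_add_distrib, Finset.mul_sum]
    refine Finset.sum_congr rfl fun i _ => ?_
    have hi : Set.indicator {i : ι | (⇑(B i) : ℍ → ℂ) ∣[(2 : ℤ)] W = ε • (⇑(B i) : ℍ → ℂ)}
        (fun i => conj (fourierCoeff0 m (B i)) * fourierCoeff0 n (B i) /
          peterssonInner D (B i) (B i)) i = if a i = ε then conj (fourierCoeff0 m (B i)) *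
          fourierCoeff0 n (B i) / peterssonInner D (B i) (B i) else 0 := by
      rw [Set.indicator_apply]
      exact if_congr (hmem i) rfl rfl
    rw [hi, hite, hF]
    ring
  · intro i hi
    rw [Function.mem_support, Set.indicator_apply] at hi
    rw [Finset.mem_coe, Finsupp.mem_support_iff]
    intro h0
    refine hi ?_
    rw [hF, h0]
    simp

end Formula

end

theorem proposition1p3 (m n N Q : ℕ) (hm : 0 < m) (hn : 0 < n) (hN : 0 < N)
    (hQN : Q ∣ N) (hQ : 1 < Q) (hcop : Nat.Coprime Q (N / Q))
    (ε : ℂ) (hε : ε = 1 ∨ ε = -1)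
    (D : Set ℍ) (hD : IsGamma0FundamentalDomain N D)
    (W : GL (Fin 2) ℝ) (hW : IsAtkinLehnerMatrix N Q W)
    {ι : Type*} (B : Module.Basis ι ℂ (S2Gamma0 N)) (hB : IsAtkinLehnerEigenbasis D W B) :
    Summable (fun c : {c : ℕ+ // N ∣ (c : ℕ)} => kloostermanTerm m n (c.1 : ℕ)) ∧
    Summable (fun c : {c : ℕ+ // N / Q ∣ (c : ℕ) ∧ Nat.Coprime (c : ℕ) Q} =>
      kloostermanTermTwisted Q m n (c.1 : ℕ)) ∧
    1 / (2 * π * (√((m : ℝ) * n) : ℝ) : ℂ) *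
        ∑ᶠ i ∈ {i : ι | (⇑(B i) : ℍ → ℂ) ∣[(2 : ℤ)] W = ε • (⇑(B i) : ℍ → ℂ)},
          conj (fourierCoeff0 m (B i)) * fourierCoeff0 n (B i) / peterssonInner D (B i) (B i) =
      (if m = n then 1 else 0)
        - 2 * π * ∑' c : {c : ℕ+ // N ∣ (c : ℕ)}, kloostermanTerm m n (c.1 : ℕ)
        - 2 * π * ε * ∑' c : {c : ℕ+ // N / Q ∣ (c : ℕ) ∧ Nat.Coprime (c : ℕ) Q},
            kloostermanTermTwisted Q m n (c.1 : ℕ) := by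
  have : NeZero Q := ⟨by omega⟩
  refine ⟨summable_kloostermanTerm hm hn N, summable_kloostermanTermTwisted hm hn, ?_⟩
  rw [finsum_eigenbasis_eq hm hn hN hQN hε hD hW B hB, limitCoeff, limitCoeff,
    tsum_kloostermanTermTwisted_one, if_neg (fun h : Q = 1 ∧ m = n => hQ.ne' h.1)]
  simp only [true_and]
  have hmc : (m : ℂ) ≠ 0 := by exact_mod_cast hm.ne'
  have hπ : (π : ℂ) ≠ 0 := by exact_mod_cast Real.pi_ne_zero
  have hs : ((√((m : ℝ) * n) : ℝ) : ℂ) ≠ 0 := by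
    have : 0 < √((m : ℝ) * n) := Real.sqrt_pos.2 (by positivity)
    exact_mod_cast this.ne'
  -- The normalisation leaves m/√(mn) in front of the diagonal term, which is 1 when m = n.
  have hδ : (m : ℂ) * (if m = n then 1 else 0) =
      ((√((m : ℝ) * n) : ℝ) : ℂ) * (if m = n then 1 else 0) := by
    split_ifs with h
    · rw [h, Real.sqrt_mul_self (by positivity)]
      simp
    · simp
  unfold Modulus
  push_cast
  field_simp
  linear_combination hδ
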